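/- **Setting.** $\mathbb{RP}^3$ and $\mathbb{RP}^2$ are the sets of classes $[x]$ of non-zero vectors of $\mathbb R^4$, $\mathbb R^3$ up to non-zero scalars; an invertible matrix acts by $A[x]=[Ax]$. For $\omega\in\mathbb R^3$, $\omega^\times$ is the skew matrix with $\omega^\times v=\omega\times v$; $\Pi_y=I_3-yy^\top/|y|^2$ for $y\ne0$ in $\mathbb R^3$ and $\bar\Pi_x=I_4-xx^\top/|x|^2$ for $x\neq 0$ in $\mathbb R^4$. $SE(3)$ is the group of matrices $\begin{pmatrix}R&x\\0&1\end{pmatrix}$ and $SOT(3)$ the group of matrices $\begin{pmatrix}R&0\\0&a\end{pmatrix}$, with $R\in SO(3)$, $x\in\mathbb R^3$, $a\in\mathbb R\setminus\{0\}$; $R_P$ is the rotation part of $P\in SE(3)$. Let $n=n_p+n_b$. The SLAM manifold $\mathcal M_n(3)$ is the quotient of $SE(3)\times(\mathbb{RP}^3)^n$ by $(P,\eta_i)\simeq(SP,S\eta_i)$, $S\in SE(3)$. The reduced total space $\mathring{\mathcal T}$ consists of the $(P,\eta_i)$ such that $P^{-1}\eta_i=[q;r]$ has $r\ne0$, $q\neq0$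 for $i\le n_p$ (point landmarks) and $r=0$ for $i>n_p$ (bearing landmarks). Put $h_i(P,\eta)=[q]\in\mathbb{RP}^2$. The group $VSLAM_n(3)=SE(3)\times SOT(3)^n$ acts by $\Upsilon((A,Q_i),(P,\eta_i))=(PA,PAQ_i^{-1}P^{-1}\eta_i)$. Let $U=\begin{pmatrix}\Omega^\times&V\\0&0\end{pmatrix}$ be a continuous velocity input on $[0,\infty)$ and let $\xi=(P,\eta_i)$ be the true state: $\dot P=PU$, $\dot\eta_i=0$, with $\xi(t)\in\mathring{\mathcal T}$ for all $t\ge0$. Put $y_i=h_i(\xi)$. *Gains.* Let $k_G,k_H>0$ and $k>\frac12$. For $i\le n_p$ let $\Sigma_i$ solve, on $[0,\infty)$, $$\dot\Sigma_i=\Sigma_i\Omega^\times-\Omega^\times\Sigma_i+k_HI_3-\Sigma_i\Pi_{y_i}k_G\Pi_{y_i}\Sigma_i,\qquad \Sigma_i(0)=\Sigma_i(0)^\top>0,$$ put $G_i=k_GI_3$, and assume that there are $\delta,\mu>0$ with $\frac1\delta\int_t^{t+\delta}\Pi_{R_P(s)y_i(s)}\,ds\ge\mu I_3$ for all $t>0$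 and all $i\le n_p$. For $i>n_p$ put $\Sigma_i=G_i=I_3$. Put $K_i=k\Sigma_i\Pi_{y_i}G_i$. *Observer.* For a reference configuration $\mathring\xi\in\mathring{\mathcal T}$ consider $\hat X=(\hat A,\hat Q_i)\in VSLAM_n(3)$ and $\hat\xi=(\hat P,\hat\eta_i)=\Upsilon(\hat X,\mathring\xi)$ with $\hat X(0)=\mathrm{id}$ (so $\hat\xi(0)=\mathring\xi$), $$\dot{\hat A}=\hat A(U+\Delta_{\hat A}),\qquad \dot{\hat Q}_i=\hat Q_i\bigl(W(U,\hat P^{-1}\hat\eta_i)+\Delta_{\hat Q_i}\bigr),$$ $$W\!\left(U,\begin{bmatrix}q\\r\end{bmatrix}\right)=\begin{pmatrix}\bigl(\Omega-r\tfrac{V\times q}{|q|^2}\bigr)^\times&0\\0&-r\tfrac{V^\top q}{|q|^2}\end{pmatrix},\qquad \Delta_{\hat Q_i}=\begin{pmatrix}(\hat y_i^\times K_i\Pi_{y_i}\hat y_i)^\times&0\\0&-\hat y_i^\top K_i\Pi_{y_i}\hat y_i\end{pmatrix},$$ where $\hat y_i$ is a representative of norm one of $h_i(\hat\xi)$, and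 where $\Delta_{\hat A}=\begin{pmatrix}\Delta_{\hat R}^\times&\Delta_{\hat x}\\0&0\end{pmatrix}$ is, at every time, a least-squares solution, i.e. $(\Delta_{\hat R},\Delta_{\hat x})\in\mathbb R^6$ minimises $$\sum_{i=1}^n\left|\frac1{|\hat\theta_i|}\bar\Pi_{\hat\theta_i}\left(\begin{pmatrix}-(\hat\theta_i^{1:3})^\times&\hat\theta_i^4I_3\\0&0\end{pmatrix}\begin{pmatrix}\Delta_{\hat R}\\\Delta_{\hat x}\end{pmatrix}+\Delta_{\hat Q_i}\hat\theta_i\right)\right|^2,\qquad[\hat\theta_i]=\hat P^{-1}\hat\eta_i .$$ *Errors.* For $i\le n_p$ let $e_i$ be the difference of the positions $q/r\in\mathbb R^3$ of $\hat P^{-1}\hat\eta_i$ and of $P^{-1}\eta_i$. For $i>n_p$ let $c_i$ be the cosine of the angle between $y_i$ and $\hat y_i$. Put $\mathcal L=\sum_{i\le n_p}\frac12e_i^\top\Sigma_i^{-1}e_i+\sum_{i>n_p}\frac12(1-c_i^2)$ and $\mathcal E=\sum_{i\le n_p}|e_i|^2+\sum_{i>n_p}(1-c_i^2)$. Say that $\hat\xi$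 *converges to $\xi$ up to equivalence on $\mathcal M_n(3)$* if there are $\zeta(t)\simeq\hat\xi(t)$ whose pose is $P(t)$ and whose landmarks converge in $\mathbb{RP}^3$ to the (constant) $\eta_i$. The *basin of attraction* $\mathcal B$ is the set of $\mathring\xi\in\mathring{\mathcal T}$ for which the observer equations have a solution on $[0,\infty)$ and every such solution converges to $\xi$ in this sense. **Theorem.** The estimated state converges to the true state almost-globally asymptotically, and exponentially in the large, up to equivalence on $\mathcal M_n(3)$. That is: 1. *(Almost-global attraction)* For every pose $\mathring P\in SE(3)$ and Lebesgue-almost all $p_1,\dots,p_{n_p},b_1,\dots,b_{n_b}\in\mathbb R^3$ (with all $b_j\ne0$), the reference configuration $(\mathring P,[p_1;1],\dots,[p_{n_p};1],[b_1;0],\dots,[b_{n_b};0])$ belongs to $\mathcal B$. 2. *(Stability)* For every $\varepsilon>0$ there is $\delta'>0$ such that for every $\mathring\xi\in\mathring{\mathcal T}$ with $\mathcal E(0)<\delta'$ and every solution of the observer equations on an interval $[0,T]$, $\mathcal E(t)<\varepsilon$ for all $t\in[0,T]$. 3. *(Exponential convergence in the large)* For every compact $\mathcal K\subseteq\mathcal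 B$ there are $\lambda,M>0$ such that for every $\mathring\xi\in\mathcal K$, every solution of the observer equations on $[0,\infty)$ and every $t\ge0$, $\mathcal L(t)\le e^{-\lambda t}\mathcal L(0)$ and $\mathcal E(t)\le Me^{-\lambda t}\mathcal E(0)$. -/

import Mathlib

open scoped Matrix LinearAlgebra.Projectivization Topology
open Set Filter MeasureTheory

noncomputable section

namespace VisualSlam

/-! ### Vectors, matrices and real projective space -/

/-- Column vectors of `ℝ³`. All Euclidean norms below are written through the dot product `⬝ᵥ`. -/
abbrev R3 := Fin 3 → ℝ

/-- Index set of homogeneous coordinates: the first three coordinates and the fourth one. -/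
abbrev HIdx := Fin 3 ⊕ Unit

/-- Column vectors of `ℝ⁴` in the block form `(q, r)` with `q ∈ ℝ³` and `r ∈ ℝ`. -/
abbrev R4 := HIdx → ℝ

/-- The vector `(q, r)` of `ℝ⁴`. -/
def hom (q : R3) (r : ℝ) : R4 := Sum.elim q (fun _ => r)

/-- The first three coordinates `x_{1:3}`. -/
def head (x : R4) : R3 := fun a => x (Sum.inl a)

/-- The fourth coordinate `x_4`. -/
def last (x : R4) : ℝ := x (Sum.inr ())

/-- The skew-symmetric matrix `ω^×` of a vector. -/
def skew (ω : R3) : Matrix (Fin 3) (Fin 3) ℝ :=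
  !![0, -ω 2, ω 1; ω 2, 0, -ω 0; -ω 1, ω 0, 0]

/-- The projector `I - y yᵀ / |y|²` (in `ℝ³` and in `ℝ⁴`). It does not change when `y` is multiplied
by a non-zero scalar. -/
def proj {ι : Type} [Fintype ι] [DecidableEq ι] (y : ι → ℝ) : Matrix ι ι ℝ :=
  1 - (y ⬝ᵥ y)⁻¹ • Matrix.vecMulVec y y

abbrev RP2 := ℙ ℝ R3

abbrev RP3 := ℙ ℝ R4

/-- The quotient topology of the real projective space. -/
instance instTopRP3 : TopologicalSpace RP3 :=
  TopologicalSpace.coinduced (Projectivization.mk' ℝ) inferInstance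

/-- Invertible `4 × 4` matrices act on `ℝ⁴` by matrix-vector multiplication; through this instance
they act on `RP3` by `A [x] = [A x]`. -/
instance instGLAct : DistribMulAction (GL HIdx ℝ) R4 where
  smul g v := (g : Matrix HIdx HIdx ℝ) *ᵥ v
  one_smul v := by
    change ((1 : GL HIdx ℝ) : Matrix HIdx HIdx ℝ) *ᵥ v = v
    simp
  mul_smul g h v := by
    change ((g * h : GL HIdx ℝ) : Matrix HIdx HIdx ℝ) *ᵥ v
      = (g : Matrix HIdx HIdx ℝ) *ᵥ ((h : Matrix HIdx HIdx ℝ) *ᵥ v)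
    simp [Matrix.mulVec_mulVec]
  smul_zero g := by
    change (g : Matrix HIdx HIdx ℝ) *ᵥ (0 : R4) = 0
    simp
  smul_add g v w := by
    change (g : Matrix HIdx HIdx ℝ) *ᵥ (v + w)
      = (g : Matrix HIdx HIdx ℝ) *ᵥ v + (g : Matrix HIdx HIdx ℝ) *ᵥ w
    exact Matrix.mulVec_add _ _ _

theorem gl_smul_def (g : GL HIdx ℝ) (v : R4) : g • v = (g : Matrix HIdx HIdx ℝ) *ᵥ v := rfl

instance instGLComm : SMulCommClass (GL HIdx ℝ) ℝ R4 where
  smul_comm g c v := by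
    simp only [gl_smul_def, Matrix.mulVec_smul]

theorem hom_one_ne_zero (p : R3) : hom p 1 ≠ 0 := fun h => by
  have := congrFun h (Sum.inr ())
  simp [hom] at this

theorem hom_zero_ne_zero {b : R3} (hb : b ≠ 0) : hom b 0 ≠ 0 := fun h => hb <| by
  funext a
  have := congrFun h (Sum.inl a)
  simpa [hom] using this

/-- The projective point `[p; 1]` of a position `p ∈ ℝ³`. -/
def boundPt (p : R3) : RP3 := Projectivization.mk ℝ (hom p 1) (hom_one_ne_zero p)

/-- The projective point `[b; 0]` of a direction `b ≠ 0`. -/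
def freePt (b : R3) (hb : b ≠ 0) : RP3 := Projectivization.mk ℝ (hom b 0) (hom_zero_ne_zero hb)

/-- Point-type elements other than `[0; 1]`. -/
def pointOrbit : Set RP3 := {x | last x.rep ≠ 0 ∧ x ≠ boundPt 0}

/-- Bearing-type elements. -/
def bearingOrbit : Set RP3 := {x | last x.rep = 0}

/-- The position `x_{1:3} / x_4 ∈ ℝ³` of a point-type element `[x]`. -/
def position (x : RP3) : R3 := (last x.rep)⁻¹ • head x.rep

open Classical in
/-- The calibrated camera `[x] ↦ [x_{1:3}]`. The excluded element `[0; 1]`, which has no image, gets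
an arbitrary value. -/
def camera (x : RP3) : RP2 :=
  if h : head x.rep ≠ 0 then Projectivization.mk ℝ (head x.rep) h
  else Projectivization.mk ℝ (fun _ => (1 : ℝ)) (fun h0 => one_ne_zero (congrFun h0 0))

/-- A representative of norm one of an element of `RP2`; it is determined up to its sign. -/
def unitRep (y : RP2) : R3 := (Real.sqrt (y.rep ⬝ᵥ y.rep))⁻¹ • y.rep

/-! ### The groups `SE(3)`, `SOT(3)` and `VSLAM_n(3)` -/

/-- The matrix `[R, x; 0, 1]`. -/
def rigidMat (R : Matrix (Fin 3) (Fin 3) ℝ) (x : R3) : Matrix HIdx HIdx ℝ :=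
  Matrix.fromBlocks R (Matrix.replicateCol Unit x) 0 1

/-- The matrix `[R, 0; 0, a]`. -/
def scaledMat (R : Matrix (Fin 3) (Fin 3) ℝ) (a : ℝ) : Matrix HIdx HIdx ℝ :=
  Matrix.fromBlocks R 0 0 (a • (1 : Matrix Unit Unit ℝ))

theorem so3_mul_transpose {R : Matrix (Fin 3) (Fin 3) ℝ}
    (hR : R ∈ Matrix.specialOrthogonalGroup (Fin 3) ℝ) : R * Rᵀ = 1 := by
  have h := (Matrix.mem_specialOrthogonalGroup_iff.1 hR).1
  simpa [Matrix.star_eq_conjTranspose] using (Matrix.mem_orthogonalGroup_iff (Fin 3) ℝ).1 h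

theorem so3_transpose_mem {R : Matrix (Fin 3) (Fin 3) ℝ}
    (hR : R ∈ Matrix.specialOrthogonalGroup (Fin 3) ℝ) :
    Rᵀ ∈ Matrix.specialOrthogonalGroup (Fin 3) ℝ := by
  have h1 := so3_mul_transpose hR
  rw [Matrix.mem_specialOrthogonalGroup_iff, Matrix.mem_orthogonalGroup_iff]
  refine ⟨?_, ?_⟩
  · simpa [Matrix.star_eq_conjTranspose] using mul_eq_one_comm.1 h1
  · rw [Matrix.det_transpose]
    exact (Matrix.mem_specialOrthogonalGroup_iff.1 hR).2

/-- The special Euclidean group, as a group of invertible `4 × 4` matrices. -/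
def SE3 : Subgroup (GL HIdx ℝ) where
  carrier := {g | ∃ R ∈ Matrix.specialOrthogonalGroup (Fin 3) ℝ, ∃ x : R3,
    (g : Matrix HIdx HIdx ℝ) = rigidMat R x}
  mul_mem' := by
    rintro g h ⟨R, hR, x, hg⟩ ⟨S, hS, y, hh⟩
    refine ⟨R * S, mul_mem hR hS, R *ᵥ y + x, ?_⟩
    rw [Units.val_mul, hg, hh, rigidMat, rigidMat, rigidMat, Matrix.fromBlocks_multiply]
    congr 1
    · simp
    · ext a b
      simp [Matrix.mul_apply, Matrix.mulVec, dotProduct]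
    · simp
    · simp
  one_mem' := ⟨1, one_mem _, 0, by
    rw [rigidMat, Units.val_one, ← Matrix.fromBlocks_one]
    congr 1⟩
  inv_mem' := by
    rintro g ⟨R, hR, x, hg⟩
    refine ⟨Rᵀ, so3_transpose_mem hR, -(Rᵀ *ᵥ x), ?_⟩
    have h1 := so3_mul_transpose hR
    refine Units.inv_eq_of_mul_eq_one_right ?_
    rw [hg, rigidMat, rigidMat, Matrix.fromBlocks_multiply, ← Matrix.fromBlocks_one]
    congr 1
    · simp [h1]
    · have h2 : R * Matrix.replicateCol Unit (-(Rᵀ *ᵥ x)) = -Matrix.replicateCol Unit x := by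
        have h3 : R *ᵥ (-(Rᵀ *ᵥ x)) = -x := by
          rw [Matrix.mulVec_neg, Matrix.mulVec_mulVec, h1, Matrix.one_mulVec]
        ext a b
        simpa [Matrix.mul_apply, Matrix.mulVec, dotProduct] using congrFun h3 a
      rw [h2]
      simp
    · simp
    · simp

/-- The group of scaled orthogonal transformations `[R, 0; 0, a]`, `R ∈ SO(3)`, `a ≠ 0`. -/
def SOT3 : Subgroup (GL HIdx ℝ) where
  carrier := {g | ∃ R ∈ Matrix.specialOrthogonalGroup (Fin 3) ℝ, ∃ a : ℝ, a ≠ 0 ∧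
    (g : Matrix HIdx HIdx ℝ) = scaledMat R a}
  mul_mem' := by
    rintro g h ⟨R, hR, a, ha, hg⟩ ⟨S, hS, b, hb, hh⟩
    refine ⟨R * S, mul_mem hR hS, a * b, mul_ne_zero ha hb, ?_⟩
    rw [Units.val_mul, hg, hh, scaledMat, scaledMat, scaledMat, Matrix.fromBlocks_multiply]
    congr 1 <;> simp [smul_smul, mul_comm]
  one_mem' := ⟨1, one_mem _, 1, one_ne_zero, by
    rw [scaledMat, Units.val_one, ← Matrix.fromBlocks_one]
    simp⟩
  inv_mem' := by
    rintro g ⟨R, hR, a, ha, hg⟩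
    refine ⟨Rᵀ, so3_transpose_mem hR, a⁻¹, inv_ne_zero ha, ?_⟩
    refine Units.inv_eq_of_mul_eq_one_right ?_
    rw [hg, scaledMat, scaledMat, Matrix.fromBlocks_multiply, ← Matrix.fromBlocks_one]
    congr 1 <;> simp [so3_mul_transpose hR, smul_smul, ha]

/-- The underlying `4 × 4` matrix. -/
def poseMat (P : SE3) : Matrix HIdx HIdx ℝ := ((P : GL HIdx ℝ) : Matrix HIdx HIdx ℝ)

/-- The underlying `4 × 4` matrix. -/
def sotGroupMat (Q : SOT3) : Matrix HIdx HIdx ℝ := ((Q : GL HIdx ℝ) : Matrix HIdx HIdx ℝ)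

/-- The rotation component `R_P`. -/
def rot (P : SE3) : Matrix (Fin 3) (Fin 3) ℝ := (poseMat P).toBlocks₁₁

/-- Landmark indices: `np` point landmarks followed by `nb` bearing landmarks. -/
abbrev Idx (np nb : ℕ) := Fin np ⊕ Fin nb

/-- The symmetry group `VSLAM_n(3)`, `n = np + nb`, with elements `(A, Q_i)`. -/
abbrev VSLAMGroup (np nb : ℕ) := SE3 × (Idx np nb → SOT3)

/-- Velocities `(Ω, V)`: coordinates of the Lie algebra `se(3)`. -/
abbrev Twist := R3 × R3

/-- The matrix `[Ω^×, V; 0, 0]`. -/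
def twistMat (U : Twist) : Matrix HIdx HIdx ℝ :=
  Matrix.fromBlocks (skew U.1) (Matrix.replicateCol Unit U.2) 0 0

/-- The matrix `[ω^×, 0; 0, s]` of the Lie algebra of `SOT(3)`. -/
def sotMat (ω : R3) (s : ℝ) : Matrix HIdx HIdx ℝ :=
  Matrix.fromBlocks (skew ω) 0 0 (s • (1 : Matrix Unit Unit ℝ))

/-- `t ↦ M t` has, entry by entry, the derivative `M'` at `t` along the time interval `J`. -/
def HasMatDeriv {ι : Type} (M : ℝ → Matrix ι ι ℝ) (M' : Matrix ι ι ℝ) (J : Set ℝ) (t : ℝ) : Prop :=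
  ∀ a b, HasDerivWithinAt (fun s => M s a b) (M' a b) J t

/-! ### The total space, the SLAM manifold and the true system -/

/-- The total space `SE(3) × RP3 × ⋯ × RP3`, with elements `(P, η_i)`. -/
abbrev TotalSpace (np nb : ℕ) := SE3 × (Idx np nb → RP3)

/-- The SLAM manifold: the quotient of the total space by the action
`S • (P, η_i) = (S P, S η_i)` of `SE(3)`, that is, by changes of the reference frame. -/
abbrev SlamManifold (np nb : ℕ) := MulAction.orbitRel.Quotient SE3 (TotalSpace np nb)

/-- The class `⌊P, η_i⌋`. -/
def slamClass {np nb : ℕ} (ξ : TotalSpace np nb) : SlamManifold np nb :=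
  Quotient.mk (MulAction.orbitRel SE3 (TotalSpace np nb)) ξ

/-- Body-fixed coordinates `P⁻¹ η_i`. -/
def body {np nb : ℕ} (ξ : TotalSpace np nb) (i : Idx np nb) : RP3 := ξ.1⁻¹ • ξ.2 i

/-- The output `y_i = (I₃ 0) P⁻¹ η_i ∈ RP2`. -/
def output {np nb : ℕ} (ξ : TotalSpace np nb) (i : Idx np nb) : RP2 := camera (body ξ i)

/-- The reduced total space: the first `np` landmarks are of point type and do not lie at the robot
origin, the other ones are of bearing type. -/
def reducedTotalSpace (np nb : ℕ) : Set (TotalSpace np nb) :=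
  {ξ | (∀ i : Fin np, body ξ (Sum.inl i) ∈ pointOrbit) ∧
    ∀ j : Fin nb, body ξ (Sum.inr j) ∈ bearingOrbit}

/-- `ξ = (P, η_i)` solves `Ṗ = P U`, `η̇_i = 0` on `[0, ∞)`. -/
def IsTrajectory {np nb : ℕ} (U : ℝ → Twist) (ξ : ℝ → TotalSpace np nb) : Prop :=
  (∀ t ∈ Ici (0 : ℝ),
    HasMatDeriv (fun s => poseMat (ξ s).1) (poseMat (ξ t).1 * twistMat (U t)) (Ici 0) t) ∧
  ∀ t ∈ Ici (0 : ℝ), (ξ t).2 = (ξ 0).2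

/-- The right action `Υ((A, Q_i), (P, η_i)) = (P A, P A Q_i⁻¹ P⁻¹ η_i)`. -/
def upsilon {np nb : ℕ} (X : VSLAMGroup np nb) (ξ : TotalSpace np nb) : TotalSpace np nb :=
  (ξ.1 * X.1, fun i =>
    ((ξ.1 : GL HIdx ℝ) * (X.1 : GL HIdx ℝ) * (X.2 i : GL HIdx ℝ)⁻¹ * (ξ.1 : GL HIdx ℝ)⁻¹) • ξ.2 i)

/-- The landmark part `W(U, [q; r])` of the velocity lift. It does not depend on the representative
of `[q; r]`. -/
def lift (U : Twist) (x : RP3) : Matrix HIdx HIdx ℝ :=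
  let q := head x.rep
  let r := last x.rep
  sotMat (U.1 - (r / (q ⬝ᵥ q)) • (crossProduct U.2 q)) (-(r * (U.2 ⬝ᵥ q) / (q ⬝ᵥ q)))

/-! ### The observer -/

/-- The Riccati equation of the point landmarks, on `[0, ∞)`:
`Σ̇_i = Σ_i Ω^× - Ω^× Σ_i + k_H I - Σ_i Π_{y_i} (k_G I) Π_{y_i} Σ_i`. -/
def SolvesRiccati {np nb : ℕ} (kG kH : ℝ) (U : ℝ → Twist) (ξ : ℝ → TotalSpace np nb)
    (S : Fin np → ℝ → Matrix (Fin 3) (Fin 3) ℝ) : Prop :=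
  ∀ i : Fin np, ∀ t ∈ Ici (0 : ℝ),
    let Pi := proj (output (ξ t) (Sum.inl i)).rep
    HasMatDeriv (S i)
      (S i t * skew (U t).1 - skew (U t).1 * S i t + kH • (1 : Matrix (Fin 3) (Fin 3) ℝ)
        - S i t * Pi * (kG • (1 : Matrix (Fin 3) (Fin 3) ℝ)) * Pi * S i t)
      (Ici 0) t

/-- Persistence of excitation of the point landmarks:
`(1/δ) ∫_t^{t+δ} Π_{R_P(s) y_i(s)} ds ≥ μ I₃` for every `t > 0` and every `i`, in the order of
symmetric matrices, with the integral taken entry by entry. -/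
def PersistentlyExciting {np nb : ℕ} (ξ : ℝ → TotalSpace np nb) (δ μ : ℝ) : Prop :=
  ∀ t > 0, ∀ i : Fin np,
    Matrix.PosSemidef
      ((1 / δ) • (Matrix.of fun a b : Fin 3 => ∫ s in t..(t + δ),
          proj (rot (ξ s).1 *ᵥ (output (ξ s) (Sum.inl i)).rep) a b)
        - μ • (1 : Matrix (Fin 3) (Fin 3) ℝ))

/-- `Σ_i` for all landmarks: the Riccati solutions, and `I₃` for the bearing landmarks. -/
def sigma {np nb : ℕ} (S : Fin np → ℝ → Matrix (Fin 3) (Fin 3) ℝ) (t : ℝ) :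
    Idx np nb → Matrix (Fin 3) (Fin 3) ℝ :=
  Sum.elim (fun i => S i t) (fun _ => 1)

/-- `G_i` for all landmarks: `k_G I₃`, and `I₃` for the bearing landmarks. -/
def gainG {np nb : ℕ} (kG : ℝ) : Idx np nb → Matrix (Fin 3) (Fin 3) ℝ :=
  Sum.elim (fun _ => kG • 1) (fun _ => 1)

/-- The landmark innovations `Δ_{Q̂_i}`, with gain `K_i = k Σ_i Π_{y_i} G_i`; here `ŷ_i` is the
representative of norm one (its sign is irrelevant). -/
def innovation {np nb : ℕ} (k kG : ℝ) (S : Fin np → ℝ → Matrix (Fin 3) (Fin 3) ℝ) (t : ℝ)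
    (ξ ξhat : TotalSpace np nb) (i : Idx np nb) : Matrix HIdx HIdx ℝ :=
  let Pi := proj (output ξ i).rep
  let yhat := unitRep (output ξhat i)
  let K := k • (sigma S t i * Pi * gainG kG i)
  let w := K *ᵥ (Pi *ᵥ yhat)
  sotMat (skew yhat *ᵥ w) (-(yhat ⬝ᵥ w))

/-- The least-squares cost of a robot innovation `d = (Δ_R̂, Δ_x̂)`, given the landmark innovations
`ΔQ`. The representative of `θ̂_i = P̂⁻¹ η̂_i` is irrelevant. -/
def robotCost {np nb : ℕ} (ξhat : TotalSpace np nb) (ΔQ : Idx np nb → Matrix HIdx HIdx ℝ)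
    (d : Twist) : ℝ :=
  ∑ i, let θ := (body ξhat i).rep
    let v : R4 := (Real.sqrt (θ ⬝ᵥ θ))⁻¹ • (proj θ *ᵥ
      ((Matrix.fromBlocks (-skew (head θ)) (last θ • (1 : Matrix (Fin 3) (Fin 3) ℝ)) 0 0 :
          Matrix (Fin 3 ⊕ Unit) (Fin 3 ⊕ Fin 3) ℝ) *ᵥ (Sum.elim d.1 d.2) + ΔQ i *ᵥ θ))
    v ⬝ᵥ v

/-- `X = (Â, Q̂_i)` is a solution of the observer equations on the time interval `J`, started at the
identity, for the reference configuration `ξ₀`; the robot innovation `Δ` is at every time a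
least-squares solution. The estimated state is `upsilon (X t) ξ₀`. -/
structure IsObserverRun {np nb : ℕ} (k kG : ℝ) (U : ℝ → Twist) (ξ : ℝ → TotalSpace np nb)
    (S : Fin np → ℝ → Matrix (Fin 3) (Fin 3) ℝ) (ξ₀ : TotalSpace np nb) (J : Set ℝ)
    (X : ℝ → VSLAMGroup np nb) (Δ : ℝ → Twist) : Prop where
  init : X 0 = 1
  leastSquares : ∀ t ∈ J, ∀ d : Twist,
    robotCost (upsilon (X t) ξ₀) (innovation k kG S t (ξ t) (upsilon (X t) ξ₀)) (Δ t) ≤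
      robotCost (upsilon (X t) ξ₀) (innovation k kG S t (ξ t) (upsilon (X t) ξ₀)) d
  robot : ∀ t ∈ J,
    HasMatDeriv (fun s => poseMat (X s).1) (poseMat (X t).1 * (twistMat (U t) + twistMat (Δ t))) J t
  landmark : ∀ i, ∀ t ∈ J,
    HasMatDeriv (fun s => sotGroupMat ((X s).2 i))
      (sotGroupMat ((X t).2 i) * (lift (U t) (body (upsilon (X t) ξ₀) i)
        + innovation k kG S t (ξ t) (upsilon (X t) ξ₀) i)) J t

/-! ### Convergence and stability -/

/-- Convergence of `ξhat = (P̂, η̂_i)` to the trajectory `ξ = (P, η_i)` (with constant landmarks `η_i`)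
up to equivalence on the SLAM manifold: the class of `ξhat t` has a representative whose pose is
`P(t)` and whose landmarks converge to the `η_i`. -/
def ConvergesUpToEquiv {np nb : ℕ} (ξhat ξ : ℝ → TotalSpace np nb) : Prop :=
  ∃ ζ : ℝ → TotalSpace np nb,
    (∀ t ∈ Ici (0 : ℝ), slamClass (ζ t) = slamClass (ξhat t) ∧ (ζ t).1 = (ξ t).1) ∧
    ∀ i, Tendsto (fun t => (ζ t).2 i) atTop (𝓝 ((ξ 0).2 i))

/-- The error `e_i` of a point landmark, in body coordinates. -/
def pointError {np nb : ℕ} (ξhat ξ : TotalSpace np nb) (i : Fin np) : R3 :=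
  position (body ξhat (Sum.inl i)) - position (body ξ (Sum.inl i))

/-- The error `1 - cos²` of a bearing landmark, where `cos` is the cosine of the angle between
`y_j` and `ŷ_j`. -/
def bearingError {np nb : ℕ} (ξhat ξ : TotalSpace np nb) (j : Fin nb) : ℝ :=
  1 - (unitRep (output ξ (Sum.inr j)) ⬝ᵥ unitRep (output ξhat (Sum.inr j))) ^ 2

/-- The Lyapunov function: `½ e_iᵀ Σ_i⁻¹ e_i` summed over the point landmarks plus `½ (1 - cos²)`
summed over the bearing landmarks. -/
def lyapunov {np nb : ℕ} (S : Fin np → ℝ → Matrix (Fin 3) (Fin 3) ℝ) (t : ℝ)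
    (ξhat ξ : TotalSpace np nb) : ℝ :=
  (∑ i, (1 / 2) * (pointError ξhat ξ i ⬝ᵥ ((S i t)⁻¹ *ᵥ pointError ξhat ξ i)))
    + ∑ j, (1 / 2) * bearingError ξhat ξ j

/-- The squared size of the error, without the weights `Σ_i⁻¹`. -/
def errorSq {np nb : ℕ} (ξhat ξ : TotalSpace np nb) : ℝ :=
  (∑ i, pointError ξhat ξ i ⬝ᵥ pointError ξhat ξ i) + ∑ j, bearingError ξhat ξ j

/-- The basin of attraction: the initial estimates (reference configurations) in the reduced total
space for which the observer equations have a solution on `[0, ∞)` and for which every such solution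
yields an estimate that converges to the true state up to equivalence. -/
def basin {np nb : ℕ} (k kG : ℝ) (U : ℝ → Twist) (ξ : ℝ → TotalSpace np nb)
    (S : Fin np → ℝ → Matrix (Fin 3) (Fin 3) ℝ) : Set (TotalSpace np nb) :=
  {ξ₀ | ξ₀ ∈ reducedTotalSpace np nb ∧
    (∃ X Δ, IsObserverRun k kG U ξ S ξ₀ (Ici 0) X Δ) ∧
    ∀ X Δ, IsObserverRun k kG U ξ S ξ₀ (Ici 0) X Δ →
      ConvergesUpToEquiv (fun t => upsilon (X t) ξ₀) ξ}

/-- The configuration with pose `P`, point landmarks at `p_i` and bearing landmarks along `b_j ≠ 0`. -/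
def config {np nb : ℕ} (P : SE3) (p : Fin np → R3) (b : Fin nb → R3) (hb : ∀ j, b j ≠ 0) :
    TotalSpace np nb :=
  (P, Sum.elim (fun i => boundPt (p i)) (fun j => freePt (b j) (hb j)))

end VisualSlam

end

open VisualSlam

/-!
Write the landmarks in body coordinates as `[x; r]` and their estimates as `[z; r]`, with `r = 1`
for points and `r = 0` for bearings. The velocity lift and the landmark innovations are designed
so that, along every run of the observer, the normalized estimate solves the *linear* equation
`z' = -Ω × z - r V - k Σ Π_x G Π_x z`, whatever the robot innovation is
(`IsObserverRun.exists_linear`); the robot innovation only moves the reference frame. The true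
landmark solves `x' = -Ω × x - r V`.

For a point landmark, `e = z - x` and the derivative of `e ⬝ᵥ Σ⁻¹ e` is at most `-k_H |Σ⁻¹ e|²`.
Here `Σ` remains positive definite, and it is bounded by persistence of excitation
(`RiccatiAlong.exists_upper_bound`), so that the error decays exponentially at a uniform rate
(`RiccatiAlong.pointError_decay`). For a bearing landmark `x ⬝ᵥ z` is constant while the component
of `z` orthogonal to `x` decays like `e^{-k t}` (`bearing_invariants`). So the error `1 - cos²`
decays at the rate `2 k cos²(0)`, except when `z(0)` is orthogonal to `x(0)`, a property that is
then kept for ever (`IsObserverRun.bearingError_bounds`). This gives stability. It also shows that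
`cos(0) ≠ 0` on the basin of attraction, and on a compact part of the basin the continuous
function `cos²(0)` has a positive minimum (`exists_bearing_gap`), which makes the rate uniform.

For the almost-global claim runs must be shown to exist. The linear equations give the estimated
landmarks `z i`, and unless some `z i` vanishes at some time, scaled rotations that produce them
are found by integration (`exists_scaledRotation_curve`). A continuous robot innovation exists if
the kernel of the least-squares problem has a continuous description
(`exists_continuous_leastSquares`). The kernel consists of the robot motions that leave all
estimated landmarks fixed: rotations about one point landmark, or about the origin together with
the translations if there are no point landmarks, that fix the directions of the remaining
landmarks. If those directions never vanish and are pairwise never parallel, then there are no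
such rotations for two or more directions, and the obvious ones for one or none
(`exists_continuous_stabilizer`). All these genericity conditions exclude that `z i` meets a
moving point or a moving line at some time. For fixed other landmarks that is a family of initial
values with two parameters in a space of dimension three, so that the excluded set is null by
Sard's lemma (`LandmarkFlow.volume_meets_line`).
-/

namespace VisualSlam

local notation "Mat3" => Matrix (Fin 3) (Fin 3) ℝ

/-! ### Calculus of matrix-valued curves and linear differential equations -/

section Calculus

variable {ι : Type} {J J' : Set ℝ} {t : ℝ}

theorem HasMatDeriv.mono {M : ℝ → Matrix ι ι ℝ} {M' : Matrix ι ι ℝ}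
    (h : HasMatDeriv M M' J t) (hJ : J' ⊆ J) : HasMatDeriv M M' J' t :=
  fun a b => (h a b).mono hJ

theorem HasMatDeriv.congr_deriv {M : ℝ → Matrix ι ι ℝ} {M' M'' : Matrix ι ι ℝ}
    (h : HasMatDeriv M M' J t) (e : M' = M'') : HasMatDeriv M M'' J t := e ▸ h

theorem HasMatDeriv.sub {M N : ℝ → Matrix ι ι ℝ} {M' N' : Matrix ι ι ℝ}
    (hM : HasMatDeriv M M' J t) (hN : HasMatDeriv N N' J t) :
    HasMatDeriv (fun s => M s - N s) (M' - N') J t :=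
  fun a b => (hM a b).sub (hN a b)

theorem HasMatDeriv.transpose {M : ℝ → Matrix ι ι ℝ} {M' : Matrix ι ι ℝ}
    (hM : HasMatDeriv M M' J t) : HasMatDeriv (fun s => (M s)ᵀ) M'ᵀ J t :=
  fun a b => hM b a

theorem HasMatDeriv.mul [Fintype ι] {M N : ℝ → Matrix ι ι ℝ} {M' N' : Matrix ι ι ℝ}
    (hM : HasMatDeriv M M' J t) (hN : HasMatDeriv N N' J t) :
    HasMatDeriv (fun s => M s * N s) (M' * N t + M t * N') J t := by
  intro a b
  simp only [Matrix.mul_apply, Matrix.add_apply, ← Finset.sum_add_distrib]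
  exact HasDerivWithinAt.fun_sum fun c _ => (hM a c).mul (hN c b)

theorem HasMatDeriv.mulVec [Fintype ι] {M : ℝ → Matrix ι ι ℝ} {M' : Matrix ι ι ℝ}
    {v : ℝ → ι → ℝ} {v' : ι → ℝ}
    (hM : HasMatDeriv M M' J t) (hv : HasDerivWithinAt v v' J t) :
    HasDerivWithinAt (fun s => M s *ᵥ v s) (M' *ᵥ v t + M t *ᵥ v') J t := by
  rw [hasDerivWithinAt_pi] at hv ⊢
  intro a
  simp only [Matrix.mulVec, dotProduct, Pi.add_apply, ← Finset.sum_add_distrib]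
  exact HasDerivWithinAt.fun_sum fun c _ => (hM a c).mul (hv c)

theorem hasDerivWithinAt_dotProduct [Fintype ι] {v w : ℝ → ι → ℝ} {v' w' : ι → ℝ}
    (hv : HasDerivWithinAt v v' J t) (hw : HasDerivWithinAt w w' J t) :
    HasDerivWithinAt (fun s => v s ⬝ᵥ w s) (v' ⬝ᵥ w t + v t ⬝ᵥ w') J t := by
  rw [hasDerivWithinAt_pi] at hv hw
  simp only [dotProduct, ← Finset.sum_add_distrib]
  exact HasDerivWithinAt.fun_sum fun c _ => (hv c).mul (hw c)

theorem continuousOn_of_hasMatDeriv {M : ℝ → Matrix ι ι ℝ} {M' : ℝ → Matrix ι ι ℝ}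
    (h : ∀ t ∈ J, HasMatDeriv M (M' t) J t) : ContinuousOn M J :=
  continuousOn_pi.2 fun a => continuousOn_pi.2 fun b t ht => (h t ht a b).continuousWithinAt

end Calculus

section Monotone

variable {J : Set ℝ}

theorem antitoneOn_of_hasDerivWithinAt_nonpos (hJ : Convex ℝ J) {f f' : ℝ → ℝ}
    (hf : ∀ t ∈ J, HasDerivWithinAt f (f' t) J t) (hf' : ∀ t ∈ J, f' t ≤ 0) :
    AntitoneOn f J := by
  refine antitoneOn_of_deriv_nonpos hJ (fun t ht => (hf t ht).continuousWithinAt) ?_ ?_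
  · intro t ht
    exact ((hf t (interior_subset ht)).hasDerivAt
      (mem_interior_iff_mem_nhds.1 ht)).differentiableAt.differentiableWithinAt
  · intro t ht
    rw [((hf t (interior_subset ht)).hasDerivAt (mem_interior_iff_mem_nhds.1 ht)).deriv]
    exact hf' t (interior_subset ht)

theorem eq_of_hasDerivWithinAt_zero (hJ : Convex ℝ J) {f f' : ℝ → ℝ}
    (hf : ∀ t ∈ J, HasDerivWithinAt f (f' t) J t) (hf' : ∀ t ∈ J, f' t = 0)
    {s t : ℝ} (hs : s ∈ J) (ht : t ∈ J) : f s = f t := by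
  have h1 := antitoneOn_of_hasDerivWithinAt_nonpos hJ hf fun t ht => (hf' t ht).le
  have h2 := antitoneOn_of_hasDerivWithinAt_nonpos hJ (fun t ht => (hf t ht).fun_neg)
    fun t ht => by simp [hf' t ht]
  rcases le_total s t with h | h
  · exact le_antisymm (by simpa using h2 hs ht h) (h1 hs ht h)
  · exact le_antisymm (h1 ht hs h) (by simpa using h2 ht hs h)

theorem mat_eq_of_hasMatDeriv_zero {ι : Type} (hJ : Convex ℝ J) {M M' : ℝ → Matrix ι ι ℝ}
    (hM : ∀ t ∈ J, HasMatDeriv M (M' t) J t) (hM' : ∀ t ∈ J, M' t = 0)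
    {s t : ℝ} (hs : s ∈ J) (ht : t ∈ J) : M s = M t := by
  ext a b
  exact eq_of_hasDerivWithinAt_zero hJ (f := fun t => M t a b) (fun t ht => hM t ht a b)
    (fun t ht => by simp [hM' t ht]) hs ht

theorem vec_eq_of_hasDerivWithinAt_zero {ι : Type} [Fintype ι] (hJ : Convex ℝ J)
    {v v' : ℝ → ι → ℝ}
    (hv : ∀ t ∈ J, HasDerivWithinAt v (v' t) J t) (hv' : ∀ t ∈ J, v' t = 0)
    {s t : ℝ} (hs : s ∈ J) (ht : t ∈ J) : v s = v t := by
  ext a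
  exact eq_of_hasDerivWithinAt_zero hJ (f := fun t => v t a)
    (fun t ht => hasDerivWithinAt_pi.1 (hv t ht) a)
    (fun t ht => by simp [hv' t ht]) hs ht

end Monotone

section LinearODE

theorem hasDerivAt_primitive {E : Type*} [NormedAddCommGroup E] [NormedSpace ℝ E]
    [CompleteSpace E] {f : ℝ → E} (hf : Continuous f) (t : ℝ) :
    HasDerivAt (fun u => ∫ s in (0 : ℝ)..u, f s) (f t) t :=
  intervalIntegral.integral_hasDerivAt_right (hf.intervalIntegrable _ _)
    (hf.stronglyMeasurableAtFilter _ _) hf.continuousAt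

theorem exists_antideriv {E : Type*} [NormedAddCommGroup E] [NormedSpace ℝ E] [CompleteSpace E]
    {f : ℝ → E} (hf : Continuous f) : ∃ F : ℝ → E, F 0 = 0 ∧ ∀ t, HasDerivAt F (f t) t :=
  ⟨fun t => ∫ s in (0 : ℝ)..t, f s, by simp, hasDerivAt_primitive hf⟩

/-- The iterated integrals `Xₙ₊₁(t) = ∫₀ᵗ Xₙ M` of the Peano-Baker series, bundled with their
continuity. -/
noncomputable def peanoBaker {A : Type*} [NormedRing A] [NormedAlgebra ℝ A] (M : C(ℝ, A)) :
    ℕ → C(ℝ, A)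
  | 0 => 1
  | n + 1 => ⟨fun t => ∫ s in (0 : ℝ)..t, peanoBaker M n s * M s,
      intervalIntegral.continuous_primitive (fun _ _ =>
        ((peanoBaker M n).continuous.mul M.continuous).intervalIntegrable _ _) 0⟩

variable {A : Type*} [NormedRing A] [NormedAlgebra ℝ A]

theorem norm_peanoBaker_le (M : C(ℝ, A)) {C T : ℝ} (hC : ∀ t, |t| ≤ T → ‖M t‖ ≤ C) (n : ℕ) :
    ∀ t, |t| ≤ T → ‖peanoBaker M n t‖ ≤ ‖(1 : A)‖ * (C ^ n * |t| ^ n / n.factorial) := by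
  induction n with
  | zero => intro t _; simp [peanoBaker]
  | succ n ih =>
    intro t ht
    have hC0 : 0 ≤ C := (norm_nonneg _).trans (hC t ht)
    have h1 : ‖peanoBaker M (n + 1) t‖ ≤ ∫ s in Set.uIoc 0 t, ‖peanoBaker M n s * M s‖ :=
      intervalIntegral.norm_integral_le_integral_norm_uIoc
    have hc : Continuous fun s : ℝ => ‖(1 : A)‖ * (C ^ n * |s - 0| ^ n / n.factorial) * C := by
      fun_prop
    have hc' : Continuous fun s : ℝ => ‖peanoBaker M n s * M s‖ :=
      ((peanoBaker M n).continuous.mul M.continuous).norm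
    have h2 : ∫ s in Set.uIoc 0 t, ‖peanoBaker M n s * M s‖ ≤
        ∫ s in Set.uIoc 0 t, ‖(1 : A)‖ * (C ^ n * |s - 0| ^ n / n.factorial) * C := by
      refine setIntegral_mono_on (hc'.integrableOn_uIoc) (hc.integrableOn_uIoc)
        measurableSet_uIoc fun s hs => ?_
      have hs' : |s| ≤ T := by
        refine le_trans ?_ ht
        rcases Set.mem_uIoc.1 hs with h | h
        · rw [abs_of_pos h.1, abs_of_pos (h.1.trans_le h.2)]; exact h.2
        · rw [abs_of_nonpos h.2, abs_of_neg (h.1.trans_le h.2)]; linarith [h.1]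
      rw [sub_zero]
      exact (norm_mul_le _ _).trans (mul_le_mul (ih s hs') (hC s hs') (norm_nonneg _)
        (by positivity))
    refine h1.trans (h2.trans (le_of_eq ?_))
    have h3 : ∀ s : ℝ, ‖(1 : A)‖ * (C ^ n * |s - 0| ^ n / n.factorial) * C
        = (‖(1 : A)‖ * C ^ (n + 1) / n.factorial) * |s - 0| ^ n := fun s => by ring
    simp_rw [h3]
    rw [integral_const_mul, integral_pow_abs_sub_uIoc, sub_zero, Nat.factorial_succ]
    push_cast
    field_simp

/-- Global existence for `X' = X M` on the whole real line, with `X 0 = 1`, in a Banach algebra: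
the Peano-Baker series converges locally uniformly together with its derivatives. -/
theorem exists_linearODE [CompleteSpace A] {M : ℝ → A} (hM : Continuous M) :
    ∃ X : ℝ → A, X 0 = 1 ∧ ∀ t, HasDerivAt X (X t * M t) t := by
  set N : C(ℝ, A) := ⟨M, hM⟩
  have hd : ∀ n t, HasDerivAt (peanoBaker N (n + 1)) (peanoBaker N n t * M t) t := fun n t =>
    hasDerivAt_primitive ((peanoBaker N n).continuous.mul hM) t
  have key : ∀ T : ℝ, ∃ C, 0 ≤ C ∧ ∀ t, |t| ≤ T → ‖M t‖ ≤ C := by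
    intro T
    obtain ⟨C, hC⟩ := (isCompact_Icc (a := -T) (b := T)).exists_bound_of_continuousOn
      hM.continuousOn
    exact ⟨max C 0, le_max_right _ _, fun t ht => (hC t (abs_le.1 ht)).trans (le_max_left _ _)⟩
  have hsum : ∀ t, Summable fun n => peanoBaker N n t := by
    intro t
    obtain ⟨C, hC0, hC⟩ := key |t|
    refine Summable.of_norm_bounded (g := fun n : ℕ => ‖(1 : A)‖ * ((C * |t|) ^ n / n.factorial))
      ((Real.summable_pow_div_factorial _).mul_left _) fun n => ?_
    have := norm_peanoBaker_le N hC n t le_rfl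
    rwa [← mul_pow] at this
  refine ⟨fun t => ∑' n, peanoBaker N n t, ?_, fun t => ?_⟩
  · change ∑' n, peanoBaker N n 0 = 1
    rw [tsum_eq_single 0]
    · simp [peanoBaker]
    · rintro (_ | n) hn
      · exact absurd rfl hn
      · simp [peanoBaker]
  · obtain ⟨C, hC0, hC⟩ := key (|t| + 1)
    have ht0 : 0 ≤ |t| := abs_nonneg t
    have hmem : t ∈ Ioo (-(|t| + 1)) (|t| + 1) := by
      constructor <;> cases abs_cases t <;> linarith
    have h1 := hasDerivAt_tsum_of_isPreconnected
      (u := fun n : ℕ => ‖(1 : A)‖ * ((C * (|t| + 1)) ^ n / n.factorial) * C)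
      (g := fun n => (peanoBaker N (n + 1) : ℝ → A))
      (g' := fun n s => peanoBaker N n s * M s)
      (t := Ioo (-(|t| + 1)) (|t| + 1)) (y₀ := t) (y := t)
      (((Real.summable_pow_div_factorial _).mul_left _).mul_right _) isOpen_Ioo
      isPreconnected_Ioo (fun n s _ => hd n s) (fun n s hs => by
        have hs' : |s| ≤ |t| + 1 := abs_le.2 ⟨hs.1.le, hs.2.le⟩
        refine (norm_mul_le _ _).trans (mul_le_mul ?_ (hC s hs') (norm_nonneg _) (by positivity))
        refine (norm_peanoBaker_le N hC n s hs').trans ?_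
        rw [mul_pow]
        gcongr) hmem ((summable_nat_add_iff 1).2 (hsum t)) hmem
    have h2 : (fun s => ∑' n, peanoBaker N n s) =
        fun s => peanoBaker N 0 s + ∑' n, peanoBaker N (n + 1) s := by
      funext s
      exact (hsum s).tsum_eq_zero_add
    rw [h2]
    have h3 : (peanoBaker N 0 t + ∑' n, peanoBaker N (n + 1) t) * M t =
        0 + ∑' n, peanoBaker N n t * M t := by
      rw [← (hsum t).tsum_eq_zero_add, zero_add, (hsum t).tsum_mul_right]
    simp only [h3]
    exact (hasDerivAt_const t (1 : A)).add h1

section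

attribute [local instance] Matrix.linftyOpNormedRing Matrix.linftyOpNormedAlgebra

theorem exists_matrix_linearODE {ι : Type} [Fintype ι] [DecidableEq ι] {M : ℝ → Matrix ι ι ℝ}
    (hM : Continuous M) :
    ∃ X : ℝ → Matrix ι ι ℝ, X 0 = 1 ∧ ∀ t, HasMatDeriv X (X t * M t) univ t := by
  obtain ⟨X, h0, hX⟩ := exists_linearODE (A := Matrix ι ι ℝ) hM
  refine ⟨X, h0, fun t a b => ?_⟩
  have h := (LinearMap.toContinuousLinearMap
    (Matrix.entryLinearMap ℝ ℝ a b)).hasFDerivAt.comp_hasDerivAt t (hX t)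
  exact h.hasDerivWithinAt

end

/-- A fundamental matrix `X` of `X' = X M`, together with its inverse, which solves
`Y' = -M Y`. -/
theorem exists_fundamental {ι : Type} [Fintype ι] [DecidableEq ι] {M : ℝ → Matrix ι ι ℝ}
    (hM : Continuous M) :
    ∃ X Y : ℝ → Matrix ι ι ℝ, X 0 = 1 ∧ Y 0 = 1 ∧ (∀ t, HasMatDeriv X (X t * M t) univ t) ∧
      (∀ t, HasMatDeriv Y (-(M t * Y t)) univ t) ∧ (∀ t, X t * Y t = 1) ∧ ∀ t, Y t * X t = 1 := by
  obtain ⟨X, hX0, hX⟩ := exists_matrix_linearODE hM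
  obtain ⟨Z, hZ0, hZ⟩ := exists_matrix_linearODE (M := fun t => -(M t)ᵀ) hM.matrix_transpose.neg
  have hY : ∀ t, HasMatDeriv (fun s => (Z s)ᵀ) (-(M t * (Z t)ᵀ)) univ t := fun t =>
    (hZ t).transpose.congr_deriv (by simp [Matrix.transpose_mul])
  have h1 : ∀ t, X t * (Z t)ᵀ = 1 := fun t => by
    have := mat_eq_of_hasMatDeriv_zero convex_univ (fun t _ => (hX t).mul (hY t))
      (fun t _ => by simp [Matrix.mul_assoc]) (mem_univ t) (mem_univ 0)
    simpa [hX0, hZ0] using this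
  exact ⟨X, fun t => (Z t)ᵀ, hX0, by simp [hZ0], hX, hY, h1, fun t => mul_eq_one_comm.1 (h1 t)⟩

end LinearODE

section Rotations

theorem skew_transpose (ω : R3) : (skew ω)ᵀ = -skew ω := by
  ext a b
  fin_cases a <;> fin_cases b <;> simp [skew]

theorem skew_mulVec (ω v : R3) : skew ω *ᵥ v = crossProduct ω v := by
  ext a
  fin_cases a <;> simp [skew, Matrix.mulVec, dotProduct, Fin.sum_univ_three, cross_apply] <;> ring

theorem so3_transpose_mul {R : Matrix (Fin 3) (Fin 3) ℝ}
    (hR : R ∈ Matrix.specialOrthogonalGroup (Fin 3) ℝ) : Rᵀ * R = 1 :=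
  mul_eq_one_comm.1 (so3_mul_transpose hR)

/-- The solution of `R' = R ω^×` stays in `SO(3)`: it is orthogonal, and its determinant is a
continuous function with values `± 1`. -/
theorem exists_rotation {ω : ℝ → R3} (hω : Continuous ω) :
    ∃ R : ℝ → Matrix (Fin 3) (Fin 3) ℝ, R 0 = 1 ∧
      (∀ t, HasMatDeriv R (R t * skew (ω t)) univ t) ∧
      ∀ t, R t ∈ Matrix.specialOrthogonalGroup (Fin 3) ℝ := by
  have hc : Continuous fun t => skew (ω t) := by
    refine continuous_matrix fun a b => ?_
    fin_cases a <;> fin_cases b <;> simp [skew] <;> fun_prop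
  obtain ⟨R, h0, hR⟩ := exists_matrix_linearODE hc
  have hRR : ∀ t, R t * (R t)ᵀ = 1 := fun t => by
    have := mat_eq_of_hasMatDeriv_zero convex_univ (fun t _ => (hR t).mul (hR t).transpose)
      (fun t _ => by simp [Matrix.transpose_mul, Matrix.mul_assoc, skew_transpose])
      (mem_univ t) (mem_univ 0)
    simpa [h0] using this
  have hdet : ∀ t, (R t).det = 1 ∨ (R t).det = -1 := fun t => by
    have := congrArg Matrix.det (hRR t)
    rw [Matrix.det_mul, Matrix.det_transpose, Matrix.det_one] at this
    exact mul_self_eq_one_iff.1 this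
  have hcont : Continuous fun t => (R t).det := by
    refine Continuous.matrix_det (continuousOn_univ.1 ?_)
    exact continuousOn_of_hasMatDeriv fun t _ => hR t
  refine ⟨R, h0, hR, fun t => ?_⟩
  rw [Matrix.mem_specialOrthogonalGroup_iff, Matrix.mem_orthogonalGroup_iff]
  refine ⟨by simpa [Matrix.star_eq_conjTranspose] using hRR t, ?_⟩
  rcases hdet t with h | h
  · exact h
  · exfalso
    obtain ⟨s, hs⟩ := mem_range_of_exists_le_of_exists_ge hcont (c := 0) ⟨t, by rw [h]; norm_num⟩
      ⟨0, by simp [h0]⟩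
    rcases hdet s with h' | h' <;> simp only at hs <;> rw [h'] at hs <;> norm_num at hs

end Rotations

/-! ### Homogeneous coordinates -/

theorem dot_self_nonneg {ι : Type} [Fintype ι] (v : ι → ℝ) : 0 ≤ v ⬝ᵥ v :=
  Finset.sum_nonneg fun i _ => mul_self_nonneg (v i)

theorem dot_self_pos {ι : Type} [Fintype ι] {v : ι → ℝ} (hv : v ≠ 0) : 0 < v ⬝ᵥ v :=
  (dot_self_nonneg v).lt_of_ne fun h => hv (dotProduct_self_eq_zero.1 h.symm)

section Projector

variable {ι : Type} [Fintype ι] [DecidableEq ι]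

theorem proj_mulVec (y v : ι → ℝ) : proj y *ᵥ v = v - ((y ⬝ᵥ y)⁻¹ * (y ⬝ᵥ v)) • y := by
  rw [proj, Matrix.sub_mulVec, Matrix.one_mulVec, Matrix.smul_mulVec, Matrix.vecMulVec_mulVec]
  ext a
  simp only [Pi.sub_apply, Pi.smul_apply, smul_eq_mul, MulOpposite.smul_eq_mul_unop,
    MulOpposite.unop_op]
  ring

theorem proj_smul {c : ℝ} (hc : c ≠ 0) (y : ι → ℝ) : proj (c • y) = proj y := by
  ext a b
  simp only [proj, Matrix.sub_apply, Matrix.smul_apply, Matrix.vecMulVec_apply, Pi.smul_apply,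
    smul_dotProduct, dotProduct_smul, smul_eq_mul]
  rw [mul_inv, mul_inv]
  field_simp

theorem proj_transpose (y : ι → ℝ) : (proj y)ᵀ = proj y := by
  ext a b
  simp only [proj, Matrix.transpose_apply, Matrix.sub_apply, Matrix.smul_apply,
    Matrix.vecMulVec_apply, smul_eq_mul, Matrix.one_apply, eq_comm (a := b) (b := a)]
  ring

theorem proj_mulVec_self {y : ι → ℝ} (hy : y ≠ 0) : proj y *ᵥ y = 0 := by
  rw [proj_mulVec, inv_mul_cancel₀ (dot_self_pos hy).ne', one_smul, sub_self]

theorem dot_proj_self {y : ι → ℝ} (hy : y ≠ 0) (v : ι → ℝ) : y ⬝ᵥ (proj y *ᵥ v) = 0 := by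
  rw [Matrix.dotProduct_mulVec, ← Matrix.mulVec_transpose, proj_transpose, proj_mulVec_self hy,
    zero_dotProduct]

theorem proj_mul_proj {y : ι → ℝ} (hy : y ≠ 0) : proj y * proj y = proj y := by
  refine Matrix.ext_of_mulVec_single fun b => ?_
  rw [← Matrix.mulVec_mulVec, proj_mulVec y (proj y *ᵥ _), dot_proj_self hy, mul_zero, zero_smul,
    sub_zero]

theorem dot_proj {y : ι → ℝ} (v : ι → ℝ) :
    v ⬝ᵥ (proj y *ᵥ v) = v ⬝ᵥ v - (y ⬝ᵥ y)⁻¹ * (y ⬝ᵥ v) ^ 2 := by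
  rw [proj_mulVec, dotProduct_sub, dotProduct_smul, dotProduct_comm v y, smul_eq_mul]
  ring

theorem proj_mulVec_dot_self {y : ι → ℝ} (hy : y ≠ 0) (v : ι → ℝ) :
    (proj y *ᵥ v) ⬝ᵥ (proj y *ᵥ v) = v ⬝ᵥ (proj y *ᵥ v) := by
  conv_rhs => rw [← proj_mul_proj hy, ← Matrix.mulVec_mulVec, Matrix.dotProduct_mulVec,
    ← Matrix.mulVec_transpose, proj_transpose]

theorem dot_proj_nonneg {y : ι → ℝ} (hy : y ≠ 0) (v : ι → ℝ) : 0 ≤ v ⬝ᵥ (proj y *ᵥ v) := by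
  rw [← proj_mulVec_dot_self hy]
  exact dot_self_nonneg _

theorem dot_proj_le (y v : ι → ℝ) : v ⬝ᵥ (proj y *ᵥ v) ≤ v ⬝ᵥ v := by
  rw [dot_proj]
  have := dot_self_nonneg y
  have : 0 ≤ (y ⬝ᵥ y)⁻¹ * (y ⬝ᵥ v) ^ 2 := by positivity
  linarith

end Projector

@[simp] theorem head_hom (q : R3) (r : ℝ) : head (hom q r) = q := rfl

@[simp] theorem last_hom (q : R3) (r : ℝ) : last (hom q r) = r := rfl

theorem hom_head_last (x : R4) : hom (head x) (last x) = x := by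
  funext a
  rcases a with a | a <;> rfl

theorem smul_hom (c : ℝ) (q : R3) (r : ℝ) : c • hom q r = hom (c • q) (c * r) := by
  funext a
  rcases a with a | a <;> rfl

theorem hom_zero : hom 0 0 = 0 := by
  funext a
  rcases a with a | a <;> rfl

theorem hom_ne_zero_of_left {q : R3} (hq : q ≠ 0) (r : ℝ) : hom q r ≠ 0 := fun h =>
  hq (congrArg head h)

theorem hom_inj {q q' : R3} {r r' : ℝ} (h : hom q r = hom q' r') : q = q' ∧ r = r' :=
  ⟨congrArg head h, congrArg last h⟩

/-- `(z, r)` is a vector of homogeneous coordinates of `x ∈ RP3`. -/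
def IsRep (x : RP3) (z : R3) (r : ℝ) : Prop :=
  ∃ h : hom z r ≠ 0, Projectivization.mk ℝ (hom z r) h = x

namespace IsRep

variable {x : RP3} {z : R3} {r : ℝ}

theorem of_rep (x : RP3) : IsRep x (head x.rep) (last x.rep) :=
  ⟨by rw [hom_head_last]; exact x.rep_nonzero, by simp only [hom_head_last]; exact x.mk_rep⟩

theorem ne_zero (h : IsRep x z r) : hom z r ≠ 0 := h.1

theorem eq_of (h : IsRep x z r) {x' : RP3} (h' : IsRep x' z r) : x = x' := by
  obtain ⟨_, rfl⟩ := h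
  obtain ⟨_, rfl⟩ := h'
  rfl

theorem unique (h : IsRep x z r) {z' : R3} {r' : ℝ} (h' : IsRep x z' r') :
    ∃ c : ℝ, c ≠ 0 ∧ z' = c • z ∧ r' = c * r := by
  obtain ⟨h0, h⟩ := h
  obtain ⟨h0', h'⟩ := h'
  obtain ⟨c, hc⟩ := (Projectivization.mk_eq_mk_iff ℝ _ _ h0' h0).1 (h'.trans h.symm)
  have hc' : (c : ℝ) • hom z r = hom z' r' := hc
  rw [smul_hom] at hc'
  exact ⟨c, c.ne_zero, (hom_inj hc').1.symm, (hom_inj hc').2.symm⟩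

theorem smul (h : IsRep x z r) {c : ℝ} (hc : c ≠ 0) : IsRep x (c • z) (c * r) := by
  obtain ⟨h0, h⟩ := h
  refine ⟨by rw [← smul_hom]; exact smul_ne_zero hc h0, ?_⟩
  rw [← h, Projectivization.mk_eq_mk_iff']
  exact ⟨c, smul_hom c z r⟩

theorem rep_eq (h : IsRep x z r) : ∃ c : ℝ, c ≠ 0 ∧ x.rep = hom (c • z) (c * r) := by
  obtain ⟨c, hc, h1, h2⟩ := h.unique (of_rep x)
  exact ⟨c, hc, by rw [← h1, ← h2, hom_head_last]⟩

theorem camera_rep (h : IsRep x z r) (hz : z ≠ 0) :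
    ∃ c : ℝ, c ≠ 0 ∧ (camera x).rep = c • z := by
  obtain ⟨c, hc, hx⟩ := h.rep_eq
  have hne : head x.rep ≠ 0 := by
    rw [hx, head_hom]
    exact smul_ne_zero hc hz
  rw [camera, dif_pos hne]
  obtain ⟨d, hd⟩ := Projectivization.exists_smul_eq_mk_rep ℝ (head x.rep) hne
  refine ⟨d * c, mul_ne_zero d.ne_zero hc, ?_⟩
  rw [← hd, hx, head_hom, mul_smul]
  rfl

theorem proj_camera (h : IsRep x z r) (hz : z ≠ 0) : proj (camera x).rep = proj z := by
  obtain ⟨c, hc, hx⟩ := h.camera_rep hz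
  rw [hx, proj_smul hc]

/-- The unit representative of the image of `[z; r]` is `± z / |z|`. -/
theorem unitRep_camera (h : IsRep x z r) (hz : z ≠ 0) :
    ∃ c : ℝ, c * c = (z ⬝ᵥ z)⁻¹ ∧ unitRep (camera x) = c • z := by
  obtain ⟨c, hc, hx⟩ := h.camera_rep hz
  refine ⟨(Real.sqrt ((camera x).rep ⬝ᵥ (camera x).rep))⁻¹ * c, ?_, ?_⟩
  · have hp := dot_self_pos hz
    have h1 : (camera x).rep ⬝ᵥ (camera x).rep = c * c * (z ⬝ᵥ z) := by
      rw [hx, smul_dotProduct, dotProduct_smul, smul_eq_mul, smul_eq_mul, mul_assoc]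
    have h2 : 0 < c * c * (z ⬝ᵥ z) := mul_pos (mul_self_pos.2 hc) hp
    rw [h1, mul_mul_mul_comm, ← mul_inv, Real.mul_self_sqrt h2.le]
    field_simp
  · rw [unitRep, hx, smul_smul]

theorem position_eq (h : IsRep x z 1) : position x = z := by
  obtain ⟨c, hc, hx⟩ := h.rep_eq
  rw [position, hx, head_hom, last_hom, mul_one, smul_smul, inv_mul_cancel₀ hc, one_smul]

theorem lift_eq (h : IsRep x z r) (U : Twist) :
    lift U x =
      sotMat (U.1 - (r / (z ⬝ᵥ z)) • crossProduct U.2 z) (-(r * (U.2 ⬝ᵥ z) / (z ⬝ᵥ z))) := by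
  obtain ⟨c, hc, hx⟩ := h.rep_eq
  simp only [VisualSlam.lift, hx, head_hom, last_hom, smul_dotProduct, dotProduct_smul, smul_eq_mul,
    map_smul, smul_smul]
  congr 2
  · congr 1
    field_simp
  · field_simp

theorem mem_pointOrbit (h : IsRep x z 1) (hz : z ≠ 0) : x ∈ pointOrbit := by
  obtain ⟨c, hc, hx⟩ := h.rep_eq
  refine ⟨by rw [hx, last_hom, mul_one]; exact hc, ?_⟩
  rintro rfl
  have h0 : IsRep (boundPt 0) 0 1 := ⟨_, rfl⟩
  obtain ⟨d, hd, h1, h2⟩ := h.unique h0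
  exact (smul_ne_zero hd hz) h1.symm

theorem mem_bearingOrbit (h : IsRep x z 0) : x ∈ bearingOrbit := by
  obtain ⟨c, hc, hx⟩ := h.rep_eq
  change last x.rep = 0
  rw [hx, last_hom, mul_zero]

theorem of_mem_pointOrbit (h : x ∈ pointOrbit) : ∃ z, z ≠ 0 ∧ IsRep x z 1 := by
  have h1 := (of_rep x).smul (inv_ne_zero h.1)
  rw [inv_mul_cancel₀ h.1] at h1
  refine ⟨_, fun h0 => h.2 ?_, h1⟩
  rw [h0] at h1
  exact h1.eq_of ⟨_, rfl⟩

theorem of_mem_bearingOrbit (h : x ∈ bearingOrbit) : ∃ z, z ≠ 0 ∧ IsRep x z 0 := by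
  have h1 := of_rep x
  rw [show last x.rep = 0 from h] at h1
  refine ⟨_, fun h0 => h1.ne_zero ?_, h1⟩
  rw [h0, hom_zero]

end IsRep

/-! ### Poses and scaled rotations in homogeneous coordinates -/

/-- The translation component of a pose. -/
def trans (P : SE3) : R3 := fun a => poseMat P (Sum.inl a) (Sum.inr ())

theorem rigidMat_mulVec (R : Matrix (Fin 3) (Fin 3) ℝ) (x q : R3) (r : ℝ) :
    rigidMat R x *ᵥ hom q r = hom (R *ᵥ q + r • x) r := by
  funext a
  rcases a with a | a <;>
    simp [rigidMat, hom, Matrix.mulVec, dotProduct, Fintype.sum_sum_type, mul_comm]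

theorem scaledMat_mulVec (R : Matrix (Fin 3) (Fin 3) ℝ) (a : ℝ) (q : R3) (r : ℝ) :
    scaledMat R a *ᵥ hom q r = hom (R *ᵥ q) (a * r) := by
  funext a
  rcases a with a | a <;>
    simp [scaledMat, hom, Matrix.mulVec, dotProduct, Fintype.sum_sum_type]

theorem sotMat_mulVec (ω q : R3) (s r : ℝ) :
    sotMat ω s *ᵥ hom q r = hom (crossProduct ω q) (s * r) := by
  rw [← skew_mulVec]
  funext a
  rcases a with a | a <;>
    simp [sotMat, hom, Matrix.mulVec, dotProduct, Fintype.sum_sum_type]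

theorem rot_mem_and_poseMat (P : SE3) :
    rot P ∈ Matrix.specialOrthogonalGroup (Fin 3) ℝ ∧ poseMat P = rigidMat (rot P) (trans P) := by
  obtain ⟨R, hR, x, h⟩ := P.2
  have h' : poseMat P = rigidMat R x := h
  have h1 : rot P = R := by rw [rot, h', rigidMat, Matrix.toBlocks_fromBlocks₁₁]
  have h2 : trans P = x := by
    funext a
    simp [trans, h', rigidMat]
  rw [h1, h2]
  exact ⟨hR, h'⟩

theorem IsRep.gl_smul {x : RP3} {z w : R3} {r s : ℝ} (h : IsRep x z r) (g : GL HIdx ℝ)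
    (hg : (g : Matrix HIdx HIdx ℝ) *ᵥ hom z r = hom w s) : IsRep (g • x) w s := by
  obtain ⟨h0, rfl⟩ := h
  have h1 : g • hom z r = hom w s := hg
  refine ⟨?_, ?_⟩
  · rw [← h1]
    exact (smul_ne_zero_iff_ne g).2 h0
  · rw [Projectivization.smul_mk]
    simp only [h1]

theorem IsRep.pose_smul {x : RP3} {z : R3} {r : ℝ} (h : IsRep x z r) (P : SE3) :
    IsRep (P • x) (rot P *ᵥ z + r • trans P) r :=
  h.gl_smul (P : GL HIdx ℝ) (by
    change poseMat P *ᵥ _ = _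
    rw [(rot_mem_and_poseMat P).2, rigidMat_mulVec])

theorem rot_mulVec_transpose (P : SE3) (v : R3) : rot P *ᵥ ((rot P)ᵀ *ᵥ v) = v := by
  rw [Matrix.mulVec_mulVec, so3_mul_transpose (rot_mem_and_poseMat P).1, Matrix.one_mulVec]

theorem transpose_mulVec_rot (P : SE3) (v : R3) : (rot P)ᵀ *ᵥ (rot P *ᵥ v) = v := by
  rw [Matrix.mulVec_mulVec, so3_transpose_mul (rot_mem_and_poseMat P).1, Matrix.one_mulVec]

theorem IsRep.pose_inv_smul {x : RP3} {z : R3} {r : ℝ} (h : IsRep x z r) (P : SE3) :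
    IsRep (P⁻¹ • x) ((rot P)ᵀ *ᵥ (z - r • trans P)) r :=
  h.gl_smul ((P⁻¹ : SE3) : GL HIdx ℝ) (by
    have h1 : poseMat P *ᵥ hom ((rot P)ᵀ *ᵥ (z - r • trans P)) r = hom z r := by
      rw [(rot_mem_and_poseMat P).2, rigidMat_mulVec, rot_mulVec_transpose, sub_add_cancel]
    rw [← h1]
    change _ *ᵥ (((P : GL HIdx ℝ) : Matrix HIdx HIdx ℝ) *ᵥ _) = _
    rw [Matrix.mulVec_mulVec, ← Units.val_mul, ← Subgroup.coe_mul, inv_mul_cancel]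
    simp)

theorem IsRep.sot_inv_smul {x : RP3} {z : R3} {r : ℝ} (h : IsRep x z r) (Q : SOT3)
    {R : Matrix (Fin 3) (Fin 3) ℝ} {a : ℝ} (hR : R ∈ Matrix.specialOrthogonalGroup (Fin 3) ℝ)
    (ha : a ≠ 0) (hQ : sotGroupMat Q = scaledMat R a) :
    IsRep ((Q : GL HIdx ℝ)⁻¹ • x) (a • (Rᵀ *ᵥ z)) r := by
  have h1 : sotGroupMat Q *ᵥ hom (Rᵀ *ᵥ z) (a⁻¹ * r) = hom z r := by
    rw [hQ, scaledMat_mulVec, Matrix.mulVec_mulVec, so3_mul_transpose hR, Matrix.one_mulVec,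
      mul_inv_cancel_left₀ ha]
  have h2 : IsRep ((Q : GL HIdx ℝ)⁻¹ • x) (Rᵀ *ᵥ z) (a⁻¹ * r) := h.gl_smul _ (by
    rw [← h1]
    change _ *ᵥ (((Q : GL HIdx ℝ) : Matrix HIdx HIdx ℝ) *ᵥ _) = _
    rw [Matrix.mulVec_mulVec, ← Units.val_mul, inv_mul_cancel]
    simp)
  have h3 := h2.smul ha
  rwa [mul_inv_cancel_left₀ ha] at h3

theorem body_upsilon {np nb : ℕ} (X : VSLAMGroup np nb) (ξ : TotalSpace np nb) (i : Idx np nb) :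
    body (upsilon X ξ) i = (X.2 i : GL HIdx ℝ)⁻¹ • body ξ i := by
  change ((ξ.1 * X.1 : SE3) : GL HIdx ℝ)⁻¹ • (((ξ.1 : GL HIdx ℝ) * (X.1 : GL HIdx ℝ) *
    (X.2 i : GL HIdx ℝ)⁻¹ * (ξ.1 : GL HIdx ℝ)⁻¹) • ξ.2 i) =
    (X.2 i : GL HIdx ℝ)⁻¹ • ((ξ.1 : GL HIdx ℝ)⁻¹ • ξ.2 i)
  rw [smul_smul, smul_smul, Subgroup.coe_mul]
  congr 1
  group

/-- The fourth homogeneous coordinate to which landmarks are normalized: `1` for points and `0` for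
bearings. -/
def rcoef {np nb : ℕ} : Idx np nb → ℝ := Sum.elim (fun _ => 1) (fun _ => 0)

theorem exists_isRep_of_mem {np nb : ℕ} {ξ : TotalSpace np nb} (h : ξ ∈ reducedTotalSpace np nb)
    (i : Idx np nb) : ∃ z, z ≠ 0 ∧ IsRep (body ξ i) z (rcoef i) := by
  rcases i with i | j
  · exact IsRep.of_mem_pointOrbit (h.1 i)
  · exact IsRep.of_mem_bearingOrbit (h.2 j)

theorem mem_reducedTotalSpace {np nb : ℕ} {ξ : TotalSpace np nb} {z : Idx np nb → R3}
    (hz : ∀ i, z i ≠ 0) (h : ∀ i, IsRep (body ξ i) (z i) (rcoef i)) :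
    ξ ∈ reducedTotalSpace np nb :=
  ⟨fun i => (h (Sum.inl i)).mem_pointOrbit (hz _), fun j => (h (Sum.inr j)).mem_bearingOrbit⟩

/-! ### Errors and innovations in homogeneous coordinates -/

section Formulas

variable {np nb : ℕ} {ξ ξhat : TotalSpace np nb} {x z : R3}

/-- `k Σᵢ Π_x Gᵢ Π_x`, the matrix through which the innovation corrects the landmark `i`. -/
noncomputable def corrMat (k kG : ℝ) (S : Fin np → ℝ → Matrix (Fin 3) (Fin 3) ℝ) (t : ℝ)
    (i : Idx np nb) (x : R3) : Matrix (Fin 3) (Fin 3) ℝ :=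
  (k • (sigma S t i * proj x * gainG kG i)) * proj x

/-- The innovation in terms of arbitrary homogeneous coordinates: representatives of norm one can
be replaced by others at the cost of the factor `1 / |z|²`. -/
theorem innovation_eq {i : Idx np nb} {r r' : ℝ} (hx : x ≠ 0) (hz : z ≠ 0)
    (h : IsRep (body ξ i) x r) (h' : IsRep (body ξhat i) z r') (k kG : ℝ)
    (S : Fin np → ℝ → Matrix (Fin 3) (Fin 3) ℝ) (t : ℝ) :
    innovation k kG S t ξ ξhat i =
      sotMat ((z ⬝ᵥ z)⁻¹ • crossProduct z (corrMat k kG S t i x *ᵥ z))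
        (-((z ⬝ᵥ z)⁻¹ * (z ⬝ᵥ (corrMat k kG S t i x *ᵥ z)))) := by
  obtain ⟨c, hc, hu⟩ := h'.unitRep_camera hz
  have h1 : skew (c • z) = c • skew z := by
    ext a b
    fin_cases a <;> fin_cases b <;> simp [skew]
  have h2 : c * k * c = (z ⬝ᵥ z)⁻¹ * k := by rw [← hc]; ring
  simp only [innovation, output, h.proj_camera hx, hu, ← skew_mulVec, Matrix.mulVec_smul, h1,
    Matrix.smul_mulVec, smul_smul, smul_dotProduct, dotProduct_smul, smul_eq_mul, h2, ← mul_assoc,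
    Matrix.mulVec_mulVec, corrMat, Matrix.smul_mul]

theorem bearingError_eq {j : Fin nb} {r r' : ℝ} (hx : x ≠ 0) (hz : z ≠ 0)
    (h : IsRep (body ξ (Sum.inr j)) x r) (h' : IsRep (body ξhat (Sum.inr j)) z r') :
    bearingError ξhat ξ j = 1 - (x ⬝ᵥ z) ^ 2 / ((x ⬝ᵥ x) * (z ⬝ᵥ z)) := by
  obtain ⟨c, hc, hu⟩ := h'.unitRep_camera hz
  obtain ⟨d, hd, hv⟩ := h.unitRep_camera hx
  have h1 := dot_self_pos hx
  have h2 := dot_self_pos hz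
  rw [bearingError, output, output, hu, hv, smul_dotProduct, dotProduct_smul, smul_eq_mul,
    smul_eq_mul, show (d * (c * (x ⬝ᵥ z))) ^ 2 = (d * d) * (c * c) * (x ⬝ᵥ z) ^ 2 by ring, hc, hd]
  field_simp

theorem pointError_eq {i : Fin np}
    (h : IsRep (body ξ (Sum.inl i)) x 1) (h' : IsRep (body ξhat (Sum.inl i)) z 1) :
    pointError ξhat ξ i = z - x := by
  rw [pointError, h.position_eq, h'.position_eq]

end Formulas

/-! ### The Riccati equation -/

theorem dot_mulVec_comm {ι : Type} [Fintype ι] {M : Matrix ι ι ℝ} (hM : Mᵀ = M) (v w : ι → ℝ) :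
    v ⬝ᵥ (M *ᵥ w) = (M *ᵥ v) ⬝ᵥ w := by
  rw [Matrix.dotProduct_mulVec, ← Matrix.mulVec_transpose, hM]

theorem dot_skew_mulVec (ω v w : R3) : v ⬝ᵥ (skew ω *ᵥ w) = -((skew ω *ᵥ v) ⬝ᵥ w) := by
  rw [Matrix.dotProduct_mulVec, ← Matrix.mulVec_transpose, skew_transpose, Matrix.neg_mulVec,
    neg_dotProduct]

theorem quadForm_le {ι : Type} [Fintype ι] (M : Matrix ι ι ℝ) (v : ι → ℝ) :
    v ⬝ᵥ (M *ᵥ v) ≤ (∑ a, ∑ b, |M a b|) * (v ⬝ᵥ v) := by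
  have h1 : ∀ a, v a * v a ≤ v ⬝ᵥ v := fun a =>
    Finset.single_le_sum (f := fun a => v a * v a) (fun i _ => mul_self_nonneg _)
      (Finset.mem_univ a)
  have h3 : v ⬝ᵥ (M *ᵥ v) = ∑ a, ∑ b, v a * (M a b * v b) := by
    simp only [dotProduct, Matrix.mulVec, Finset.mul_sum]
  rw [h3, Finset.sum_mul]
  simp only [Finset.sum_mul]
  refine Finset.sum_le_sum fun a _ => Finset.sum_le_sum fun b _ => ?_
  have h2 : |v a * v b| ≤ v ⬝ᵥ v := by
    rw [abs_mul]
    nlinarith [h1 a, h1 b, sq_nonneg (|v a| - |v b|), abs_mul_abs_self (v a),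
      abs_mul_abs_self (v b)]
  calc v a * (M a b * v b) = M a b * (v a * v b) := by ring
    _ ≤ |M a b * (v a * v b)| := le_abs_self _
    _ = |M a b| * |v a * v b| := abs_mul _ _
    _ ≤ |M a b| * (v ⬝ᵥ v) := mul_le_mul_of_nonneg_left h2 (abs_nonneg _)

theorem _root_.Matrix.IsHermitian.eq_transpose {ι : Type} {M : Matrix ι ι ℝ}
    (h : M.IsHermitian) : Mᵀ = M := by
  have := h.eq
  rwa [Matrix.conjTranspose_eq_transpose_of_trivial] at this

theorem continuous_comp_max {E : Type*} [TopologicalSpace E] {f : ℝ → E}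
    (hf : ContinuousOn f (Ici 0)) : Continuous fun t => f (max t 0) :=
  hf.comp_continuous (by fun_prop) fun _ => mem_Ici.2 (le_max_right _ _)

theorem exists_fundamental_Ici {ι : Type} [Fintype ι] [DecidableEq ι] {M : ℝ → Matrix ι ι ℝ}
    (hM : ContinuousOn M (Ici 0)) :
    ∃ X Y : ℝ → Matrix ι ι ℝ, X 0 = 1 ∧ Y 0 = 1 ∧
      (∀ t ∈ Ici (0 : ℝ), HasMatDeriv X (X t * M t) (Ici 0) t) ∧
      (∀ t ∈ Ici (0 : ℝ), HasMatDeriv Y (-(M t * Y t)) (Ici 0) t) ∧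
      (∀ t, X t * Y t = 1) ∧ ∀ t, Y t * X t = 1 := by
  obtain ⟨X, Y, h1, h2, h3, h4, h5, h6⟩ := exists_fundamental (continuous_comp_max hM)
  refine ⟨X, Y, h1, h2, fun t ht => ?_, fun t ht => ?_, h5, h6⟩
  · have := (h3 t).mono (subset_univ (Ici 0))
    rwa [max_eq_left (mem_Ici.1 ht)] at this
  · have := (h4 t).mono (subset_univ (Ici 0))
    rwa [max_eq_left (mem_Ici.1 ht)] at this

theorem continuous_skew : Continuous skew := by
  refine continuous_matrix fun a b => ?_
  fin_cases a <;> fin_cases b <;> simp [skew] <;> fun_prop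

section Riccati

variable {kG kH : ℝ} {ω x : ℝ → R3}

/-- The Riccati equation along a direction `x(t)` seen from a frame of angular velocity `ω(t)`. -/
def RiccatiAlong (kG kH : ℝ) (ω x : ℝ → R3) (P : ℝ → Mat3) : Prop :=
  ∀ t ∈ Ici (0 : ℝ), HasMatDeriv P
    (P t * skew (ω t) - skew (ω t) * P t + kH • 1 - kG • (P t * proj (x t) * P t)) (Ici 0) t

variable {P : ℝ → Mat3}

theorem RiccatiAlong.continuousOn (h : RiccatiAlong kG kH ω x P) : ContinuousOn P (Ici 0) :=
  continuousOn_of_hasMatDeriv h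

theorem RiccatiAlong.symm (h : RiccatiAlong kG kH ω x P) (hω : ContinuousOn ω (Ici 0))
    (hx : ContinuousOn (fun t => proj (x t)) (Ici 0)) (h0 : (P 0)ᵀ = P 0) :
    ∀ t ∈ Ici (0 : ℝ), (P t)ᵀ = P t := by
  have hc := h.continuousOn
  have hw : ContinuousOn (fun t => skew (ω t)) (Ici 0) := continuous_skew.comp_continuousOn hω
  have hcT : ContinuousOn (fun t => (P t)ᵀ) (Ici 0) :=
    (continuous_id.matrix_transpose).comp_continuousOn hc
  -- `P - Pᵀ` solves the linear equation `D' = D M - N D`.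
  obtain ⟨X1, Y, _, _, _, hY, _, hXY⟩ := exists_fundamental_Ici
    (M := fun t => skew (ω t) - kG • (proj (x t) * P t)) (hw.sub ((hx.mul hc).const_smul kG))
  obtain ⟨X, Y1, _, _, hX, _, _, hXX'⟩ := exists_fundamental_Ici
    (M := fun t => skew (ω t) + kG • ((P t)ᵀ * proj (x t))) (hw.add ((hcT.mul hx).const_smul kG))
  intro t ht
  have hD : ∀ s ∈ Ici (0 : ℝ), HasMatDeriv (fun s => X s * (P s - (P s)ᵀ) * Y s) 0 (Ici 0) s := by
    intro s hs
    refine (((hX s hs).mul ((h s hs).sub (h s hs).transpose)).mul (hY s hs)).congr_deriv ?_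
    simp only [Matrix.transpose_sub, Matrix.transpose_add, Matrix.transpose_smul,
      Matrix.transpose_mul, proj_transpose, skew_transpose, Matrix.transpose_one, Matrix.mul_sub,
      Matrix.sub_mul, Matrix.mul_add, Matrix.add_mul, Matrix.mul_smul, Matrix.smul_mul,
      Matrix.mul_neg, Matrix.neg_mul, Matrix.mul_assoc, Matrix.mul_one, smul_sub]
    abel
  have h1 := mat_eq_of_hasMatDeriv_zero (convex_Ici 0) hD (fun _ _ => rfl) ht
    (mem_Ici.2 le_rfl)
  simp only [h0, sub_self, Matrix.mul_zero, Matrix.zero_mul] at h1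
  have h2 : P t - (P t)ᵀ = Y1 t * (X t * (P t - (P t)ᵀ) * Y t) * X1 t := by
    rw [Matrix.mul_assoc (X t), ← Matrix.mul_assoc, ← Matrix.mul_assoc, hXX', Matrix.one_mul,
      Matrix.mul_assoc, hXY, Matrix.mul_one]
  rw [h1, Matrix.mul_zero, Matrix.zero_mul] at h2
  exact (sub_eq_zero.1 h2).symm

/-- With `A = -ω^× - ½ k_G P Π` the Riccati equation reads `P' = A P + P Aᵀ + k_H I`, so that
`X P Xᵀ` increases when `X' = -X A`. -/
theorem RiccatiAlong.pos (h : RiccatiAlong kG kH ω x P) (hω : ContinuousOn ω (Ici 0))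
    (hx : ContinuousOn (fun t => proj (x t)) (Ici 0)) (hkH : 0 < kH)
    (h0 : (P 0).PosDef) : ∀ t ∈ Ici (0 : ℝ), ∀ v ≠ 0, 0 < v ⬝ᵥ (P t *ᵥ v) := by
  have hc := h.continuousOn
  have hsymm := h.symm hω hx h0.isHermitian.eq_transpose
  have hw : ContinuousOn (fun t => skew (ω t)) (Ici 0) := continuous_skew.comp_continuousOn hω
  obtain ⟨X, Y, hX0, _, hX, _, hXY, hYX⟩ := exists_fundamental_Ici
    (M := fun t => skew (ω t) + (kG / 2) • (P t * proj (x t)))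
    (hw.add ((hc.mul hx).const_smul (kG / 2)))
  intro t ht v hv
  have hd : ∀ s ∈ Ici (0 : ℝ), HasMatDeriv (fun s => X s * P s * (X s)ᵀ)
      (kH • (X s * (X s)ᵀ)) (Ici 0) s := by
    intro s hs
    refine (((hX s hs).mul (h s hs)).mul (hX s hs).transpose).congr_deriv ?_
    have h1 : kG • (X s * (P s * (proj (x s) * (P s * (X s)ᵀ)))) =
        (kG / 2) • (X s * (P s * (proj (x s) * (P s * (X s)ᵀ)))) +
        (kG / 2) • (X s * (P s * (proj (x s) * (P s * (X s)ᵀ)))) := by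
      rw [← add_smul, add_halves]
    simp only [Matrix.transpose_add, Matrix.transpose_smul,
      Matrix.transpose_mul, proj_transpose, skew_transpose, Matrix.mul_sub,
      Matrix.sub_mul, Matrix.mul_add, Matrix.add_mul, Matrix.mul_smul, Matrix.smul_mul,
      Matrix.mul_neg, Matrix.neg_mul, Matrix.mul_assoc, Matrix.one_mul, hsymm s hs, h1]
    abel
  set w := (Y t)ᵀ *ᵥ v with hwdef
  have hwv : (X t)ᵀ *ᵥ w = v := by
    rw [hwdef, Matrix.mulVec_mulVec, ← Matrix.transpose_mul, hYX, Matrix.transpose_one,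
      Matrix.one_mulVec]
  have hw0 : w ≠ 0 := by
    intro hw
    rw [hw, Matrix.mulVec_zero] at hwv
    exact hv hwv.symm
  have hq : ∀ s, w ⬝ᵥ ((X s * P s * (X s)ᵀ) *ᵥ w) =
      ((X s)ᵀ *ᵥ w) ⬝ᵥ (P s *ᵥ ((X s)ᵀ *ᵥ w)) := fun s => by
    rw [← Matrix.mulVec_mulVec, ← Matrix.mulVec_mulVec, Matrix.dotProduct_mulVec,
      ← Matrix.mulVec_transpose]
  have hanti := antitoneOn_of_hasDerivWithinAt_nonpos (convex_Ici (0 : ℝ))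
    (f := fun s => -(w ⬝ᵥ ((X s * P s * (X s)ᵀ) *ᵥ w)))
    (fun s hs => (hasDerivWithinAt_dotProduct (hasDerivWithinAt_const s _ w)
      ((hd s hs).mulVec (hasDerivWithinAt_const s _ w))).fun_neg)
    (fun s hs => by
      have : 0 ≤ ((X s)ᵀ *ᵥ w) ⬝ᵥ ((X s)ᵀ *ᵥ w) := dot_self_nonneg _
      rw [Matrix.smul_mulVec, Matrix.mulVec_zero, add_zero, zero_dotProduct, zero_add,
        dotProduct_smul, ← Matrix.mulVec_mulVec, Matrix.dotProduct_mulVec,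
        ← Matrix.mulVec_transpose, smul_eq_mul]
      nlinarith)
  have h1 := hanti (mem_Ici.2 le_rfl) ht (mem_Ici.1 ht)
  beta_reduce at h1
  rw [hq, hq, hwv, hX0, Matrix.transpose_one, Matrix.one_mulVec] at h1
  have h2 : 0 < w ⬝ᵥ (P 0 *ᵥ w) := by simpa using h0.dotProduct_mulVec_pos hw0
  linarith

/-- The bound is obtained by duality. With `ψ(s) = k_G ∫ Π w` over a window that ends at `t`, the
quantity `ψᵀ P ψ` starts at `0` and grows at most at the rate `k_H |ψ|² + k_G |w|²`, while
persistence of excitation makes every vector a value `ψ(t)` with a controlled `w`. -/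
theorem RiccatiAlong.quadForm_le_of_excited {x : ℝ → R3} {P : ℝ → Mat3}
    (h : RiccatiAlong kG kH 0 x P)
    (hx : ContinuousOn (fun t => proj (x t)) (Ici 0)) (hx0 : ∀ t ∈ Ici (0 : ℝ), x t ≠ 0)
    (hsymm : ∀ t ∈ Ici (0 : ℝ), (P t)ᵀ = P t) (hkG : 0 < kG) (hkH : 0 < kH)
    {δ μ t₀ : ℝ} (hδ : 0 < δ) (hμ : 0 < μ) (ht₀ : 0 < t₀)
    (hPE : ∀ v : R3, δ * μ * (v ⬝ᵥ v) ≤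
      v ⬝ᵥ ((Matrix.of fun a b : Fin 3 => ∫ s in t₀..(t₀ + δ), proj (x s) a b) *ᵥ v)) (v : R3) :
    v ⬝ᵥ (P (t₀ + δ) *ᵥ v) ≤
      (δ * (kH * kG ^ 2 * δ ^ 2 + kG) / (kG * δ * μ) ^ 2) * (v ⬝ᵥ v) := by
  set Q : ℝ → Mat3 := fun s => proj (x (max s 0)) with hQ
  have hQc : Continuous Q := continuous_comp_max hx
  have hQx : ∀ s ∈ Ici (0 : ℝ), Q s = proj (x s) := fun s hs => by
    simp only [hQ, max_eq_left (mem_Ici.1 hs)]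
  have hsub : Icc t₀ (t₀ + δ) ⊆ Ici 0 := fun s hs => mem_Ici.2 (ht₀.le.trans hs.1)
  set F : ℝ → Mat3 := fun s => Matrix.of fun a b => ∫ r in t₀..s, Q r a b with hF
  have hFd : ∀ s, HasMatDeriv F (Q s) (Icc t₀ (t₀ + δ)) s := fun s a b => by
    have hc : Continuous fun r => Q r a b := hQc.matrix_elem a b
    exact (intervalIntegral.integral_hasDerivAt_right (hc.intervalIntegrable _ _)
      (hc.stronglyMeasurableAtFilter _ _) hc.continuousAt).hasDerivWithinAt
  have hF0 : F t₀ = 0 := by ext a b; simp [hF]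
  set W : Mat3 := F (t₀ + δ) with hW
  have hWeq : W = Matrix.of fun a b : Fin 3 => ∫ s in t₀..(t₀ + δ), proj (x s) a b := by
    ext a b
    simp only [hW, hF, Matrix.of_apply]
    refine intervalIntegral.integral_congr fun s hs => ?_
    rw [uIcc_of_le (by linarith)] at hs
    simp only [hQx s (hsub hs)]
  rw [← hWeq] at hPE
  -- `W` is invertible, so that `v = k_G W w` for some `w`
  have hWinj : Function.Injective W.mulVec := by
    intro a b hab
    have h1 : W *ᵥ (a - b) = 0 := by rw [Matrix.mulVec_sub]; exact sub_eq_zero.2 hab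
    have h2 := hPE (a - b)
    rw [h1, dotProduct_zero] at h2
    have h3 : (a - b) ⬝ᵥ (a - b) ≤ 0 := by
      by_contra hlt
      push Not at hlt
      nlinarith [mul_pos (mul_pos hδ hμ) hlt]
    exact sub_eq_zero.1 (dotProduct_self_eq_zero.1 (le_antisymm h3 (dot_self_nonneg _)))
  obtain ⟨w, hw⟩ := (Matrix.mulVec_surjective_iff_isUnit.2
    (Matrix.mulVec_injective_iff_isUnit.1 hWinj)) (kG⁻¹ • v)
  have hwv : kG • (W *ᵥ w) = v := by rw [hw, smul_smul, mul_inv_cancel₀ hkG.ne', one_smul]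
  set ψ : ℝ → R3 := fun s => kG • (F s *ᵥ w) with hψ
  have hψd : ∀ s, HasDerivWithinAt ψ (kG • (Q s *ᵥ w)) (Icc t₀ (t₀ + δ)) s := fun s => by
    have h1 := ((hFd s).mulVec (hasDerivWithinAt_const s (Icc t₀ (t₀ + δ)) w)).const_smul kG
    rwa [Matrix.mulVec_zero, add_zero] at h1
  have hψ0 : ψ t₀ = 0 := by simp [hψ, hF0]
  have hw0 : 0 ≤ w ⬝ᵥ w := dot_self_nonneg w
  have hQne : ∀ s ∈ Icc t₀ (t₀ + δ), x s ≠ 0 := fun s hs => hx0 s (hsub hs)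
  have hmem0 : t₀ ∈ Icc t₀ (t₀ + δ) := ⟨le_rfl, by linarith⟩
  have hmem1 : t₀ + δ ∈ Icc t₀ (t₀ + δ) := ⟨by linarith, le_rfl⟩
  have hψb : ∀ s ∈ Icc t₀ (t₀ + δ), ψ s ⬝ᵥ ψ s ≤ kG ^ 2 * δ ^ 2 * (w ⬝ᵥ w) := by
    intro s hs
    set e := ψ s with he
    set c : ℝ := (e ⬝ᵥ e) / (2 * δ) + kG ^ 2 * δ * (w ⬝ᵥ w) / 2 with hc
    have hanti := antitoneOn_of_hasDerivWithinAt_nonpos (convex_Icc t₀ (t₀ + δ))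
      (f := fun r => e ⬝ᵥ ψ r - c * r)
      (fun r _ => (hasDerivWithinAt_dotProduct (hasDerivWithinAt_const r _ e) (hψd r)).sub
        ((hasDerivWithinAt_id r _).const_mul c))
      (fun r hr => by
        have h1 : 0 ≤ (e - (kG * δ) • (Q r *ᵥ w)) ⬝ᵥ (e - (kG * δ) • (Q r *ᵥ w)) :=
          dot_self_nonneg _
        have h2 : (Q r *ᵥ w) ⬝ᵥ (Q r *ᵥ w) ≤ w ⬝ᵥ w := by
          rw [hQx r (hsub hr), proj_mulVec_dot_self (hQne r hr)]
          exact dot_proj_le _ _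
        simp only [sub_dotProduct, dotProduct_sub, smul_dotProduct, dotProduct_smul,
          smul_eq_mul, dotProduct_comm (Q r *ᵥ w) e] at h1
        rw [zero_dotProduct, zero_add, dotProduct_smul, smul_eq_mul, mul_one, hc, sub_nonpos]
        have h3 : (kG * δ) * (kG * δ) * ((Q r *ᵥ w) ⬝ᵥ (Q r *ᵥ w)) ≤
            (kG * δ) * (kG * δ) * (w ⬝ᵥ w) := mul_le_mul_of_nonneg_left h2 (by positivity)
        have h4 : 2 * δ * (kG * (e ⬝ᵥ (Q r *ᵥ w))) ≤
            2 * δ * ((e ⬝ᵥ e) / (2 * δ) + kG ^ 2 * δ * (w ⬝ᵥ w) / 2) := by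
          have : 2 * δ * ((e ⬝ᵥ e) / (2 * δ) + kG ^ 2 * δ * (w ⬝ᵥ w) / 2) =
            e ⬝ᵥ e + (kG * δ) * (kG * δ) * (w ⬝ᵥ w) := by field_simp
          rw [this]
          linarith
        exact le_of_mul_le_mul_left h4 (by positivity))
    have h1 := hanti hmem0 hs hs.1
    simp only [hψ0, dotProduct_zero] at h1
    have hc0 : 0 ≤ c := by have := dot_self_nonneg e; positivity
    have h2 : e ⬝ᵥ e ≤ c * δ := by
      have : c * (s - t₀) ≤ c * δ := mul_le_mul_of_nonneg_left (by linarith [hs.2]) hc0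
      have h3 : e ⬝ᵥ ψ s = e ⬝ᵥ e := rfl
      linarith
    have h3 : c * δ = (e ⬝ᵥ e) / 2 + kG ^ 2 * δ ^ 2 * (w ⬝ᵥ w) / 2 := by
      rw [hc]; field_simp
    linarith
  set C : ℝ := (kH * kG ^ 2 * δ ^ 2 + kG) * (w ⬝ᵥ w) with hC
  have hanti := antitoneOn_of_hasDerivWithinAt_nonpos (convex_Icc t₀ (t₀ + δ))
    (f := fun s => ψ s ⬝ᵥ (P s *ᵥ ψ s) - C * s)
    (fun s hs => (hasDerivWithinAt_dotProduct (hψd s)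
      (((h s (hsub hs)).mono hsub).mulVec (hψd s))).sub ((hasDerivWithinAt_id s _).const_mul C))
    (fun s hs => by
      have h1 := hψb s hs
      have hs0 := hsub hs
      rw [hQx s hs0]
      set Pi := proj (x s)
      have h2 : w ⬝ᵥ (Pi *ᵥ w) ≤ w ⬝ᵥ w := dot_proj_le _ _
      have h3 := dot_proj_nonneg (hQne s hs) (w - P s *ᵥ ψ s)
      have h4 : ∀ a b : R3, a ⬝ᵥ (Pi *ᵥ b) = b ⬝ᵥ (Pi *ᵥ a) := fun a b => by
        rw [dot_mulVec_comm (proj_transpose _), dotProduct_comm]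
      have h5 : ψ s ⬝ᵥ (P s *ᵥ (Pi *ᵥ w)) = w ⬝ᵥ (Pi *ᵥ (P s *ᵥ ψ s)) := by
        rw [dot_mulVec_comm (hsymm s hs0), h4]
      have h6 : ψ s ⬝ᵥ (P s *ᵥ (Pi *ᵥ (P s *ᵥ ψ s))) =
          (P s *ᵥ ψ s) ⬝ᵥ (Pi *ᵥ (P s *ᵥ ψ s)) := by
        rw [dot_mulVec_comm (hsymm s hs0)]
      simp only [Matrix.mulVec_sub, dotProduct_sub, sub_dotProduct] at h3
      have hz : skew ((0 : ℝ → R3) s) = 0 := by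
        ext a b; fin_cases a <;> fin_cases b <;> simp [skew]
      rw [hz]
      simp only [Matrix.mul_zero, Matrix.zero_mul, sub_self, zero_add, Matrix.sub_mulVec,
        Matrix.smul_mulVec, Matrix.one_mulVec, dotProduct_add, dotProduct_sub, dotProduct_smul,
        smul_dotProduct, Matrix.mulVec_smul, ← Matrix.mulVec_mulVec, smul_eq_mul, h5, h6, mul_one,
        hC]
      rw [dotProduct_comm (Pi *ᵥ w), h4 (P s *ᵥ ψ s) w]
      rw [h4 (P s *ᵥ ψ s) w] at h3
      nlinarith [mul_le_mul_of_nonneg_left h1 hkH.le, mul_le_mul_of_nonneg_left h2 hkG.le,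
        mul_nonneg hkG.le h3])
  have h1 := hanti hmem0 hmem1 (by linarith)
  have h2 : ψ (t₀ + δ) = v := hwv
  simp only [hψ0, zero_dotProduct, h2] at h1
  have h3 : kG * δ * μ * (w ⬝ᵥ w) ≤ v ⬝ᵥ w := by
    have := mul_le_mul_of_nonneg_left (hPE w) hkG.le
    rw [← hwv, smul_dotProduct, dotProduct_comm (W *ᵥ w), smul_eq_mul]
    linarith
  -- Cauchy-Schwarz turns `κ |w|² ≤ v ⬝ᵥ w` into `κ² |w|² ≤ |v|²`
  have h4 : (kG * δ * μ) ^ 2 * (w ⬝ᵥ w) ≤ v ⬝ᵥ v := by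
    have h5 : 0 ≤ (v - (kG * δ * μ) • w) ⬝ᵥ (v - (kG * δ * μ) • w) := dot_self_nonneg _
    simp only [sub_dotProduct, dotProduct_sub, smul_dotProduct, dotProduct_smul,
          smul_eq_mul, dotProduct_comm w v] at h5
    have hκ : 0 < kG * δ * μ := by positivity
    nlinarith [mul_le_mul_of_nonneg_left h3 hκ.le]
  have hκ : 0 < (kG * δ * μ) ^ 2 := by positivity
  have h5 : w ⬝ᵥ w ≤ (v ⬝ᵥ v) / (kG * δ * μ) ^ 2 := by
    rw [le_div_iff₀ hκ]; linarith
  have h6 : v ⬝ᵥ (P (t₀ + δ) *ᵥ v) ≤ δ * (kH * kG ^ 2 * δ ^ 2 + kG) * (w ⬝ᵥ w) := by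
    rw [hC] at h1; linarith
  refine h6.trans ((mul_le_mul_of_nonneg_left h5 (by positivity)).trans (le_of_eq ?_))
  ring

theorem proj_rotate {R : Mat3} (hR : Rᵀ * R = 1) (y : R3) :
    proj (R *ᵥ y) = R * proj y * Rᵀ := by
  have h1 : (R *ᵥ y) ⬝ᵥ (R *ᵥ y) = y ⬝ᵥ y := by
    rw [Matrix.dotProduct_mulVec, ← Matrix.mulVec_transpose, Matrix.mulVec_mulVec, hR,
      Matrix.one_mulVec]
  rw [proj, proj, h1, Matrix.mul_sub, Matrix.mul_one, Matrix.sub_mul, mul_eq_one_comm.1 hR,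
    Matrix.mul_smul, Matrix.smul_mul, Matrix.mul_vecMulVec, Matrix.vecMulVec_mul,
    ← Matrix.mulVec_transpose, Matrix.transpose_transpose]

/-- Passing to the inertial frame removes the angular velocity. -/
theorem RiccatiAlong.rotate (h : RiccatiAlong kG kH ω x P) {R : ℝ → Mat3}
    (hR : ∀ t ∈ Ici (0 : ℝ), HasMatDeriv R (R t * skew (ω t)) (Ici 0) t)
    (hRo : ∀ t, (R t)ᵀ * R t = 1) :
    RiccatiAlong kG kH 0 (fun t => R t *ᵥ x t) (fun t => R t * P t * (R t)ᵀ) := by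
  intro t ht
  have hz : skew ((0 : ℝ → R3) t) = 0 := by
    ext a b; fin_cases a <;> fin_cases b <;> simp [skew]
  have hRo' : ∀ A : Mat3, (R t)ᵀ * (R t * A) = A := fun A => by
    rw [← Matrix.mul_assoc, hRo, Matrix.one_mul]
  refine (((hR t ht).mul (h t ht)).mul (hR t ht).transpose).congr_deriv ?_
  rw [hz, proj_rotate (hRo t)]
  simp only [Matrix.transpose_mul, skew_transpose, Matrix.mul_sub, Matrix.sub_mul, Matrix.mul_add,
    Matrix.add_mul, Matrix.mul_smul, Matrix.smul_mul, Matrix.mul_neg, Matrix.neg_mul,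
    Matrix.mul_assoc, hRo', Matrix.mul_zero, Matrix.zero_mul, Matrix.one_mul,
    mul_eq_one_comm.1 (hRo t)]
  abel

/-- Persistence of excitation bounds the Riccati solution: after the first window by
`RiccatiAlong.quadForm_le_of_excited`, before by compactness. -/
theorem RiccatiAlong.exists_upper_bound (h : RiccatiAlong kG kH ω x P)
    (hω : ContinuousOn ω (Ici 0)) (hx : ContinuousOn (fun t => proj (x t)) (Ici 0))
    (hx0 : ∀ t ∈ Ici (0 : ℝ), x t ≠ 0) (hkG : 0 < kG) (hkH : 0 < kH) (h0 : (P 0).PosDef)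
    {R : ℝ → Mat3} (hR : ∀ t ∈ Ici (0 : ℝ), HasMatDeriv R (R t * skew (ω t)) (Ici 0) t)
    (hRo : ∀ t, (R t)ᵀ * R t = 1)
    {δ μ : ℝ} (hδ : 0 < δ) (hμ : 0 < μ)
    (hPE : ∀ t > 0, ∀ v : R3, δ * μ * (v ⬝ᵥ v) ≤ v ⬝ᵥ
      ((Matrix.of fun a b : Fin 3 => ∫ s in t..(t + δ), proj (R s *ᵥ x s) a b) *ᵥ v)) :
    ∃ σ > 0, ∀ t ∈ Ici (0 : ℝ), ∀ v : R3, v ⬝ᵥ (P t *ᵥ v) ≤ σ * (v ⬝ᵥ v) := by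
  have hc := h.continuousOn
  have hsymm := h.symm hω hx h0.isHermitian.eq_transpose
  have hRc : ContinuousOn R (Ici 0) := continuousOn_of_hasMatDeriv hR
  have hRx : ∀ t ∈ Ici (0 : ℝ), R t *ᵥ x t ≠ 0 := fun t ht h1 => hx0 t ht (by
    have := congrArg (fun v => (R t)ᵀ *ᵥ v) h1
    simpa [Matrix.mulVec_mulVec, hRo] using this)
  have hprojc : ContinuousOn (fun t => proj (R t *ᵥ x t)) (Ici 0) := by
    simp only [fun t => proj_rotate (hRo t) (x t)]
    exact (hRc.mul hx).mul (continuous_id.matrix_transpose.comp_continuousOn hRc)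
  have h' := h.rotate hR hRo
  have hbig : ∀ t, δ < t → ∀ v : R3, v ⬝ᵥ (P t *ᵥ v) ≤
      (δ * (kH * kG ^ 2 * δ ^ 2 + kG) / (kG * δ * μ) ^ 2) * (v ⬝ᵥ v) := by
    intro t ht v
    have h1 := h'.quadForm_le_of_excited hprojc hRx (fun s hs => by
      rw [Matrix.transpose_mul, Matrix.transpose_mul, Matrix.transpose_transpose, hsymm s hs,
        Matrix.mul_assoc]) hkG hkH hδ hμ (t₀ := t - δ) (by linarith)
      (hPE (t - δ) (by linarith)) (R t *ᵥ v)
    rw [sub_add_cancel] at h1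
    have h2 : (R t)ᵀ *ᵥ (R t *ᵥ v) = v := by
      rw [Matrix.mulVec_mulVec, hRo, Matrix.one_mulVec]
    have h3 : (R t *ᵥ v) ⬝ᵥ (R t *ᵥ v) = v ⬝ᵥ v := by
      rw [Matrix.dotProduct_mulVec, ← Matrix.mulVec_transpose, h2]
    rwa [h3, ← Matrix.mulVec_mulVec, ← Matrix.mulVec_mulVec, h2, Matrix.dotProduct_mulVec,
      ← Matrix.mulVec_transpose, h2] at h1
  obtain ⟨C, hC⟩ := (isCompact_Icc (a := (0 : ℝ)) (b := δ)).exists_bound_of_continuousOn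
    (f := fun t => ∑ a, ∑ b, |P t a b|) (by
      refine continuousOn_finsetSum _ fun a _ => continuousOn_finsetSum _ fun b _ => ?_
      have : ContinuousOn (fun t => P t a b) (Ici 0) :=
        fun t ht => (h t ht a b).continuousWithinAt
      exact (this.mono fun s hs => hs.1).abs)
  refine ⟨max (max C (δ * (kH * kG ^ 2 * δ ^ 2 + kG) / (kG * δ * μ) ^ 2)) 1,
    lt_max_of_lt_right one_pos, fun t ht v => ?_⟩
  have hv := dot_self_nonneg v
  rcases le_or_gt t δ with h1 | h1
  · refine (quadForm_le (P t) v).trans (mul_le_mul_of_nonneg_right ?_ hv)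
    exact (le_abs_self _).trans ((hC t ⟨ht, h1⟩).trans ((le_max_left _ _).trans (le_max_left _ _)))
  · exact (hbig t h1 v).trans (mul_le_mul_of_nonneg_right
      ((le_max_right _ _).trans (le_max_left _ _)) hv)

end Riccati

/-! ### Decay of the landmark errors -/

theorem isUnit_of_quadForm_pos {P : Mat3} (h : ∀ v ≠ 0, 0 < v ⬝ᵥ (P *ᵥ v)) : IsUnit P := by
  refine Matrix.mulVec_injective_iff_isUnit.1 fun a b hab => ?_
  have h1 : P *ᵥ (a - b) = 0 := by rw [Matrix.mulVec_sub]; exact sub_eq_zero.2 hab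
  by_contra hne
  have h2 := h (a - b) (sub_ne_zero.2 hne)
  rw [h1, dotProduct_zero] at h2
  exact lt_irrefl _ h2

theorem HasMatDeriv.inv {J : Set ℝ} {t : ℝ} {P : ℝ → Mat3} {P' : Mat3} (ht : t ∈ J)
    (h : HasMatDeriv P P' J t) (hu : ∀ s ∈ J, IsUnit (P s)) :
    HasMatDeriv (fun s => (P s)⁻¹) (-((P t)⁻¹ * P' * (P t)⁻¹)) J t := by
  have hdet : ∀ s ∈ J, IsUnit (P s).det := fun s hs => (Matrix.isUnit_iff_isUnit_det _).1 (hu s hs)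
  by_cases hacc : UniqueDiffWithinAt ℝ J t
  swap
  -- at an isolated point of `J` every matrix is a derivative
  · intro a b
    exact HasFDerivWithinAt.of_not_accPt fun hacc' => hacc (uniqueDiffWithinAt_iff_accPt.2 hacc')
  -- The entries of the inverse are rational functions of those of `P`.
  have hd : ∀ a b, DifferentiableWithinAt ℝ (fun s => (P s)⁻¹ a b) J t := by
    have he : ∀ a b, DifferentiableWithinAt ℝ (fun s => P s a b) J t :=
      fun a b => (h a b).differentiableWithinAt
    have hne : (P t).det ≠ 0 := (hdet t ht).ne_zero
    have h1 : DifferentiableWithinAt ℝ (fun s => (P s).det) J t := by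
      simp only [Matrix.det_fin_three]
      fun_prop
    intro a b
    simp only [Matrix.inv_def, Ring.inverse_eq_inv', Matrix.smul_apply, smul_eq_mul]
    refine (h1.inv hne).mul ?_
    simp only [Matrix.adjugate_fin_three]
    fin_cases a <;> fin_cases b <;> simp <;> fun_prop
  have hN : HasMatDeriv (fun s => (P s)⁻¹)
      (Matrix.of fun a b => derivWithin (fun s => (P s)⁻¹ a b) J t) J t :=
    fun a b => (hd a b).hasDerivWithinAt
  set N' : Mat3 := Matrix.of fun a b => derivWithin (fun s => (P s)⁻¹ a b) J t
  refine hN.congr_deriv ?_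
  have h1 : N' * P t + (P t)⁻¹ * P' = 0 := by
    ext a b
    have h2 := (hN.mul h) a b
    have h3 : HasDerivWithinAt (fun s => ((P s)⁻¹ * P s) a b) 0 J t :=
      (hasDerivWithinAt_const t J ((1 : Mat3) a b)).congr
        (fun s hs => by rw [Matrix.nonsing_inv_mul _ (hdet s hs)])
        (by rw [Matrix.nonsing_inv_mul _ (hdet t ht)])
    exact hacc.eq_deriv _ h2 h3
  have h2 : N' = N' * P t * (P t)⁻¹ := by
    rw [Matrix.mul_assoc, Matrix.mul_nonsing_inv _ (hdet t ht), Matrix.mul_one]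
  rw [h2, eq_neg_of_add_eq_zero_left h1, Matrix.neg_mul]

section PointError

variable {kG kH k σ : ℝ} {ω x : ℝ → R3} {P : ℝ → Mat3}

/-- Exponential decay of `e ⬝ᵥ P⁻¹ e` for a point landmark. Its derivative is
`-(2 k - 1) k_G |Π e|² - k_H |P⁻¹ e|²`. -/
theorem RiccatiAlong.pointError_decay (h : RiccatiAlong kG kH ω x P)
    (hx0 : ∀ t ∈ Ici (0 : ℝ), x t ≠ 0)
    (hsymm : ∀ t ∈ Ici (0 : ℝ), (P t)ᵀ = P t)
    (hpos : ∀ t ∈ Ici (0 : ℝ), ∀ v ≠ 0, 0 < v ⬝ᵥ (P t *ᵥ v))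
    (hkG : 0 < kG) (hkH : 0 < kH) (hk : 1 / 2 < k) (hσ : 0 < σ)
    (hbd : ∀ t ∈ Ici (0 : ℝ), ∀ v : R3, v ⬝ᵥ (P t *ᵥ v) ≤ σ * (v ⬝ᵥ v))
    {J : Set ℝ} (hJ : Convex ℝ J) (hJ0 : J ⊆ Ici 0) (h0 : (0 : ℝ) ∈ J) {e : ℝ → R3}
    (he : ∀ t ∈ J, HasDerivWithinAt e
      (-(skew (ω t) *ᵥ e t) - (k * kG) • (P t *ᵥ (proj (x t) *ᵥ e t))) J t) :
    ∀ t ∈ J, e t ⬝ᵥ ((P t)⁻¹ *ᵥ e t) ≤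
      Real.exp (-(kH / σ) * t) * (e 0 ⬝ᵥ ((P 0)⁻¹ *ᵥ e 0)) := by
  have hu : ∀ t ∈ J, IsUnit (P t) := fun t ht => isUnit_of_quadForm_pos (hpos t (hJ0 ht))
  have hdet : ∀ t ∈ J, IsUnit (P t).det := fun t ht =>
    (Matrix.isUnit_iff_isUnit_det _).1 (hu t ht)
  have hd := fun t (ht : t ∈ J) => hasDerivWithinAt_dotProduct (he t ht)
    ((HasMatDeriv.inv ht ((h t (hJ0 ht)).mono hJ0) hu).mulVec (he t ht))
  have hexp : ∀ t ∈ J, HasDerivWithinAt (fun s => Real.exp (kH / σ * s))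
      (Real.exp (kH / σ * t) * (kH / σ * 1)) J t := fun t _ =>
    ((hasDerivWithinAt_id t J).const_mul (kH / σ)).exp
  have hanti := antitoneOn_of_hasDerivWithinAt_nonpos hJ
    (f := fun s => Real.exp (kH / σ * s) * (e s ⬝ᵥ ((P s)⁻¹ *ᵥ e s)))
    (fun t ht => (hexp t ht).mul (hd t ht)) (fun t ht => by
      set Pi := proj (x t)
      set N := (P t)⁻¹ with hN
      set g := N *ᵥ e t with hg
      have hNP : N * P t = 1 := Matrix.nonsing_inv_mul _ (hdet t ht)
      have hPN : P t * N = 1 := Matrix.mul_nonsing_inv _ (hdet t ht)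
      have hPs := hsymm t (hJ0 ht)
      have hNs : Nᵀ = N := by rw [hN, Matrix.transpose_nonsing_inv, hPs]
      have heg : P t *ᵥ g = e t := by rw [hg, Matrix.mulVec_mulVec, hPN, Matrix.one_mulVec]
      have hexp0 := Real.exp_pos (kH / σ * t)
      have hNd : N * (P t * skew (ω t) - skew (ω t) * P t + kH • 1
          - kG • (P t * proj (x t) * P t)) * N =
          skew (ω t) * N - N * skew (ω t) + kH • (N * N) - kG • Pi := by
        have h1 : ∀ A : Mat3, N * (P t * A) = A := fun A => by
          rw [← Matrix.mul_assoc, hNP, Matrix.one_mul]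
        simp only [Matrix.mul_sub, Matrix.sub_mul, Matrix.mul_add, Matrix.add_mul,
          Matrix.mul_smul, Matrix.smul_mul, Matrix.mul_assoc, h1, hPN, Matrix.mul_one]
        rfl
      rw [hNd]
      have hq := dot_proj_nonneg (hx0 t (hJ0 ht)) (e t)
      have h1 : e t ⬝ᵥ g ≤ σ * (g ⬝ᵥ g) := by
        have := hbd t (hJ0 ht) g
        rwa [heg, dotProduct_comm] at this
      have h2 : (skew (ω t) *ᵥ e t) ⬝ᵥ g = -(e t ⬝ᵥ (skew (ω t) *ᵥ g)) := by
        rw [dot_skew_mulVec, neg_neg]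
      have h3 : (P t *ᵥ (Pi *ᵥ e t)) ⬝ᵥ g = e t ⬝ᵥ (Pi *ᵥ e t) := by
        rw [← dot_mulVec_comm hPs, heg, dotProduct_comm]
      have h4 : ∀ v, e t ⬝ᵥ (N *ᵥ v) = v ⬝ᵥ g := fun v => by
        rw [dot_mulVec_comm hNs, dotProduct_comm]
      simp only [Matrix.neg_mulVec, Matrix.sub_mulVec, Matrix.add_mulVec, Matrix.smul_mulVec,
        ← Matrix.mulVec_mulVec, ← hg, dotProduct_add, dotProduct_neg, dotProduct_sub,
        dotProduct_smul, sub_dotProduct, neg_dotProduct, smul_dotProduct, smul_eq_mul, h4, h2, h3]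
      have hgg := dot_self_nonneg g
      have h5 : kH / σ * (e t ⬝ᵥ g) ≤ kH * (g ⬝ᵥ g) := by
        rw [div_mul_eq_mul_div, div_le_iff₀ hσ]
        nlinarith [mul_le_mul_of_nonneg_left h1 hkH.le]
      have h6 : 0 ≤ (2 * k - 1) * kG * (e t ⬝ᵥ (Pi *ᵥ e t)) :=
        mul_nonneg (mul_nonneg (by linarith) hkG.le) hq
      have h7 : (skew (ω t) *ᵥ e t) ⬝ᵥ g = -(e t ⬝ᵥ (skew (ω t) *ᵥ g)) := h2
      have h8 : kH / σ * (e t ⬝ᵥ g) - kH * (g ⬝ᵥ g)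
          - (2 * k - 1) * kG * (e t ⬝ᵥ (Pi *ᵥ e t)) ≤ 0 := by linarith
      refine le_of_eq_of_le ?_ (mul_nonpos_of_nonneg_of_nonpos hexp0.le h8)
      ring)
  intro t ht
  have h1 := hanti h0 ht (hJ0 ht)
  simp only [mul_zero, Real.exp_zero, one_mul] at h1
  have h2 : Real.exp (-(kH / σ) * t) * (Real.exp (kH / σ * t) * (e t ⬝ᵥ ((P t)⁻¹ *ᵥ e t))) =
      e t ⬝ᵥ ((P t)⁻¹ *ᵥ e t) := by
    rw [← mul_assoc, ← Real.exp_add]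
    simp
  rw [← h2]
  exact mul_le_mul_of_nonneg_left h1 (Real.exp_pos _).le

theorem dot_self_le_inv_quadForm {P : Mat3} (hsymm : Pᵀ = P)
    (hpos : ∀ v ≠ 0, 0 < v ⬝ᵥ (P *ᵥ v)) (hσ : 0 < σ)
    (hbd : ∀ v : R3, v ⬝ᵥ (P *ᵥ v) ≤ σ * (v ⬝ᵥ v)) (e : R3) :
    e ⬝ᵥ e ≤ σ * (e ⬝ᵥ (P⁻¹ *ᵥ e)) := by
  have hdet := (Matrix.isUnit_iff_isUnit_det _).1 (isUnit_of_quadForm_pos hpos)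
  set g := P⁻¹ *ᵥ e with hg
  have heg : P *ᵥ g = e := by
    rw [hg, Matrix.mulVec_mulVec, Matrix.mul_nonsing_inv _ hdet, Matrix.one_mulVec]
  have h1 : 0 ≤ (e - σ • g) ⬝ᵥ (P *ᵥ (e - σ • g)) := by
    by_cases h : e - σ • g = 0
    · rw [h, zero_dotProduct]
    · exact (hpos _ h).le
  have h2 : g ⬝ᵥ (P *ᵥ e) = e ⬝ᵥ e := by rw [dot_mulVec_comm hsymm, heg]
  have h3 := hbd e
  simp only [Matrix.mulVec_sub, Matrix.mulVec_smul, heg, dotProduct_sub, sub_dotProduct,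
    smul_dotProduct, dotProduct_smul, smul_eq_mul, h2, dotProduct_comm g e] at h1
  have h4 : σ * (e ⬝ᵥ e) ≤ σ * (σ * (e ⬝ᵥ g)) := by linarith
  exact le_of_mul_le_mul_left h4 hσ

theorem inv_quadForm_nonneg {P : Mat3} (hpos : ∀ v ≠ 0, 0 < v ⬝ᵥ (P *ᵥ v)) (e : R3) :
    0 ≤ e ⬝ᵥ (P⁻¹ *ᵥ e) := by
  have hdet := (Matrix.isUnit_iff_isUnit_det _).1 (isUnit_of_quadForm_pos hpos)
  set g := P⁻¹ *ᵥ e with hg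
  have heg : P *ᵥ g = e := by
    rw [hg, Matrix.mulVec_mulVec, Matrix.mul_nonsing_inv _ hdet, Matrix.one_mulVec]
  rw [← heg, dotProduct_comm]
  by_cases h : g = 0
  · rw [h, zero_dotProduct]
  · exact (hpos _ h).le

end PointError

section BearingError

variable {k : ℝ} {ω x z : ℝ → R3} {J : Set ℝ}

/-- For a bearing landmark `x ⬝ᵥ z` is constant while `z ⬝ᵥ Π z` decays at the rate `2 k`. -/
theorem bearing_invariants (hJ : Convex ℝ J) (h0 : (0 : ℝ) ∈ J)
    (hx0 : ∀ t ∈ J, x t ≠ 0) (hx : ∀ t ∈ J, HasDerivWithinAt x (-(skew (ω t) *ᵥ x t)) J t)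
    (hz : ∀ t ∈ J, HasDerivWithinAt z
      (-(skew (ω t) *ᵥ z t) - k • (proj (x t) *ᵥ z t)) J t) :
    ∀ t ∈ J, x t ⬝ᵥ x t = x 0 ⬝ᵥ x 0 ∧ x t ⬝ᵥ z t = x 0 ⬝ᵥ z 0 ∧
      z t ⬝ᵥ (proj (x t) *ᵥ z t) = Real.exp (-(2 * k) * t) * (z 0 ⬝ᵥ (proj (x 0) *ᵥ z 0)) := by
  intro t ht
  have hsk : ∀ (w v : R3), v ⬝ᵥ (skew w *ᵥ v) = 0 := fun w v => by
    have := dot_skew_mulVec w v v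
    rw [dotProduct_comm (skew w *ᵥ v)] at this
    linarith
  have h1 : ∀ s ∈ J, x s ⬝ᵥ x s = x 0 ⬝ᵥ x 0 := fun s hs =>
    eq_of_hasDerivWithinAt_zero hJ (f := fun s => x s ⬝ᵥ x s)
      (fun s hs => hasDerivWithinAt_dotProduct (hx s hs) (hx s hs)) (fun s hs => by
        rw [neg_dotProduct, dotProduct_neg, dotProduct_comm (skew _ *ᵥ _), hsk]; simp) hs h0
  have h2 : ∀ s ∈ J, x s ⬝ᵥ z s = x 0 ⬝ᵥ z 0 := fun s hs =>
    eq_of_hasDerivWithinAt_zero hJ (f := fun s => x s ⬝ᵥ z s)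
      (fun s hs => hasDerivWithinAt_dotProduct (hx s hs) (hz s hs)) (fun s hs => by
        rw [neg_dotProduct, dotProduct_sub, dotProduct_neg, dotProduct_smul,
          dot_proj_self (hx0 s hs), dot_skew_mulVec]; simp) hs h0
  refine ⟨h1 t ht, h2 t ht, ?_⟩
  have h3 : ∀ s ∈ J, z s ⬝ᵥ (proj (x s) *ᵥ z s) =
      z s ⬝ᵥ z s - (x 0 ⬝ᵥ x 0)⁻¹ * (x 0 ⬝ᵥ z 0) ^ 2 := fun s hs => by
    rw [dot_proj, h1 s hs, h2 s hs]
  have hexp : ∀ s ∈ J, HasDerivWithinAt (fun s => Real.exp (2 * k * s))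
      (Real.exp (2 * k * s) * (2 * k * 1)) J s := fun s _ =>
    ((hasDerivWithinAt_id s J).const_mul (2 * k)).exp
  have h4 := eq_of_hasDerivWithinAt_zero hJ
    (f := fun s => Real.exp (2 * k * s) *
      (z s ⬝ᵥ z s - (x 0 ⬝ᵥ x 0)⁻¹ * (x 0 ⬝ᵥ z 0) ^ 2))
    (fun s hs => (hexp s hs).mul
      ((hasDerivWithinAt_dotProduct (hz s hs) (hz s hs)).sub_const _)) (fun s hs => by
        rw [← h3 s hs, dotProduct_comm _ (z s), dotProduct_sub, dotProduct_neg, hsk,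
          dotProduct_smul, smul_eq_mul]
        ring) ht h0
  simp only [mul_zero, Real.exp_zero, one_mul] at h4
  rw [h3 t ht, h3 0 h0, ← h4, ← mul_assoc, ← Real.exp_add]
  simp

/-- The scalar form of the decay of the bearing error: `n e^{-c} / (n e^{-c} + m)` is at most
`e^{-c m / (n + m)} n / (n + m)`, by convexity of the exponential. -/
theorem bearing_decay_scalar {n m c : ℝ} (hn : 0 ≤ n) (hm : 0 ≤ m) (hnm : 0 < n + m)
    (hnm' : 0 < Real.exp (-c) * n + m) :
    Real.exp (-c) * n / (Real.exp (-c) * n + m) ≤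
      Real.exp (-(m / (n + m) * c)) * (n / (n + m)) := by
  have h1 := convexOn_exp.2 (mem_univ (-c)) (mem_univ 0)
    (show 0 ≤ n / (n + m) by positivity) (show 0 ≤ m / (n + m) by positivity) (by field_simp)
  simp only [smul_eq_mul, mul_zero, add_zero, Real.exp_zero, mul_one] at h1
  have h2 : Real.exp (-c) = Real.exp (-(m / (n + m) * c)) * Real.exp (n / (n + m) * -c) := by
    rw [← Real.exp_add]
    congr 1
    field_simp
    ring
  have h3 : Real.exp (n / (n + m) * -c) * (n + m) ≤ Real.exp (-c) * n + m := by
    have := mul_le_mul_of_nonneg_right h1 hnm.le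
    refine this.trans (le_of_eq ?_)
    field_simp
  rw [div_le_iff₀ hnm']
  calc Real.exp (-c) * n
      = Real.exp (-(m / (n + m) * c)) * (n / (n + m)) *
          (Real.exp (n / (n + m) * -c) * (n + m)) := by
        rw [h2]; field_simp
    _ ≤ _ := mul_le_mul_of_nonneg_left h3 (by positivity)

end BearingError

/-! ### The true trajectory in body coordinates -/

section

variable {np nb : ℕ}

theorem hasDeriv_rot_trans {P : ℝ → SE3} {W : Twist} {J : Set ℝ} {t : ℝ}
    (h : HasMatDeriv (fun s => poseMat (P s)) (poseMat (P t) * twistMat W) J t) :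
    HasMatDeriv (fun s => rot (P s)) (rot (P t) * skew W.1) J t ∧
      HasDerivWithinAt (fun s => trans (P s)) (rot (P t) *ᵥ W.2) J t := by
  have hP := (rot_mem_and_poseMat (P t)).2
  have hm : poseMat (P t) * twistMat W = Matrix.fromBlocks (rot (P t) * skew W.1)
      (rot (P t) * Matrix.replicateCol Unit W.2) 0 0 := by
    rw [hP, rigidMat, twistMat, Matrix.fromBlocks_multiply]
    congr 1 <;> simp
  rw [hm] at h
  refine ⟨fun a b => h (Sum.inl a) (Sum.inl b), hasDerivWithinAt_pi.2 fun a => ?_⟩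
  exact h (Sum.inl a) (Sum.inr ())

/-- The true landmarks in normalized body coordinates `x i t`, and the constant normalized
coordinates `h i` of the landmarks in the inertial frame. -/
structure TrueBody (U : ℝ → Twist) (ξ : ℝ → TotalSpace np nb) (x : Idx np nb → ℝ → R3)
    (h : Idx np nb → R3) : Prop where
  target : ∀ i, IsRep ((ξ 0).2 i) (h i) (rcoef i)
  rep : ∀ i, ∀ t ∈ Ici (0 : ℝ), IsRep (body (ξ t) i) (x i t) (rcoef i)
  ne_zero : ∀ i, ∀ t ∈ Ici (0 : ℝ), x i t ≠ 0
  inertial : ∀ i, ∀ t ∈ Ici (0 : ℝ), rot (ξ t).1 *ᵥ x i t + rcoef i • trans (ξ t).1 = h i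
  deriv : ∀ i, ∀ t ∈ Ici (0 : ℝ), HasDerivWithinAt (x i)
    (-(skew (U t).1 *ᵥ x i t) - rcoef i • (U t).2) (Ici 0) t

theorem exists_trueBody {U : ℝ → Twist} {ξ : ℝ → TotalSpace np nb} (hξ : IsTrajectory U ξ)
    (hred : ∀ t ∈ Ici (0 : ℝ), ξ t ∈ reducedTotalSpace np nb) :
    ∃ x h, TrueBody U ξ x h := by
  choose z hz hrep using fun i => exists_isRep_of_mem (hred 0 (mem_Ici.2 le_rfl)) i
  set h : Idx np nb → R3 := fun i => rot (ξ 0).1 *ᵥ z i + rcoef i • trans (ξ 0).1 with hh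
  have htar : ∀ i, IsRep ((ξ 0).2 i) (h i) (rcoef i) := fun i => by
    have := (hrep i).pose_smul (ξ 0).1
    rwa [body, smul_inv_smul] at this
  have hr : ∀ i, ∀ t ∈ Ici (0 : ℝ), IsRep (body (ξ t) i)
      ((rot (ξ t).1)ᵀ *ᵥ (h i - rcoef i • trans (ξ t).1)) (rcoef i) := fun i t ht => by
    rw [body, hξ.2 t ht]
    exact (htar i).pose_inv_smul (ξ t).1
  refine ⟨fun i t => (rot (ξ t).1)ᵀ *ᵥ (h i - rcoef i • trans (ξ t).1), h, htar, hr, ?_, ?_, ?_⟩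
  · intro i t ht h0
    obtain ⟨z', hz', hrep'⟩ := exists_isRep_of_mem (hred t ht) i
    obtain ⟨c, hc, h1, -⟩ := (hr i t ht).unique hrep'
    rw [h0, smul_zero] at h1
    exact hz' h1
  · intro i t ht
    rw [rot_mulVec_transpose, sub_add_cancel]
  · intro i t ht
    obtain ⟨h1, h2⟩ := hasDeriv_rot_trans (hξ.1 t ht)
    have h3 := h1.transpose.mulVec
      ((hasDerivWithinAt_const t (Ici 0) (h i)).sub (h2.const_smul (rcoef i)))
    refine h3.congr_deriv ?_
    rw [Matrix.transpose_mul, skew_transpose, ← Matrix.mulVec_mulVec, Matrix.neg_mulVec,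
      zero_sub, Matrix.mulVec_neg, Matrix.mulVec_smul, transpose_mulVec_rot, ← sub_eq_add_neg]
    rfl

/-- The properties of the solutions of the Riccati equations that the observer relies on. The upper
bound `σ` is uniform in time and common to all point landmarks. -/
structure RiccatiData (kG kH σ : ℝ) (U : ℝ → Twist) (x : Idx np nb → ℝ → R3)
    (S : Fin np → ℝ → Mat3) : Prop where
  along : ∀ i, RiccatiAlong kG kH (fun t => (U t).1) (x (Sum.inl i)) (S i)
  symm : ∀ i, ∀ t ∈ Ici (0 : ℝ), (S i t)ᵀ = S i t
  pos : ∀ i, ∀ t ∈ Ici (0 : ℝ), ∀ v ≠ 0, 0 < v ⬝ᵥ (S i t *ᵥ v)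
  bound : ∀ i, ∀ t ∈ Ici (0 : ℝ), ∀ v : R3, v ⬝ᵥ (S i t *ᵥ v) ≤ σ * (v ⬝ᵥ v)

theorem TrueBody.continuousOn_proj {U : ℝ → Twist} {ξ : ℝ → TotalSpace np nb}
    {x : Idx np nb → ℝ → R3} {h : Idx np nb → R3} (hx : TrueBody U ξ x h) (i : Idx np nb) :
    ContinuousOn (fun t => proj (x i t)) (Ici 0) := by
  have hc : ContinuousOn (x i) (Ici 0) := fun t ht => (hx.deriv i t ht).continuousWithinAt
  have hd : ContinuousOn (fun t => (x i t ⬝ᵥ x i t)⁻¹) (Ici 0) := fun t ht =>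
    ((hasDerivWithinAt_dotProduct (hx.deriv i t ht) (hx.deriv i t ht)).continuousWithinAt).inv₀
      (dot_self_pos (hx.ne_zero i t ht)).ne'
  have hv : Continuous fun y : R3 => Matrix.vecMulVec y y :=
    continuous_id.matrix_vecMulVec continuous_id
  exact continuousOn_const.sub (hd.smul (hv.comp_continuousOn hc))

theorem exists_riccatiData {U : ℝ → Twist} (hU : ContinuousOn U (Ici 0))
    {ξ : ℝ → TotalSpace np nb} (hξ : IsTrajectory U ξ) {x : Idx np nb → ℝ → R3}
    {h : Idx np nb → R3} (hx : TrueBody U ξ x h) {kG kH : ℝ} (hkG : 0 < kG) (hkH : 0 < kH)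
    {S : Fin np → ℝ → Mat3} (hS₀ : ∀ i, (S i 0).PosDef) (hS : SolvesRiccati kG kH U ξ S)
    (hPE : ∃ δ > 0, ∃ μ > 0, PersistentlyExciting ξ δ μ) :
    ∃ σ > 0, RiccatiData kG kH σ U x S := by
  obtain ⟨δ, hδ, μ, hμ, hPE⟩ := hPE
  have hω : ContinuousOn (fun t => (U t).1) (Ici 0) := continuous_fst.comp_continuousOn hU
  have halong : ∀ i, RiccatiAlong kG kH (fun t => (U t).1) (x (Sum.inl i)) (S i) := by
    intro i t ht
    refine (hS i t ht).congr_deriv ?_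
    simp only [output, (hx.rep (Sum.inl i) t ht).proj_camera (hx.ne_zero _ t ht)]
    rw [Matrix.mul_smul, Matrix.mul_one, Matrix.smul_mul, Matrix.mul_assoc (S i t),
      proj_mul_proj (hx.ne_zero _ t ht), Matrix.smul_mul]
  have hub : ∀ i, ∃ σ > 0, ∀ t ∈ Ici (0 : ℝ), ∀ v : R3,
      v ⬝ᵥ (S i t *ᵥ v) ≤ σ * (v ⬝ᵥ v) := by
    intro i
    refine (halong i).exists_upper_bound hω (hx.continuousOn_proj _) (hx.ne_zero _) hkG hkH
      (hS₀ i) (R := fun t => rot (ξ t).1) (fun t ht => (hasDeriv_rot_trans (hξ.1 t ht)).1)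
      (fun t => so3_transpose_mul (rot_mem_and_poseMat _).1) hδ hμ (fun t ht v => ?_)
    have h1 := (hPE t ht i).dotProduct_mulVec_nonneg v
    rw [star_trivial] at h1
    have h2 : (Matrix.of fun a b : Fin 3 => ∫ s in t..(t + δ),
          proj (rot (ξ s).1 *ᵥ (output (ξ s) (Sum.inl i)).rep) a b) =
        Matrix.of fun a b : Fin 3 => ∫ s in t..(t + δ),
          proj (rot (ξ s).1 *ᵥ x (Sum.inl i) s) a b := by
      ext a b
      simp only [Matrix.of_apply]
      refine intervalIntegral.integral_congr fun s hs => ?_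
      rw [uIcc_of_le (by linarith)] at hs
      have hs0 : s ∈ Ici (0 : ℝ) := mem_Ici.2 (by linarith [hs.1])
      obtain ⟨c, hc, hrep⟩ := (hx.rep (Sum.inl i) s hs0).camera_rep (hx.ne_zero _ s hs0)
      simp only [output, hrep, Matrix.mulVec_smul, proj_smul hc]
    rw [h2, Matrix.sub_mulVec, Matrix.smul_mulVec, Matrix.smul_mulVec, Matrix.one_mulVec,
      dotProduct_sub, dotProduct_smul, dotProduct_smul, smul_eq_mul, smul_eq_mul, sub_nonneg,
      one_div, inv_mul_eq_div, le_div_iff₀ hδ] at h1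
    linarith
  choose σ hσ hbd using hub
  have hle : ∀ i, σ i ≤ (∑ i, σ i) + 1 := fun i => by
    have := Finset.single_le_sum (f := σ) (fun j _ => (hσ j).le) (Finset.mem_univ i)
    linarith
  refine ⟨(∑ i, σ i) + 1, ?_, halong, fun i => ?_, fun i => ?_, fun i t ht v => ?_⟩
  · have := Finset.sum_nonneg (s := Finset.univ) (f := σ) fun j _ => (hσ j).le
    linarith
  · exact (halong i).symm hω (hx.continuousOn_proj _) (hS₀ i).isHermitian.eq_transpose
  · exact (halong i).pos hω (hx.continuousOn_proj _) hkH (hS₀ i)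
  · exact (hbd i t ht v).trans (mul_le_mul_of_nonneg_right (hle i) (dot_self_nonneg v))

/-! ### The estimated landmarks solve linear equations -/

/-- The choice of the velocity lift and of the innovation: the corresponding vector field of
`SOT(3)` moves `z` linearly. -/
theorem lift_add_innovation_apply {z : R3} (hz : z ≠ 0) (Ω V w : R3) (r : ℝ) :
    (-(r * (V ⬝ᵥ z) / (z ⬝ᵥ z)) + -((z ⬝ᵥ z)⁻¹ * (z ⬝ᵥ w))) • z -
      skew (Ω - (r / (z ⬝ᵥ z)) • crossProduct V z + (z ⬝ᵥ z)⁻¹ • crossProduct z w) *ᵥ z =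
      -(skew Ω *ᵥ z) - r • V - w := by
  have h1 := (dot_self_pos hz).ne'
  have h2 : ∀ u : R3, (z ⬝ᵥ z)⁻¹ • (z ⬝ᵥ z) • u = u := fun u => by
    rw [smul_smul, inv_mul_cancel₀ h1, one_smul]
  have h2' : ∀ u : R3, (r * (z ⬝ᵥ z)⁻¹) • (z ⬝ᵥ z) • u = r • u := fun u => by
    rw [mul_smul, h2]
  rw [skew_mulVec, skew_mulVec, map_add, map_sub, LinearMap.add_apply, LinearMap.sub_apply,
    map_smul, map_smul, LinearMap.smul_apply, LinearMap.smul_apply, cross_cross_eq_smul_sub_smul,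
    cross_cross_eq_smul_sub_smul, smul_sub, smul_sub, h2, div_eq_mul_inv, div_eq_mul_inv,
    h2', add_smul, neg_smul, neg_smul, dotProduct_comm w z]
  simp only [smul_smul]
  have h3 : r * (V ⬝ᵥ z) * (z ⬝ᵥ z)⁻¹ = r * (z ⬝ᵥ z)⁻¹ * (V ⬝ᵥ z) := by ring
  rw [h3]
  abel

theorem sotMat_add (ω ω' : R3) (s s' : ℝ) :
    sotMat ω s + sotMat ω' s' = sotMat (ω + ω') (s + s') := by
  rw [sotMat, sotMat, sotMat, Matrix.fromBlocks_add, ← add_smul]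
  congr 1
  · ext a b
    fin_cases a <;> fin_cases b <;> simp [skew] <;> ring
  · simp
  · simp

theorem exists_scaledMat_eq (Q : SOT3) :
    (sotGroupMat Q).toBlocks₁₁ ∈ Matrix.specialOrthogonalGroup (Fin 3) ℝ ∧
      sotGroupMat Q (Sum.inr ()) (Sum.inr ()) ≠ 0 ∧
      sotGroupMat Q =
        scaledMat (sotGroupMat Q).toBlocks₁₁ (sotGroupMat Q (Sum.inr ()) (Sum.inr ())) := by
  obtain ⟨R, hR, a, ha, h⟩ := Q.2
  have h' : sotGroupMat Q = scaledMat R a := h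
  have h1 : (sotGroupMat Q).toBlocks₁₁ = R := by
    rw [h', scaledMat, Matrix.toBlocks_fromBlocks₁₁]
  have h2 : sotGroupMat Q (Sum.inr ()) (Sum.inr ()) = a := by
    simp [h', scaledMat]
  rw [h1, h2]
  exact ⟨hR, ha, h'⟩

section Run

variable {k kG kH σ : ℝ} {U : ℝ → Twist} {ξ : ℝ → TotalSpace np nb} {S : Fin np → ℝ → Mat3}
  {x : Idx np nb → ℝ → R3} {h : Idx np nb → R3} {ξ₀ : TotalSpace np nb} {J : Set ℝ}
  {X : ℝ → VSLAMGroup np nb} {Δ : ℝ → Twist}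

/-- Along any run the estimate of a landmark, in suitably normalized body coordinates, solves a
linear differential equation. -/
theorem IsObserverRun.exists_linear (hrun : IsObserverRun k kG U ξ S ξ₀ J X Δ)
    (hx : TrueBody U ξ x h) (hJ0 : J ⊆ Ici 0) (i : Idx np nb) {z₀ : R3} (hz₀ : z₀ ≠ 0)
    (hrep : IsRep (body ξ₀ i) z₀ (rcoef i)) :
    ∃ z : ℝ → R3, z 0 = z₀ ∧ ∀ t ∈ J, z t ≠ 0 ∧
      IsRep (body (upsilon (X t) ξ₀) i) (z t) (rcoef i) ∧
      HasDerivWithinAt z (-(skew (U t).1 *ᵥ z t) - rcoef i • (U t).2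
        - corrMat k kG S t i (x i t) *ᵥ z t) J t := by
  set R : ℝ → Mat3 := fun t => (sotGroupMat ((X t).2 i)).toBlocks₁₁ with hR
  set a : ℝ → ℝ := fun t => sotGroupMat ((X t).2 i) (Sum.inr ()) (Sum.inr ()) with ha
  have hQ := fun t => exists_scaledMat_eq ((X t).2 i)
  have hz : ∀ t, a t • ((R t)ᵀ *ᵥ z₀) ≠ 0 := fun t => by
    refine smul_ne_zero (hQ t).2.1 fun h0 => hz₀ ?_
    have := congrArg (fun v => R t *ᵥ v) h0
    simpa [Matrix.mulVec_mulVec, hR, so3_mul_transpose (hQ t).1] using this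
  have hrepz : ∀ t, IsRep (body (upsilon (X t) ξ₀) i) (a t • ((R t)ᵀ *ᵥ z₀)) (rcoef i) :=
    fun t => by
      rw [body_upsilon]
      exact hrep.sot_inv_smul _ (hQ t).1 (hQ t).2.1 (hQ t).2.2
  refine ⟨fun t => a t • ((R t)ᵀ *ᵥ z₀), ?_, fun t ht => ⟨hz t, hrepz t, ?_⟩⟩
  · have h1 : sotGroupMat ((X 0).2 i) = 1 := by rw [hrun.init]; rfl
    have h2 : R 0 = 1 := by
      simp only [hR, h1]
      ext b c
      simp [Matrix.toBlocks₁₁, Matrix.one_apply]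
    have h3 : a 0 = 1 := by simp only [ha, h1, Matrix.one_apply_eq]
    simp [h2, h3]
  · have h1 := hrun.landmark i t ht
    set z := a t • ((R t)ᵀ *ᵥ z₀) with hzdef
    rw [(hrepz t).lift_eq, innovation_eq (hx.ne_zero i t (hJ0 ht)) (hz t)
      (hx.rep i t (hJ0 ht)) (hrepz t), sotMat_add] at h1
    set w := corrMat k kG S t i (x i t) *ᵥ z
    set ω := (U t).1 - (rcoef i / (z ⬝ᵥ z)) • crossProduct (U t).2 z
      + (z ⬝ᵥ z)⁻¹ • crossProduct z w with hω
    set s := -(rcoef i * ((U t).2 ⬝ᵥ z) / (z ⬝ᵥ z)) + -((z ⬝ᵥ z)⁻¹ * (z ⬝ᵥ w)) with hs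
    have hm : sotGroupMat ((X t).2 i) * sotMat ω s =
        Matrix.fromBlocks (R t * skew ω) 0 0 ((a t * s) • (1 : Matrix Unit Unit ℝ)) := by
      rw [(hQ t).2.2, scaledMat, sotMat, Matrix.fromBlocks_multiply]
      simp [smul_smul, hR, ha, mul_comm]
    rw [hm] at h1
    have hRd : HasMatDeriv R (R t * skew ω) J t := fun b c => h1 (Sum.inl b) (Sum.inl c)
    have had : HasDerivWithinAt a (a t * s) J t := by
      have := h1 (Sum.inr ()) (Sum.inr ())
      simpa using this
    have h2 := had.smul (hRd.transpose.mulVec (hasDerivWithinAt_const t J z₀))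
    refine h2.congr_deriv ?_
    rw [← lift_add_innovation_apply (hz t) (U t).1 (U t).2 w (rcoef i), ← hω, ← hs,
      Matrix.mulVec_zero, add_zero, Matrix.transpose_mul, skew_transpose, ← Matrix.mulVec_mulVec,
      Matrix.neg_mulVec, smul_neg, ← Matrix.mulVec_smul, ← hzdef, hzdef, smul_smul, mul_comm s]
    abel

theorem corrMat_inl (i : Fin np) (t : ℝ) {y : R3} (hy : y ≠ 0) (v : R3) :
    corrMat (nb := nb) k kG S t (Sum.inl i) y *ᵥ v = (k * kG) • (S i t *ᵥ (proj y *ᵥ v)) := by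
  simp only [corrMat, sigma, gainG, Sum.elim_inl]
  rw [Matrix.mul_smul, Matrix.mul_one, smul_smul, Matrix.smul_mul, Matrix.mul_assoc,
    proj_mul_proj hy, Matrix.smul_mulVec, ← Matrix.mulVec_mulVec]

theorem corrMat_inr (j : Fin nb) (t : ℝ) {y : R3} (hy : y ≠ 0) (v : R3) :
    corrMat k kG S t (Sum.inr j) y *ᵥ v = k • (proj y *ᵥ v) := by
  simp only [corrMat, sigma, gainG, Sum.elim_inr]
  rw [Matrix.mul_one, Matrix.one_mul, Matrix.smul_mul, proj_mul_proj hy, Matrix.smul_mulVec]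

theorem IsObserverRun.pointError_le (hrun : IsObserverRun k kG U ξ S ξ₀ J X Δ)
    (hx : TrueBody U ξ x h) (hS : RiccatiData kG kH σ U x S) (hk : 1 / 2 < k)
    (hkG : 0 < kG) (hkH : 0 < kH) (hσ : 0 < σ)
    (hJ : Convex ℝ J) (hJ0 : J ⊆ Ici 0) (h0 : (0 : ℝ) ∈ J) (hξ₀ : ξ₀ ∈ reducedTotalSpace np nb)
    (i : Fin np) : ∀ t ∈ J,
      pointError (upsilon (X t) ξ₀) (ξ t) i ⬝ᵥ
        ((S i t)⁻¹ *ᵥ pointError (upsilon (X t) ξ₀) (ξ t) i) ≤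
      Real.exp (-(kH / σ) * t) * (pointError ξ₀ (ξ 0) i ⬝ᵥ
        ((S i 0)⁻¹ *ᵥ pointError ξ₀ (ξ 0) i)) := by
  obtain ⟨z₀, hz₀, hrep⟩ := exists_isRep_of_mem hξ₀ (Sum.inl i)
  obtain ⟨z, hz0, hz⟩ := hrun.exists_linear hx hJ0 (Sum.inl i) hz₀ hrep
  have he : ∀ t ∈ J, HasDerivWithinAt (fun t => z t - x (Sum.inl i) t)
      (-(skew (U t).1 *ᵥ (z t - x (Sum.inl i) t)) -
        (k * kG) • (S i t *ᵥ (proj (x (Sum.inl i) t) *ᵥ (z t - x (Sum.inl i) t)))) J t := by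
    intro t ht
    refine ((hz t ht).2.2.sub ((hx.deriv (Sum.inl i) t (hJ0 ht)).mono hJ0)).congr_deriv ?_
    have hne := hx.ne_zero (Sum.inl i) t (hJ0 ht)
    rw [corrMat_inl i t hne, Matrix.mulVec_sub, Matrix.mulVec_sub, proj_mulVec_self hne, sub_zero]
    abel
  have hmain := (hS.along i).pointError_decay (hx.ne_zero _) (hS.symm i) (hS.pos i) hkG hkH hk hσ
    (hS.bound i) hJ hJ0 h0 he
  have hpe : ∀ t ∈ J, pointError (upsilon (X t) ξ₀) (ξ t) i = z t - x (Sum.inl i) t :=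
    fun t ht => pointError_eq (hx.rep _ t (hJ0 ht)) (hz t ht).2.1
  have hpe0 : pointError ξ₀ (ξ 0) i = z 0 - x (Sum.inl i) 0 := by
    rw [hz0]
    exact pointError_eq (hx.rep _ 0 (mem_Ici.2 le_rfl)) hrep
  intro t ht
  rw [hpe t ht, hpe0]
  exact hmain t ht

/-- The bearing errors along a run: either the initial estimate is orthogonal to the true bearing
and remains so, or the error decays exponentially. -/
theorem IsObserverRun.bearingError_bounds (hrun : IsObserverRun k kG U ξ S ξ₀ J X Δ)
    (hx : TrueBody U ξ x h) (hJ : Convex ℝ J) (hJ0 : J ⊆ Ici 0) (h0 : (0 : ℝ) ∈ J)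
    (hξ₀ : ξ₀ ∈ reducedTotalSpace np nb) (j : Fin nb) : ∀ t ∈ J,
      0 ≤ bearingError (upsilon (X t) ξ₀) (ξ t) j ∧
      bearingError (upsilon (X t) ξ₀) (ξ t) j ≤
        Real.exp (-((1 - bearingError ξ₀ (ξ 0) j) * (2 * k * t))) * bearingError ξ₀ (ξ 0) j ∧
      (bearingError ξ₀ (ξ 0) j = 1 → bearingError (upsilon (X t) ξ₀) (ξ t) j = 1) := by
  obtain ⟨z₀, hz₀, hrep⟩ := exists_isRep_of_mem hξ₀ (Sum.inr j)
  obtain ⟨z, hz0, hz⟩ := hrun.exists_linear hx hJ0 (Sum.inr j) hz₀ hrep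
  have hr : rcoef (Sum.inr j : Idx np nb) = 0 := rfl
  have hinv := bearing_invariants (k := k) hJ h0 (fun t ht => hx.ne_zero (Sum.inr j) t (hJ0 ht))
    (ω := fun t => (U t).1) (x := x (Sum.inr j)) (z := z)
    (fun t ht => ((hx.deriv (Sum.inr j) t (hJ0 ht)).mono hJ0).congr_deriv (by simp [hr]))
    (fun t ht => (hz t ht).2.2.congr_deriv (by
      rw [corrMat_inr j t (hx.ne_zero _ t (hJ0 ht)), hr, zero_smul, sub_zero]))
  set n := z 0 ⬝ᵥ (proj (x (Sum.inr j) 0) *ᵥ z 0) with hn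
  set m := (x (Sum.inr j) 0 ⬝ᵥ x (Sum.inr j) 0)⁻¹ * (x (Sum.inr j) 0 ⬝ᵥ z 0) ^ 2 with hm
  have hx0 := hx.ne_zero (Sum.inr j) 0 (mem_Ici.2 le_rfl)
  have hn0 : 0 ≤ n := dot_proj_nonneg hx0 _
  have hm0 : 0 ≤ m := mul_nonneg (inv_nonneg.2 (dot_self_nonneg _)) (sq_nonneg _)
  -- `|z|² = n e^{-2kt} + m`, and the error is `n e^{-2kt} / |z|²`
  have hzz : ∀ t ∈ J, z t ⬝ᵥ z t = Real.exp (-(2 * k * t)) * n + m := by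
    intro t ht
    obtain ⟨h1, h2, h3⟩ := hinv t ht
    rw [dot_proj, h1, h2, ← hm] at h3
    rw [← neg_mul, ← h3]
    ring
  have herr : ∀ t ∈ J, 0 < Real.exp (-(2 * k * t)) * n + m ∧
      1 - (x (Sum.inr j) t ⬝ᵥ z t) ^ 2 / ((x (Sum.inr j) t ⬝ᵥ x (Sum.inr j) t) * (z t ⬝ᵥ z t)) =
        Real.exp (-(2 * k * t)) * n / (Real.exp (-(2 * k * t)) * n + m) := by
    intro t ht
    obtain ⟨h1, h2, h3⟩ := hinv t ht
    have h4 := dot_self_pos (hz t ht).1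
    have h5 : (x (Sum.inr j) t ⬝ᵥ z t) ^ 2 /
        ((x (Sum.inr j) t ⬝ᵥ x (Sum.inr j) t) * (z t ⬝ᵥ z t)) = m / (z t ⬝ᵥ z t) := by
      rw [h1, h2, hm]
      field_simp
    rw [h5, hzz t ht]
    rw [hzz t ht] at h4
    refine ⟨h4, ?_⟩
    rw [eq_div_iff h4.ne', sub_mul, div_mul_cancel₀ _ h4.ne']
    ring
  have hbe : ∀ t ∈ J, bearingError (upsilon (X t) ξ₀) (ξ t) j =
      Real.exp (-(2 * k * t)) * n / (Real.exp (-(2 * k * t)) * n + m) := fun t ht => by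
    rw [bearingError_eq (hx.ne_zero _ t (hJ0 ht)) (hz t ht).1 (hx.rep _ t (hJ0 ht)) (hz t ht).2.1,
      (herr t ht).2]
  have hbe0 : bearingError ξ₀ (ξ 0) j = n / (n + m) := by
    have h1 := (herr 0 h0).2
    rw [mul_zero, neg_zero, Real.exp_zero, one_mul, hz0] at h1
    rw [← h1]
    exact bearingError_eq hx0 hz₀ (hx.rep _ 0 (mem_Ici.2 le_rfl)) hrep
  have hnm : 0 < n + m := by
    have := (herr 0 h0).1
    rwa [mul_zero, neg_zero, Real.exp_zero, one_mul] at this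
  intro t ht
  have hp := (herr t ht).1
  refine ⟨?_, ?_, ?_⟩
  · rw [hbe t ht]
    positivity
  · rw [hbe t ht, hbe0, show 1 - n / (n + m) = m / (n + m) by field_simp; ring]
    exact bearing_decay_scalar hn0 hm0 hnm hp
  · intro h1
    rw [hbe0, div_eq_one_iff_eq hnm.ne'] at h1
    have hm' : m = 0 := by linarith
    rw [hbe t ht, hm', add_zero]
    rw [hm', add_zero] at hp
    exact div_self hp.ne'

theorem bearingError_mem_Icc {ζ ζ' : TotalSpace np nb} (hζ : ζ ∈ reducedTotalSpace np nb)
    (hζ' : ζ' ∈ reducedTotalSpace np nb) (j : Fin nb) :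
    bearingError ζ ζ' j ∈ Icc (0 : ℝ) 1 := by
  obtain ⟨z, hz, hrz⟩ := exists_isRep_of_mem hζ (Sum.inr j)
  obtain ⟨y, hy, hry⟩ := exists_isRep_of_mem hζ' (Sum.inr j)
  rw [bearingError_eq hy hz hry hrz]
  have h1 := dot_self_pos hy
  have h2 := dot_self_pos hz
  have h3 := dot_proj_nonneg hy z
  rw [dot_proj] at h3
  have h4 : (y ⬝ᵥ z) ^ 2 / ((y ⬝ᵥ y) * (z ⬝ᵥ z)) ≤ 1 := by
    rw [div_le_one (by positivity)]
    have h5 : (y ⬝ᵥ y)⁻¹ * (y ⬝ᵥ z) ^ 2 ≤ z ⬝ᵥ z := by linarith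
    rwa [inv_mul_le_iff₀ h1] at h5
  have h5 : 0 ≤ (y ⬝ᵥ z) ^ 2 / ((y ⬝ᵥ y) * (z ⬝ᵥ z)) := by positivity
  exact ⟨by linarith, by linarith⟩

end Run

end

/-! ### Stability and uniform error bounds -/

section

variable {np nb : ℕ} {k kG kH σ : ℝ} {U : ℝ → Twist} {ξ : ℝ → TotalSpace np nb}
  {S : Fin np → ℝ → Mat3} {x : Idx np nb → ℝ → R3} {h : Idx np nb → R3}

/-- The constant absorbs the bounds of `Σ(t)` and of `Σ(0)⁻¹`; it depends neither on the run nor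
on its interval of existence. -/
theorem exists_pointErrorSq_bound (hx : TrueBody U ξ x h) (hS : RiccatiData kG kH σ U x S)
    (hk : 1 / 2 < k) (hkG : 0 < kG) (hkH : 0 < kH) (hσ : 0 < σ) :
    ∃ M : ℝ, 1 ≤ M ∧ ∀ {J : Set ℝ}, Convex ℝ J → J ⊆ Ici 0 → (0 : ℝ) ∈ J →
      ∀ ξ₀ ∈ reducedTotalSpace np nb, ∀ X Δ, IsObserverRun k kG U ξ S ξ₀ J X Δ →
      ∀ t ∈ J, ∀ i, pointError (upsilon (X t) ξ₀) (ξ t) i ⬝ᵥ pointError (upsilon (X t) ξ₀) (ξ t) i ≤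
        M * (Real.exp (-(kH / σ) * t) * (pointError ξ₀ (ξ 0) i ⬝ᵥ pointError ξ₀ (ξ 0) i)) := by
  set C : ℝ := ∑ i, ∑ a, ∑ b, |(S i 0)⁻¹ a b|
  have hC : ∀ i, ∑ a, ∑ b, |(S i 0)⁻¹ a b| ≤ C := fun i =>
    Finset.single_le_sum (f := fun i => ∑ a, ∑ b, |(S i 0)⁻¹ a b|)
      (fun j _ => Finset.sum_nonneg fun a _ => Finset.sum_nonneg fun b _ => abs_nonneg _)
      (Finset.mem_univ i)
  refine ⟨max 1 (σ * C), le_max_left _ _, ?_⟩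
  intro J hJ hJ0 h0 ξ₀ hξ₀ X Δ hrun t ht i
  set e := pointError (upsilon (X t) ξ₀) (ξ t) i
  set e₀ := pointError ξ₀ (ξ 0) i
  have h1 : e ⬝ᵥ e ≤ σ * (e ⬝ᵥ ((S i t)⁻¹ *ᵥ e)) :=
    dot_self_le_inv_quadForm (hS.symm i t (hJ0 ht)) (hS.pos i t (hJ0 ht)) hσ
      (hS.bound i t (hJ0 ht)) e
  have h2 := hrun.pointError_le hx hS hk hkG hkH hσ hJ hJ0 h0 hξ₀ i t ht
  have h3 : e₀ ⬝ᵥ ((S i 0)⁻¹ *ᵥ e₀) ≤ C * (e₀ ⬝ᵥ e₀) :=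
    (quadForm_le _ _).trans (mul_le_mul_of_nonneg_right (hC i) (dot_self_nonneg _))
  have hexp := Real.exp_pos (-(kH / σ) * t)
  calc e ⬝ᵥ e ≤ σ * (Real.exp (-(kH / σ) * t) * (C * (e₀ ⬝ᵥ e₀))) :=
        h1.trans (mul_le_mul_of_nonneg_left
          (h2.trans (mul_le_mul_of_nonneg_left h3 hexp.le)) hσ.le)
    _ = (σ * C) * (Real.exp (-(kH / σ) * t) * (e₀ ⬝ᵥ e₀)) := by ring
    _ ≤ _ := mul_le_mul_of_nonneg_right (le_max_right _ _)
        (mul_nonneg hexp.le (dot_self_nonneg _))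

theorem stability (hx : TrueBody U ξ x h) (hS : RiccatiData kG kH σ U x S)
    (hred : ∀ t ∈ Ici (0 : ℝ), ξ t ∈ reducedTotalSpace np nb)
    (hk : 1 / 2 < k) (hkG : 0 < kG) (hkH : 0 < kH) (hσ : 0 < σ) :
    ∀ ε > 0, ∃ δ > 0, ∀ ξ₀ ∈ reducedTotalSpace np nb, errorSq ξ₀ (ξ 0) < δ →
      ∀ T ≥ 0, ∀ X Δ, IsObserverRun k kG U ξ S ξ₀ (Icc 0 T) X Δ →
        ∀ t ∈ Icc 0 T, errorSq (upsilon (X t) ξ₀) (ξ t) < ε := by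
  obtain ⟨M, hM, hbd⟩ := exists_pointErrorSq_bound hx hS hk hkG hkH hσ
  have hM0 : 0 < M := by linarith
  intro ε hε
  refine ⟨ε / M, div_pos hε hM0, fun ξ₀ hξ₀ hE T hT X Δ hrun t ht => ?_⟩
  have hJ0 : Icc 0 T ⊆ Ici (0 : ℝ) := fun s hs => hs.1
  have h0 : (0 : ℝ) ∈ Icc 0 T := ⟨le_rfl, hT⟩
  have h1 : errorSq (upsilon (X t) ξ₀) (ξ t) ≤ M * errorSq ξ₀ (ξ 0) := by
    rw [errorSq, errorSq, mul_add, Finset.mul_sum, Finset.mul_sum]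
    refine add_le_add (Finset.sum_le_sum fun i _ => ?_) (Finset.sum_le_sum fun j _ => ?_)
    · refine (hbd (convex_Icc 0 T) hJ0 h0 ξ₀ hξ₀ X Δ hrun t ht i).trans
        (mul_le_mul_of_nonneg_left ?_ hM0.le)
      refine mul_le_of_le_one_left (dot_self_nonneg _) (Real.exp_le_one_iff.2 ?_)
      rw [neg_mul]
      exact neg_nonpos.2 (mul_nonneg (by positivity) ht.1)
    · obtain ⟨h2, h3⟩ := bearingError_mem_Icc hξ₀ (hred 0 (mem_Ici.2 le_rfl)) j
      refine ((hrun.bearingError_bounds hx (convex_Icc 0 T) hJ0 h0 hξ₀ j t ht).2.1).trans ?_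
      have h4 : Real.exp (-((1 - bearingError ξ₀ (ξ 0) j) * (2 * k * t))) ≤ 1 := by
        refine Real.exp_le_one_iff.2 (neg_nonpos.2 (mul_nonneg (by linarith) ?_))
        have := ht.1
        have : 0 < k := by linarith
        positivity
      exact mul_le_mul_of_nonneg_right (h4.trans hM) h2
  rw [lt_div_iff₀ hM0] at hE
  linarith

/-- A lower bound `c` for the initial `cos²` of the bearings makes all rates of decay uniform. -/
theorem exponential_bounds (hx : TrueBody U ξ x h) (hS : RiccatiData kG kH σ U x S)
    (hred : ∀ t ∈ Ici (0 : ℝ), ξ t ∈ reducedTotalSpace np nb)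
    (hk : 1 / 2 < k) (hkG : 0 < kG) (hkH : 0 < kH) (hσ : 0 < σ)
    {K : Set (TotalSpace np nb)} (hK : K ⊆ reducedTotalSpace np nb) {c : ℝ} (hc : 0 < c)
    (hKc : ∀ ξ₀ ∈ K, ∀ j, c ≤ 1 - bearingError ξ₀ (ξ 0) j) :
    ∃ lam > 0, ∃ M > 0,
      ∀ ξ₀ ∈ K, ∀ X Δ, IsObserverRun k kG U ξ S ξ₀ (Ici 0) X Δ → ∀ t ∈ Ici (0 : ℝ),
        lyapunov S t (upsilon (X t) ξ₀) (ξ t) ≤ Real.exp (-lam * t) * lyapunov S 0 ξ₀ (ξ 0) ∧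
        errorSq (upsilon (X t) ξ₀) (ξ t) ≤ M * Real.exp (-lam * t) * errorSq ξ₀ (ξ 0) := by
  obtain ⟨M, hM, hbd⟩ := exists_pointErrorSq_bound hx hS hk hkG hkH hσ
  have hM0 : 0 < M := by linarith
  have hk0 : 0 < k := by linarith
  refine ⟨min (kH / σ) (c * (2 * k)), lt_min (by positivity) (by positivity), M, hM0, ?_⟩
  intro ξ₀ hξ₀ X Δ hrun t ht
  set lam := min (kH / σ) (c * (2 * k)) with hlam
  have ht0 : 0 ≤ t := ht
  have hmem := mem_Ici.2 (le_refl (0 : ℝ))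
  have he1 : Real.exp (-(kH / σ) * t) ≤ Real.exp (-lam * t) := by
    refine Real.exp_le_exp.2 ?_
    have := mul_le_mul_of_nonneg_right (min_le_left (kH / σ) (c * (2 * k))) ht0
    linarith
  have hb : ∀ j, bearingError (upsilon (X t) ξ₀) (ξ t) j ≤
      Real.exp (-lam * t) * bearingError ξ₀ (ξ 0) j := fun j => by
    obtain ⟨h2, h3⟩ := bearingError_mem_Icc (hK hξ₀) (hred 0 hmem) j
    refine ((hrun.bearingError_bounds hx (convex_Ici 0) subset_rfl hmem (hK hξ₀) j t ht).2.1).trans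
      (mul_le_mul_of_nonneg_right (Real.exp_le_exp.2 ?_) h2)
    have h4 := mul_le_mul_of_nonneg_right (min_le_right (kH / σ) (c * (2 * k))) ht0
    have h5 := mul_le_mul_of_nonneg_right (hKc ξ₀ hξ₀ j) (show 0 ≤ 2 * k * t by positivity)
    linarith
  constructor
  · rw [lyapunov, lyapunov, mul_add, Finset.mul_sum, Finset.mul_sum]
    refine add_le_add (Finset.sum_le_sum fun i _ => ?_) (Finset.sum_le_sum fun j _ => ?_)
    · have h2 := hrun.pointError_le hx hS hk hkG hkH hσ (convex_Ici 0) subset_rfl hmem (hK hξ₀) i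
        t ht
      have h3 := mul_le_mul_of_nonneg_right he1
        (inv_quadForm_nonneg (hS.pos i 0 hmem) (pointError ξ₀ (ξ 0) i))
      linarith
    · linarith [hb j]
  · rw [errorSq, errorSq, mul_add, Finset.mul_sum, Finset.mul_sum]
    refine add_le_add (Finset.sum_le_sum fun i _ => ?_) (Finset.sum_le_sum fun j _ => ?_)
    · refine (hbd (convex_Ici 0) subset_rfl hmem ξ₀ (hK hξ₀) X Δ hrun t ht i).trans ?_
      rw [mul_assoc]
      exact mul_le_mul_of_nonneg_left
        (mul_le_mul_of_nonneg_right he1 (dot_self_nonneg _)) hM0.le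
    · obtain ⟨h2, h3⟩ := bearingError_mem_Icc (hK hξ₀) (hred 0 hmem) j
      refine (hb j).trans (mul_le_mul_of_nonneg_right ?_ h2)
      exact le_mul_of_one_le_left (Real.exp_pos _).le hM

/-! ### Convergence in projective space and the basin of attraction -/

/-- The embedding `[v] ↦ v vᵀ / |v|²` of `RP3` into the space of matrices. -/
noncomputable def lineProj (y : RP3) : Matrix HIdx HIdx ℝ :=
  (y.rep ⬝ᵥ y.rep)⁻¹ • Matrix.vecMulVec y.rep y.rep

theorem lineProj_mk {v : R4} (hv : v ≠ 0) :
    lineProj (Projectivization.mk ℝ v hv) = (v ⬝ᵥ v)⁻¹ • Matrix.vecMulVec v v := by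
  obtain ⟨c, hc⟩ := Projectivization.exists_smul_eq_mk_rep ℝ v hv
  have hc' : (Projectivization.mk ℝ v hv).rep = (c : ℝ) • v := hc.symm
  have h1 := dot_self_pos hv
  have h2 := c.ne_zero
  rw [lineProj, hc']
  ext a b
  simp only [Matrix.smul_apply, Matrix.vecMulVec_apply, Pi.smul_apply, smul_dotProduct,
    dotProduct_smul, smul_eq_mul]
  field_simp

theorem continuous_lineProj : Continuous lineProj := by
  refine continuous_coinduced_dom.2 ?_
  have h1 : (lineProj ∘ Projectivization.mk' ℝ : {v : R4 // v ≠ 0} → Matrix HIdx HIdx ℝ) =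
      fun v : {v : R4 // v ≠ 0} => ((v : R4) ⬝ᵥ (v : R4))⁻¹ • Matrix.vecMulVec (v : R4) (v : R4) := by
    funext v
    exact lineProj_mk v.2
  rw [h1]
  have h2 : Continuous fun v : {v : R4 // v ≠ 0} => (v : R4) ⬝ᵥ (v : R4) :=
    continuous_subtype_val.dotProduct continuous_subtype_val
  exact (h2.inv₀ fun v => (dot_self_pos v.2).ne').smul
    (continuous_subtype_val.matrix_vecMulVec continuous_subtype_val)

/-- `|u|²` times the squared cosine of the angle between the vector `u` and the line `g y`. -/
theorem cosSq_lineProj {y : RP3} {z : R3} {r : ℝ} (g : GL HIdx ℝ) (hrep : IsRep (g • y) z r)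
    (u : R4) :
    u ⬝ᵥ (((g : Matrix HIdx HIdx ℝ) * lineProj y * (g : Matrix HIdx HIdx ℝ)ᵀ) *ᵥ u) /
      ((g : Matrix HIdx HIdx ℝ) * lineProj y * (g : Matrix HIdx HIdx ℝ)ᵀ).trace =
      (u ⬝ᵥ hom z r) ^ 2 / (hom z r ⬝ᵥ hom z r) ∧
    ((g : Matrix HIdx HIdx ℝ) * lineProj y * (g : Matrix HIdx HIdx ℝ)ᵀ).trace ≠ 0 := by
  set v := y.rep with hv
  have hv0 : v ≠ 0 := y.rep_nonzero
  set N := (g : Matrix HIdx HIdx ℝ) with hN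
  set w := N *ᵥ v with hw
  have hrep' : IsRep (g • y) (head w) (last w) :=
    (IsRep.of_rep y).gl_smul g (by rw [hom_head_last, hom_head_last])
  obtain ⟨c, hc, h1, h2⟩ := hrep.unique hrep'
  have hwz : w = c • hom z r := by rw [smul_hom, ← h1, ← h2, hom_head_last]
  have hE : N * lineProj y * Nᵀ = (v ⬝ᵥ v)⁻¹ • Matrix.vecMulVec w w := by
    rw [lineProj, Matrix.mul_smul, Matrix.smul_mul, Matrix.mul_vecMulVec, Matrix.vecMulVec_mul,
      ← Matrix.mulVec_transpose, Matrix.transpose_transpose]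
  have hzpos := dot_self_pos hrep.ne_zero
  have hvpos := dot_self_pos hv0
  have htr : (N * lineProj y * Nᵀ).trace = (v ⬝ᵥ v)⁻¹ * (c ^ 2 * (hom z r ⬝ᵥ hom z r)) := by
    rw [hE, Matrix.trace_smul, Matrix.trace_vecMulVec, hwz, smul_dotProduct, dotProduct_smul,
      smul_eq_mul, smul_eq_mul, smul_eq_mul]
    ring
  have hq : u ⬝ᵥ ((N * lineProj y * Nᵀ) *ᵥ u) = (v ⬝ᵥ v)⁻¹ * (c ^ 2 * (u ⬝ᵥ hom z r) ^ 2) := by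
    rw [hE, Matrix.smul_mulVec, Matrix.vecMulVec_mulVec, dotProduct_smul, op_smul_eq_smul,
      dotProduct_smul, hwz, dotProduct_smul, smul_dotProduct, dotProduct_comm (hom z r) u]
    simp only [smul_eq_mul]
    ring
  rw [hq, htr]
  refine ⟨by field_simp, by positivity⟩

theorem tendsto_of_isRep {y : ℝ → RP3} {z : ℝ → R3} {r : ℝ} {y' : RP3} {z' : R3}
    (hy : ∀ t ∈ Ici (0 : ℝ), IsRep (y t) (z t) r) (hy' : IsRep y' z' r)
    (hz : Tendsto z atTop (𝓝 z')) : Tendsto y atTop (𝓝 y') := by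
  classical
  let g : ℝ → {v : R4 // v ≠ 0} := fun t =>
    if ht : t ∈ Ici (0 : ℝ) then ⟨hom (z t) r, (hy t ht).ne_zero⟩ else ⟨hom z' r, hy'.ne_zero⟩
  have hgt : ∀ t (ht : t ∈ Ici (0 : ℝ)), g t = ⟨hom (z t) r, (hy t ht).ne_zero⟩ :=
    fun t ht => dif_pos ht
  have hhom : Continuous fun q : R3 => hom q r := by
    refine continuous_pi fun a => ?_
    rcases a with a | a
    · exact continuous_apply a
    · exact continuous_const
  have h1 : Tendsto g atTop (𝓝 ⟨hom z' r, hy'.ne_zero⟩) := by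
    rw [tendsto_subtype_rng]
    refine ((hhom.tendsto z').comp hz).congr' ?_
    filter_upwards [Ici_mem_atTop (0 : ℝ)] with t ht
    rw [hgt t ht]
    rfl
  have h2 : Continuous (Projectivization.mk' ℝ : {v : R4 // v ≠ 0} → RP3) :=
    continuous_coinduced_rng
  have h3 := (h2.tendsto ⟨hom z' r, hy'.ne_zero⟩).comp h1
  have h4 : Projectivization.mk' ℝ ⟨hom z' r, hy'.ne_zero⟩ = y' := hy'.2
  rw [h4] at h3
  refine h3.congr' ?_
  filter_upwards [Ici_mem_atTop (0 : ℝ)] with t ht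
  rw [Function.comp_apply, hgt t ht]
  exact (hy t ht).2

theorem tendsto_zero_of_dot_self {v : ℝ → R3}
    (hv : Tendsto (fun t => v t ⬝ᵥ v t) atTop (𝓝 0)) : Tendsto v atTop (𝓝 0) := by
  rw [tendsto_pi_nhds]
  intro a
  have h1 : Tendsto (fun t => Real.sqrt (v t ⬝ᵥ v t)) atTop (𝓝 0) := by
    have := (Real.continuous_sqrt.tendsto 0).comp hv
    rwa [Real.sqrt_zero] at this
  refine squeeze_zero_norm (fun t => ?_) h1
  rw [Real.norm_eq_abs]
  refine Real.abs_le_sqrt ?_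
  rw [sq]
  exact Finset.single_le_sum (f := fun a => v t a * v t a) (fun i _ => mul_self_nonneg _)
    (Finset.mem_univ a)

theorem rot_dot_rot (P : SE3) (v w : R3) : (rot P *ᵥ v) ⬝ᵥ (rot P *ᵥ w) = v ⬝ᵥ w := by
  rw [Matrix.dotProduct_mulVec, ← Matrix.mulVec_transpose, transpose_mulVec_rot]

/-- After the change of frame that aligns the poses, the errors measure the distances and angles
between the landmarks in the inertial frame. -/
theorem convergesUpToEquiv_of_errors (hx : TrueBody U ξ x h) {ξhat : ℝ → TotalSpace np nb}
    (hhat : ∀ t ∈ Ici (0 : ℝ), ξhat t ∈ reducedTotalSpace np nb)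
    (hp : ∀ i, Tendsto (fun t => pointError (ξhat t) (ξ t) i ⬝ᵥ pointError (ξhat t) (ξ t) i)
      atTop (𝓝 0))
    (hb : ∀ j, Tendsto (fun t => bearingError (ξhat t) (ξ t) j) atTop (𝓝 0))
    (hb1 : ∀ j, ∀ t ∈ Ici (0 : ℝ), bearingError (ξhat t) (ξ t) j < 1) :
    ConvergesUpToEquiv ξhat ξ := by
  refine ⟨fun t => ((ξ t).1, fun i => (ξ t).1 • body (ξhat t) i), fun t _ => ⟨?_, rfl⟩, ?_⟩
  · refine Quotient.sound (?_ : _ ∈ MulAction.orbit SE3 (ξhat t))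
    refine ⟨(ξ t).1 * (ξhat t).1⁻¹, Prod.ext ?_ (funext fun i => ?_)⟩
    · change (ξ t).1 * (ξhat t).1⁻¹ * (ξhat t).1 = (ξ t).1
      rw [inv_mul_cancel_right]
    · change ((ξ t).1 * (ξhat t).1⁻¹) • (ξhat t).2 i = (ξ t).1 • ((ξhat t).1⁻¹ • (ξhat t).2 i)
      rw [mul_smul]
  · have hrep : ∀ i t, ∃ z, t ∈ Ici (0 : ℝ) → z ≠ 0 ∧ IsRep (body (ξhat t) i) z (rcoef i) := by
      intro i t
      by_cases ht : t ∈ Ici (0 : ℝ)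
      · obtain ⟨z, hz⟩ := exists_isRep_of_mem (hhat t ht) i
        exact ⟨z, fun _ => hz⟩
      · exact ⟨0, fun h => absurd h ht⟩
    choose z hz using hrep
    rintro (i | j)
    · -- the point `[p̂; 1]` is moved to `h + R e`
      refine tendsto_of_isRep (r := 1)
        (z := fun t => rot (ξ t).1 *ᵥ z (Sum.inl i) t + (1 : ℝ) • trans (ξ t).1)
        (fun t ht => (hz (Sum.inl i) t ht).2.pose_smul (ξ t).1) (hx.target (Sum.inl i)) ?_
      have h1 : Tendsto (fun t => rot (ξ t).1 *ᵥ pointError (ξhat t) (ξ t) i) atTop (𝓝 0) := by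
        refine tendsto_zero_of_dot_self ?_
        simp only [rot_dot_rot]
        exact hp i
      have h2 := h1.const_add (h (Sum.inl i))
      rw [add_zero] at h2
      refine h2.congr' ?_
      filter_upwards [Ici_mem_atTop (0 : ℝ)] with t ht
      have h3 : pointError (ξhat t) (ξ t) i = z (Sum.inl i) t - x (Sum.inl i) t :=
        pointError_eq (hx.rep _ t ht) (hz (Sum.inl i) t ht).2
      rw [← hx.inertial (Sum.inl i) t ht, h3, Matrix.mulVec_sub]
      simp only [rcoef, Sum.elim_inl]
      abel
    · -- the line of `z` is represented by the orthogonal projection of `x` on it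
      set c : ℝ → ℝ := fun t => (x (Sum.inr j) t ⬝ᵥ z (Sum.inr j) t) /
        (z (Sum.inr j) t ⬝ᵥ z (Sum.inr j) t) with hc
      have hbe : ∀ t ∈ Ici (0 : ℝ), bearingError (ξhat t) (ξ t) j =
          1 - (x (Sum.inr j) t ⬝ᵥ z (Sum.inr j) t) ^ 2 /
            ((x (Sum.inr j) t ⬝ᵥ x (Sum.inr j) t) * (z (Sum.inr j) t ⬝ᵥ z (Sum.inr j) t)) :=
        fun t ht => bearingError_eq (hx.ne_zero _ t ht) (hz (Sum.inr j) t ht).1 (hx.rep _ t ht)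
          (hz (Sum.inr j) t ht).2
      have hc0 : ∀ t ∈ Ici (0 : ℝ), c t ≠ 0 := by
        intro t ht h0
        have h1 := hb1 j t ht
        have h2 : x (Sum.inr j) t ⬝ᵥ z (Sum.inr j) t = 0 := by
          rcases div_eq_zero_iff.1 h0 with h3 | h3
          · exact h3
          · exact absurd h3 (dot_self_pos (hz (Sum.inr j) t ht).1).ne'
        rw [hbe t ht, h2] at h1
        norm_num at h1
      refine tendsto_of_isRep (r := 0)
        (z := fun t => rot (ξ t).1 *ᵥ (c t • z (Sum.inr j) t) + (0 : ℝ) • trans (ξ t).1)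
        (fun t ht => ?_) (hx.target (Sum.inr j)) ?_
      · have h1 := (hz (Sum.inr j) t ht).2.smul (hc0 t ht)
        simp only [rcoef, Sum.elim_inr, mul_zero] at h1
        exact h1.pose_smul (ξ t).1
      · have h1 : Tendsto (fun t => rot (ξ t).1 *ᵥ
            (c t • z (Sum.inr j) t - x (Sum.inr j) t)) atTop (𝓝 0) := by
          refine tendsto_zero_of_dot_self ?_
          have h2 := (hb j).const_mul (h (Sum.inr j) ⬝ᵥ h (Sum.inr j))
          rw [mul_zero] at h2
          refine h2.congr' ?_
          filter_upwards [Ici_mem_atTop (0 : ℝ)] with t ht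
          have h3 := dot_self_pos (hx.ne_zero (Sum.inr j) t ht)
          have h4 := dot_self_pos (hz (Sum.inr j) t ht).1
          have h5 : h (Sum.inr j) = rot (ξ t).1 *ᵥ x (Sum.inr j) t := by
            rw [← hx.inertial (Sum.inr j) t ht]
            simp [rcoef]
          rw [hbe t ht, rot_dot_rot, h5, rot_dot_rot]
          simp only [sub_dotProduct, dotProduct_sub, smul_dotProduct, dotProduct_smul,
            smul_eq_mul, dotProduct_comm (z (Sum.inr j) t) (x (Sum.inr j) t), hc]
          field_simp
          ring
        have h2 := h1.const_add (h (Sum.inr j))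
        rw [add_zero] at h2
        refine h2.congr' ?_
        filter_upwards [Ici_mem_atTop (0 : ℝ)] with t ht
        rw [← hx.inertial (Sum.inr j) t ht, Matrix.mulVec_sub]
        simp [rcoef]

/-- The squared cosine of the angle to a fixed line is continuous on `RP3`, so that lines
orthogonal to the true bearing cannot converge to it. The representative `ζ` of the estimate is
unique, as its pose determines the change of frame. -/
theorem not_convergesUpToEquiv_of_bearingError (hx : TrueBody U ξ x h)
    {ξhat : ℝ → TotalSpace np nb}
    (hhat : ∀ t ∈ Ici (0 : ℝ), ξhat t ∈ reducedTotalSpace np nb) (j : Fin nb)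
    (hb : ∀ t ∈ Ici (0 : ℝ), bearingError (ξhat t) (ξ t) j = 1) :
    ¬ ConvergesUpToEquiv ξhat ξ := by
  rintro ⟨ζ, hζ, hlim⟩
  set u : R4 := hom (h (Sum.inr j)) 0 with hu
  have htar : IsRep ((ξ 0).2 (Sum.inr j)) (h (Sum.inr j)) 0 := hx.target (Sum.inr j)
  set φ : RP3 → ℝ := fun y => u ⬝ᵥ ((((1 : GL HIdx ℝ) : Matrix HIdx HIdx ℝ) * lineProj y *
      ((1 : GL HIdx ℝ) : Matrix HIdx HIdx ℝ)ᵀ) *ᵥ u) /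
      (((1 : GL HIdx ℝ) : Matrix HIdx HIdx ℝ) * lineProj y *
        ((1 : GL HIdx ℝ) : Matrix HIdx HIdx ℝ)ᵀ).trace with hφ
  have hφeq : ∀ {y : RP3} {z : R3} {r : ℝ}, IsRep y z r →
      φ y = (u ⬝ᵥ hom z r) ^ 2 / (hom z r ⬝ᵥ hom z r) := fun {y z r} hy =>
    (cosSq_lineProj (1 : GL HIdx ℝ) (y := y) (by rwa [one_smul]) u).1
  have hφc : Continuous φ := by
    have h1 : Continuous fun y : RP3 => ((1 : GL HIdx ℝ) : Matrix HIdx HIdx ℝ) * lineProj y *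
        ((1 : GL HIdx ℝ) : Matrix HIdx HIdx ℝ)ᵀ :=
      (continuous_const.matrix_mul continuous_lineProj).matrix_mul continuous_const
    refine (continuous_const.dotProduct (h1.matrix_mulVec continuous_const)).div₀ h1.matrix_trace
      fun y => ?_
    exact (cosSq_lineProj (1 : GL HIdx ℝ) (y := y)
      (by rw [one_smul]; exact IsRep.of_rep y) u).2
  have hdot : ∀ v w : R3, hom v 0 ⬝ᵥ hom w 0 = v ⬝ᵥ w := fun v w => by
    simp [hom, dotProduct, Fintype.sum_sum_type]
  have hlim' := (hφc.tendsto _).comp (hlim (Sum.inr j))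
  have h0 : ∀ t ∈ Ici (0 : ℝ), φ ((ζ t).2 (Sum.inr j)) = 0 := by
    intro t ht
    obtain ⟨h1, h2⟩ := hζ t ht
    obtain ⟨P, hP⟩ := (Quotient.exact h1 : ζ t ∈ MulAction.orbit SE3 (ξhat t))
    have h3 : P * (ξhat t).1 = (ξ t).1 := by rw [← h2, ← hP]; rfl
    have h4 : (ζ t).2 (Sum.inr j) = (ξ t).1 • body (ξhat t) (Sum.inr j) := by
      rw [← hP, ← h3, body, mul_smul, smul_inv_smul]
      rfl
    obtain ⟨z, hz, hrep⟩ := exists_isRep_of_mem (hhat t ht) (Sum.inr j)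
    have h5 : IsRep ((ζ t).2 (Sum.inr j)) (rot (ξ t).1 *ᵥ z) 0 := by
      have := hrep.pose_smul (ξ t).1
      rw [h4]
      simpa [rcoef] using this
    have h6 : h (Sum.inr j) = rot (ξ t).1 *ᵥ x (Sum.inr j) t := by
      rw [← hx.inertial (Sum.inr j) t ht]
      simp [rcoef]
    have h7 := hb t ht
    rw [bearingError_eq (hx.ne_zero _ t ht) hz (hx.rep _ t ht) hrep] at h7
    have h8 := dot_self_pos (hx.ne_zero (Sum.inr j) t ht)
    have h9 := dot_self_pos hz
    have h10 : (x (Sum.inr j) t ⬝ᵥ z) ^ 2 / ((x (Sum.inr j) t ⬝ᵥ x (Sum.inr j) t) * (z ⬝ᵥ z)) = 0 :=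
      by linarith
    rw [div_eq_zero_iff] at h10
    have h11 : x (Sum.inr j) t ⬝ᵥ z = 0 := by
      rcases h10 with h11 | h11
      · exact pow_eq_zero_iff two_ne_zero |>.1 h11
      · exact absurd h11 (by positivity)
    rw [hφeq h5, hu, hdot, h6, rot_dot_rot, h11]
    simp
  have h1 : Tendsto (φ ∘ fun t => (ζ t).2 (Sum.inr j)) atTop (𝓝 0) :=
    tendsto_const_nhds.congr' (by
      filter_upwards [Ici_mem_atTop (0 : ℝ)] with t ht
      exact (h0 t ht).symm)
  have h2 := tendsto_nhds_unique hlim' h1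
  have h3 : h (Sum.inr j) ≠ 0 := fun h0 => htar.ne_zero (by rw [h0, hom_zero])
  rw [hφeq htar, hu, hdot] at h2
  have h4 := dot_self_pos h3
  have : (h (Sum.inr j) ⬝ᵥ h (Sum.inr j)) ^ 2 / (h (Sum.inr j) ⬝ᵥ h (Sum.inr j)) ≠ 0 := by
    positivity
  exact this h2

theorem upsilon_mem_reducedTotalSpace (Y : VSLAMGroup np nb) {ξ₀ : TotalSpace np nb}
    (h0 : ξ₀ ∈ reducedTotalSpace np nb) : upsilon Y ξ₀ ∈ reducedTotalSpace np nb := by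
  choose z hz hrep using fun i => exists_isRep_of_mem h0 i
  refine mem_reducedTotalSpace (z := fun i => sotGroupMat (Y.2 i) (Sum.inr ()) (Sum.inr ()) •
    ((sotGroupMat (Y.2 i)).toBlocks₁₁ᵀ *ᵥ z i)) (fun i => ?_) fun i => ?_
  · obtain ⟨h1, h2, h3⟩ := exists_scaledMat_eq (Y.2 i)
    refine smul_ne_zero h2 fun h4 => hz i ?_
    have := congrArg (fun v => (sotGroupMat (Y.2 i)).toBlocks₁₁ *ᵥ v) h4
    simpa [Matrix.mulVec_mulVec, so3_mul_transpose h1] using this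
  · obtain ⟨h1, h2, h3⟩ := exists_scaledMat_eq (Y.2 i)
    rw [body_upsilon]
    exact (hrep i).sot_inv_smul _ h1 h2 h3

theorem IsObserverRun.convergesUpToEquiv (hx : TrueBody U ξ x h)
    (hS : RiccatiData kG kH σ U x S)
    (hred : ∀ t ∈ Ici (0 : ℝ), ξ t ∈ reducedTotalSpace np nb)
    (hk : 1 / 2 < k) (hkG : 0 < kG) (hkH : 0 < kH) (hσ : 0 < σ) {ξ₀ : TotalSpace np nb}
    (hξ₀ : ξ₀ ∈ reducedTotalSpace np nb) (hb : ∀ j, bearingError ξ₀ (ξ 0) j < 1)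
    {X : ℝ → VSLAMGroup np nb} {Δ : ℝ → Twist}
    (hrun : IsObserverRun k kG U ξ S ξ₀ (Ici 0) X Δ) :
    ConvergesUpToEquiv (fun t => upsilon (X t) ξ₀) ξ := by
  obtain ⟨M, hM, hbd⟩ := exists_pointErrorSq_bound hx hS hk hkG hkH hσ
  have hmem := mem_Ici.2 (le_refl (0 : ℝ))
  have hk0 : 0 < k := by linarith
  have hlim : ∀ a > 0, Tendsto (fun t : ℝ => Real.exp (-a * t)) atTop (𝓝 0) := fun a ha => by
    refine Real.tendsto_exp_atBot.comp ?_
    exact tendsto_id.const_mul_atTop_of_neg (by linarith)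
  refine convergesUpToEquiv_of_errors hx (fun t _ => upsilon_mem_reducedTotalSpace _ hξ₀)
    (fun i => ?_) (fun j => ?_) fun j t ht => ?_
  · have h1 := ((hlim (kH / σ) (by positivity)).mul_const
      (pointError ξ₀ (ξ 0) i ⬝ᵥ pointError ξ₀ (ξ 0) i)).const_mul M
    rw [zero_mul, mul_zero] at h1
    refine squeeze_zero' (Eventually.of_forall fun t => dot_self_nonneg _) ?_ h1
    filter_upwards [Ici_mem_atTop (0 : ℝ)] with t ht
    exact hbd (convex_Ici 0) subset_rfl hmem ξ₀ hξ₀ X Δ hrun t ht i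
  · have hB := fun t ht =>
      hrun.bearingError_bounds hx (convex_Ici 0) subset_rfl hmem hξ₀ j t ht
    have h1 := (hlim ((1 - bearingError ξ₀ (ξ 0) j) * (2 * k))
      (mul_pos (by linarith [hb j]) (by positivity))).mul_const (bearingError ξ₀ (ξ 0) j)
    rw [zero_mul] at h1
    refine squeeze_zero' ?_ ?_ h1
    · filter_upwards [Ici_mem_atTop (0 : ℝ)] with t ht
      exact (hB t ht).1
    · filter_upwards [Ici_mem_atTop (0 : ℝ)] with t ht
      refine (hB t ht).2.1.trans (le_of_eq ?_)
      ring_nf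
  · have h1 := (hrun.bearingError_bounds hx (convex_Ici 0) subset_rfl hmem hξ₀ j t ht).2.1
    obtain ⟨h2, h3⟩ := bearingError_mem_Icc hξ₀ (hred 0 hmem) j
    refine h1.trans_lt (lt_of_le_of_lt (mul_le_of_le_one_left h2 (Real.exp_le_one_iff.2 ?_)) (hb j))
    have : 0 ≤ t := ht
    exact neg_nonpos.2 (mul_nonneg (by linarith) (by positivity))

theorem bearingError_lt_one_of_mem_basin (hx : TrueBody U ξ x h)
    (hred : ∀ t ∈ Ici (0 : ℝ), ξ t ∈ reducedTotalSpace np nb) {ξ₀ : TotalSpace np nb}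
    (hξ₀ : ξ₀ ∈ basin k kG U ξ S) (j : Fin nb) : bearingError ξ₀ (ξ 0) j < 1 := by
  obtain ⟨hr, ⟨X, Δ, hrun⟩, hconv⟩ := hξ₀
  have hmem := mem_Ici.2 (le_refl (0 : ℝ))
  refine lt_of_le_of_ne (bearingError_mem_Icc hr (hred 0 hmem) j).2 fun h1 => ?_
  refine not_convergesUpToEquiv_of_bearingError hx
    (fun t _ => upsilon_mem_reducedTotalSpace _ hr) j (fun t ht => ?_) (hconv X Δ hrun)
  exact (hrun.bearingError_bounds hx (convex_Ici 0) subset_rfl hmem hr j t ht).2.2 h1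

/-- The initial `cos²` of a bearing is continuous and positive on the basin of attraction. -/
theorem exists_bearing_gap (hx : TrueBody U ξ x h)
    (hred : ∀ t ∈ Ici (0 : ℝ), ξ t ∈ reducedTotalSpace np nb) {K : Set (TotalSpace np nb)}
    (hK : K ⊆ basin k kG U ξ S) (hKc : IsCompact K) :
    ∃ c > 0, ∀ ξ₀ ∈ K, ∀ j, c ≤ 1 - bearingError ξ₀ (ξ 0) j := by
  have hmem := mem_Ici.2 (le_refl (0 : ℝ))
  have hj : ∀ j : Fin nb, ∃ c > 0, ∀ ξ₀ ∈ K, c ≤ 1 - bearingError ξ₀ (ξ 0) j := by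
    intro j
    rcases K.eq_empty_or_nonempty with rfl | hne
    · exact ⟨1, one_pos, fun _ h => absurd h (notMem_empty _)⟩
    have hcont : ContinuousOn (fun ξ₀ => 1 - bearingError ξ₀ (ξ 0) j) K := by
      set y := x (Sum.inr j) 0 with hy
      have hy0 := hx.ne_zero (Sum.inr j) 0 hmem
      set N : TotalSpace np nb → Matrix HIdx HIdx ℝ := fun ζ =>
        (((ζ.1 : GL HIdx ℝ)⁻¹ : GL HIdx ℝ) : Matrix HIdx HIdx ℝ) with hN
      set E : TotalSpace np nb → Matrix HIdx HIdx ℝ := fun ζ =>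
        N ζ * lineProj (ζ.2 (Sum.inr j)) * (N ζ)ᵀ with hE
      have hEc : Continuous E := by
        have h1 : Continuous N := Units.continuous_val.comp
          (continuous_inv.comp (continuous_subtype_val.comp continuous_fst))
        exact (h1.matrix_mul (continuous_lineProj.comp
          ((continuous_apply (Sum.inr j)).comp continuous_snd))).matrix_mul h1.matrix_transpose
      have htr : ∀ ζ, (E ζ).trace ≠ 0 := fun ζ =>
        (cosSq_lineProj (ζ.1 : GL HIdx ℝ)⁻¹ (IsRep.of_rep _) 0).2
      have hF : Continuous fun ζ => (y ⬝ᵥ y)⁻¹ *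
          (hom y 0 ⬝ᵥ (E ζ *ᵥ hom y 0) / (E ζ).trace) :=
        continuous_const.mul ((continuous_const.dotProduct
          (hEc.matrix_mulVec continuous_const)).div₀ hEc.matrix_trace htr)
      refine hF.continuousOn.congr fun ζ hζ => ?_
      obtain ⟨z, hz, hrep⟩ := exists_isRep_of_mem (hK hζ).1 (Sum.inr j)
      have h1 := (cosSq_lineProj (ζ.1 : GL HIdx ℝ)⁻¹ (y := ζ.2 (Sum.inr j)) (z := z) (r := 0)
        hrep (hom y 0)).1
      have hdot : ∀ v w : R3, hom v 0 ⬝ᵥ hom w 0 = v ⬝ᵥ w := fun v w => by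
        simp [hom, dotProduct, Fintype.sum_sum_type]
      rw [hdot, hdot] at h1
      have hp1 := dot_self_pos hy0
      have hp2 := dot_self_pos hz
      change 1 - bearingError ζ (ξ 0) j = (y ⬝ᵥ y)⁻¹ * (_ / _)
      rw [h1, bearingError_eq hy0 hz (hx.rep _ 0 hmem) hrep, ← hy]
      field_simp
      ring
    obtain ⟨ζ, hζ, hmin⟩ := hKc.exists_isMinOn hne hcont
    exact ⟨1 - bearingError ζ (ξ 0) j,
      by linarith [bearingError_lt_one_of_mem_basin hx hred (hK hζ) j], fun ξ₀ h => hmin h⟩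
  choose c hc hle using hj
  rcases isEmpty_or_nonempty (Fin nb) with hn | hn
  · exact ⟨1, one_pos, fun _ _ j => isEmptyElim j⟩
  · obtain ⟨j₀, hj₀⟩ := Finite.exists_min c
    exact ⟨c j₀, hc j₀, fun ξ₀ h j => (hj₀ j).trans (hle j ξ₀ h)⟩

end

/-! ### Continuous least-squares solutions -/

theorem continuous_matrix_inv {ι : Type} [Fintype ι] [DecidableEq ι] {N : ℝ → Matrix ι ι ℝ}
    (hN : Continuous N) (hu : ∀ t, IsUnit (N t)) : Continuous fun t => (N t)⁻¹ := by
  simp only [Matrix.inv_def, Ring.inverse_eq_inv']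
  exact (hN.matrix_det.inv₀ fun t => ((Matrix.isUnit_iff_isUnit_det _).1 (hu t)).ne_zero).smul
    hN.matrix_adjugate

theorem isUnit_of_mulVec_eq_zero {ι : Type} [Fintype ι] [DecidableEq ι] {N : Matrix ι ι ℝ}
    (h : ∀ d, N *ᵥ d = 0 → d = 0) : IsUnit N := by
  refine Matrix.mulVec_injective_iff_isUnit.1 fun a b hab => sub_eq_zero.1 (h _ ?_)
  rw [Matrix.mulVec_sub]
  exact sub_eq_zero.2 hab

/-- A least-squares problem whose kernel is the range of a continuous matrix `L` has a continuous
solution: the gauge term `L Lᵀ` makes the normal equations invertible and vanishes at their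
solution. -/
theorem exists_continuous_leastSquares {I ι κ : Type} [Fintype I] [Fintype ι] [Fintype κ]
    [DecidableEq κ] {C : I → ℝ → Matrix ι κ ℝ} {g : I → ℝ → ι → ℝ} {L : ℝ → Matrix κ κ ℝ}
    (hC : ∀ i, Continuous (C i)) (hg : ∀ i, Continuous (g i)) (hL : Continuous L)
    (hker : ∀ t d, (∀ i, C i t *ᵥ d = 0) ↔ ∃ w, d = L t *ᵥ w) :
    ∃ d : ℝ → κ → ℝ, Continuous d ∧ ∀ t d',
      ∑ i, (C i t *ᵥ d t + g i t) ⬝ᵥ (C i t *ᵥ d t + g i t) ≤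
        ∑ i, (C i t *ᵥ d' + g i t) ⬝ᵥ (C i t *ᵥ d' + g i t) := by
  set N : ℝ → Matrix κ κ ℝ := fun t => ∑ i, (C i t)ᵀ * C i t + L t * (L t)ᵀ with hN
  set b : ℝ → κ → ℝ := fun t => ∑ i, (C i t)ᵀ *ᵥ g i t with hb
  have hNc : Continuous N :=
    (continuous_finsetSum _ fun i _ => (hC i).matrix_transpose.matrix_mul (hC i)).add
      (hL.matrix_mul hL.matrix_transpose)
  have hbc : Continuous b :=
    continuous_finsetSum _ fun i _ => (hC i).matrix_transpose.matrix_mulVec (hg i)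
  have hT : ∀ {m : Type} [Fintype m] (A : Matrix m κ ℝ) (u : κ → ℝ) (v : m → ℝ),
      u ⬝ᵥ (Aᵀ *ᵥ v) = (A *ᵥ u) ⬝ᵥ v := fun A u v => by
    rw [Matrix.dotProduct_mulVec, Matrix.vecMul_transpose]
  have hNd : ∀ t u d, u ⬝ᵥ (N t *ᵥ d) =
      ∑ i, (C i t *ᵥ u) ⬝ᵥ (C i t *ᵥ d) + ((L t)ᵀ *ᵥ u) ⬝ᵥ ((L t)ᵀ *ᵥ d) := by
    intro t u d
    have h1 : u ⬝ᵥ ((L t * (L t)ᵀ) *ᵥ d) = ((L t)ᵀ *ᵥ u) ⬝ᵥ ((L t)ᵀ *ᵥ d) := by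
      rw [← hT, Matrix.transpose_transpose, Matrix.mulVec_mulVec]
    simp only [hN, Matrix.add_mulVec, Matrix.sum_mulVec, dotProduct_add, dotProduct_sum, h1]
    congr 1
    refine Finset.sum_congr rfl fun i _ => ?_
    rw [← Matrix.mulVec_mulVec, hT]
  have hu : ∀ t, IsUnit (N t) := fun t => isUnit_of_mulVec_eq_zero fun d hd => by
    have h1 := hNd t d d
    rw [hd, dotProduct_zero] at h1
    have h2 : ∀ i ∈ Finset.univ, 0 ≤ (C i t *ᵥ d) ⬝ᵥ (C i t *ᵥ d) :=
      fun i _ => dot_self_nonneg _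
    have h3 := Finset.sum_nonneg h2
    have h4 := dot_self_nonneg ((L t)ᵀ *ᵥ d)
    have h5 : ∑ i, (C i t *ᵥ d) ⬝ᵥ (C i t *ᵥ d) = 0 := by linarith
    have h6 : ((L t)ᵀ *ᵥ d) ⬝ᵥ ((L t)ᵀ *ᵥ d) = 0 := by linarith
    obtain ⟨w, hw⟩ := (hker t d).1 fun i => dotProduct_self_eq_zero.1
      ((Finset.sum_eq_zero_iff_of_nonneg h2).1 h5 i (Finset.mem_univ i))
    refine dotProduct_self_eq_zero.1 ?_
    have h7 := hT (L t)ᵀ d w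
    rwa [Matrix.transpose_transpose, ← hw, dotProduct_self_eq_zero.1 h6, zero_dotProduct] at h7
  refine ⟨fun t => -((N t)⁻¹ *ᵥ b t), ((continuous_matrix_inv hNc hu).matrix_mulVec hbc).neg,
    fun t d' => ?_⟩
  set d := -((N t)⁻¹ *ᵥ b t) with hd
  have hsol : N t *ᵥ d = -b t := by
    rw [hd, Matrix.mulVec_neg, Matrix.mulVec_mulVec,
      Matrix.mul_nonsing_inv _ ((Matrix.isUnit_iff_isUnit_det _).1 (hu t)), Matrix.one_mulVec]
  have hbu : ∀ u, u ⬝ᵥ b t = ∑ i, (C i t *ᵥ u) ⬝ᵥ g i t := fun u => by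
    simp only [hb, dotProduct_sum, hT]
  -- the gauge term vanishes
  have hgauge : (L t * (L t)ᵀ) *ᵥ d = 0 := by
    set u := (L t * (L t)ᵀ) *ᵥ d with hu'
    have h1 : ∀ i, C i t *ᵥ u = 0 := (hker t u).2 ⟨(L t)ᵀ *ᵥ d, by rw [hu', Matrix.mulVec_mulVec]⟩
    have h2 := hNd t u d
    rw [hsol, dotProduct_neg, hbu] at h2
    simp only [h1, zero_dotProduct, Finset.sum_const_zero, neg_zero, zero_add] at h2
    refine dotProduct_self_eq_zero.1 ?_
    have h3 := hT (L t)ᵀ u ((L t)ᵀ *ᵥ d)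
    rwa [← h2, Matrix.transpose_transpose, Matrix.mulVec_mulVec, ← hu'] at h3
  have horth : ∀ u, ∑ i, (C i t *ᵥ u) ⬝ᵥ (C i t *ᵥ d + g i t) = 0 := by
    intro u
    have h1 := hNd t u d
    have h2 : ((L t)ᵀ *ᵥ u) ⬝ᵥ ((L t)ᵀ *ᵥ d) = 0 := by
      rw [← hT, Matrix.transpose_transpose, Matrix.mulVec_mulVec, hgauge, dotProduct_zero]
    rw [hsol, dotProduct_neg, hbu, h2, add_zero] at h1
    simp only [dotProduct_add, Finset.sum_add_distrib]
    linarith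
  have h1 : ∀ i, (C i t *ᵥ d' + g i t) ⬝ᵥ (C i t *ᵥ d' + g i t) =
      (C i t *ᵥ d + g i t) ⬝ᵥ (C i t *ᵥ d + g i t) +
        2 * ((C i t *ᵥ (d' - d)) ⬝ᵥ (C i t *ᵥ d + g i t)) +
        (C i t *ᵥ (d' - d)) ⬝ᵥ (C i t *ᵥ (d' - d)) := fun i => by
    simp only [Matrix.mulVec_sub, add_dotProduct, dotProduct_add, sub_dotProduct, dotProduct_sub,
      dotProduct_comm (g i t), dotProduct_comm (C i t *ᵥ d) (C i t *ᵥ d')]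
    ring
  simp only [h1, Finset.sum_add_distrib, ← Finset.mul_sum, horth, mul_zero, add_zero]
  exact le_add_of_nonneg_right (Finset.sum_nonneg fun i _ => dot_self_nonneg _)

theorem eq_smul_of_cross_eq_zero {ω u : R3} (hu : u ≠ 0) (h : crossProduct ω u = 0) :
    ω = ((ω ⬝ᵥ u) / (u ⬝ᵥ u)) • u := by
  have h1 := dot_self_pos hu
  have h2 := cross_cross_eq_smul_sub_smul ω u u
  rw [h, map_zero, LinearMap.zero_apply] at h2
  have h3 : (u ⬝ᵥ u) • ω = (ω ⬝ᵥ u) • u := (sub_eq_zero.1 h2.symm).symm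
  rw [div_eq_inv_mul, mul_smul, ← h3, smul_smul, inv_mul_cancel₀ h1.ne', one_smul]

/-- The angular velocities that fix the directions `u i` are the range of a continuous matrix, if
the vectors `u i` that do not vanish identically are pairwise independent at every time. -/
theorem exists_continuous_stabilizer {I : Type} {u : I → ℝ → R3} (hu : ∀ i, Continuous (u i))
    (T : Set I) (hT : ∀ i ∉ T, ∀ t, u i t = 0) (hne : ∀ i ∈ T, ∀ t, u i t ≠ 0)
    (hind : ∀ i ∈ T, ∀ j ∈ T, i ≠ j → ∀ t, crossProduct (u i t) (u j t) ≠ 0) :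
    ∃ A : ℝ → Mat3, Continuous A ∧
      ∀ t ω, (∀ i, crossProduct ω (u i t) = 0) ↔ ∃ w, ω = A t *ᵥ w := by
  rcases T.eq_empty_or_nonempty with rfl | ⟨i, hi⟩
  · refine ⟨fun _ => 1, continuous_const, fun t ω => ⟨fun _ => ⟨ω, by simp⟩, fun _ i => ?_⟩⟩
    rw [hT i (notMem_empty i), map_zero]
  by_cases hj : ∃ j ∈ T, i ≠ j
  · obtain ⟨j, hj, hij⟩ := hj
    refine ⟨fun _ => 0, continuous_const, fun t ω => ⟨fun h => ⟨0, ?_⟩, ?_⟩⟩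
    · rw [Matrix.mulVec_zero]
      have h1 := eq_smul_of_cross_eq_zero (hne i hi t) (h i)
      have h2 := h j
      rw [h1, map_smul, LinearMap.smul_apply] at h2
      rcases smul_eq_zero.1 h2 with h3 | h3
      · rw [h1, h3, zero_smul]
      · exact absurd h3 (hind i hi j hj hij t)
    · rintro ⟨w, rfl⟩ l
      simp
  · push Not at hj
    refine ⟨fun t => Matrix.vecMulVec (u i t) (u i t), (hu i).matrix_vecMulVec (hu i),
      fun t ω => ⟨fun h => ?_, ?_⟩⟩
    · have h1 := eq_smul_of_cross_eq_zero (hne i hi t) (h i)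
      have h2 := dot_self_pos (hne i hi t)
      refine ⟨((ω ⬝ᵥ u i t) / (u i t ⬝ᵥ u i t) ^ 2) • u i t, ?_⟩
      rw [Matrix.vecMulVec_mulVec, op_smul_eq_smul, dotProduct_smul, smul_eq_mul]
      conv_lhs => rw [h1]
      congr 1
      field_simp
    · rintro ⟨w, rfl⟩ l
      by_cases hl : l ∈ T
      · rw [← hj l hl, Matrix.vecMulVec_mulVec, op_smul_eq_smul, map_smul, LinearMap.smul_apply,
          cross_self, smul_zero]
      · rw [hT l hl, map_zero]

/-! ### The robot cost in homogeneous coordinates -/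

/-- The infinitesimal action of a robot innovation on the vector `(z, r)`. -/
def actionMat (z : R3) (r : ℝ) : Matrix HIdx (Fin 3 ⊕ Fin 3) ℝ :=
  Matrix.fromBlocks (-skew z) (r • (1 : Mat3)) 0 0

theorem actionMat_mulVec (z : R3) (r : ℝ) (d : Fin 3 ⊕ Fin 3 → ℝ) :
    actionMat z r *ᵥ d =
      hom (crossProduct (fun a => d (Sum.inl a)) z + r • fun a => d (Sum.inr a)) 0 := by
  have h1 : crossProduct (fun a => d (Sum.inl a)) z = -(skew z *ᵥ fun a => d (Sum.inl a)) := by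
    rw [skew_mulVec, cross_anticomm]
  rw [h1]
  funext a
  rcases a with a | a <;>
    simp [actionMat, hom, Matrix.mulVec, dotProduct, Fintype.sum_sum_type, Matrix.one_apply]

/-- The matrix of one term of the least-squares cost. -/
noncomputable def costMat (z : R3) (r : ℝ) : Matrix HIdx (Fin 3 ⊕ Fin 3) ℝ :=
  (Real.sqrt (hom z r ⬝ᵥ hom z r))⁻¹ • (proj (hom z r) * actionMat z r)

theorem actionMat_smul (c : ℝ) (z : R3) (r : ℝ) :
    actionMat (c • z) (c * r) = c • actionMat z r := by
  rw [actionMat, actionMat, Matrix.fromBlocks_smul, smul_smul, smul_zero]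
  congr 1
  ext a b
  fin_cases a <;> fin_cases b <;> simp [skew]

/-- The cost is the squared norm of an affine function of the robot innovation, which does not
depend on the homogeneous coordinates that are used. -/
theorem robotCost_eq {np nb : ℕ} {ξhat : TotalSpace np nb} {z : Idx np nb → R3}
    (hrep : ∀ i, IsRep (body ξhat i) (z i) (rcoef i)) (D : Idx np nb → Matrix HIdx HIdx ℝ)
    (d : Twist) :
    robotCost ξhat D d = ∑ i,
      (costMat (z i) (rcoef i) *ᵥ Sum.elim d.1 d.2 +
        (Real.sqrt (hom (z i) (rcoef i) ⬝ᵥ hom (z i) (rcoef i)))⁻¹ •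
          (proj (hom (z i) (rcoef i)) *ᵥ (D i *ᵥ hom (z i) (rcoef i)))) ⬝ᵥ
      (costMat (z i) (rcoef i) *ᵥ Sum.elim d.1 d.2 +
        (Real.sqrt (hom (z i) (rcoef i) ⬝ᵥ hom (z i) (rcoef i)))⁻¹ •
          (proj (hom (z i) (rcoef i)) *ᵥ (D i *ᵥ hom (z i) (rcoef i)))) := by
  refine Finset.sum_congr rfl fun i _ => ?_
  obtain ⟨c, hc, hθ⟩ := (hrep i).rep_eq
  set θ := hom (z i) (rcoef i) with hθdef
  have hpos : 0 < θ ⬝ᵥ θ := dot_self_pos (hrep i).ne_zero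
  rw [← smul_hom, ← hθdef] at hθ
  have hh : head (c • θ) = c • z i := rfl
  have hl : last (c • θ) = c * rcoef i := rfl
  have hmat : (Matrix.fromBlocks (-skew (head (c • θ)))
      (last (c • θ) • (1 : Matrix (Fin 3) (Fin 3) ℝ)) 0 0 :
          Matrix (Fin 3 ⊕ Unit) (Fin 3 ⊕ Fin 3) ℝ) = c • actionMat (z i) (rcoef i) := by
    rw [hh, hl, ← actionMat_smul]
    rfl
  have hsq : (Real.sqrt (c * (c * (θ ⬝ᵥ θ))))⁻¹ * c * ((Real.sqrt (c * (c * (θ ⬝ᵥ θ))))⁻¹ * c) =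
      (Real.sqrt (θ ⬝ᵥ θ))⁻¹ * (Real.sqrt (θ ⬝ᵥ θ))⁻¹ := by
    have h2 : 0 ≤ c * (c * (θ ⬝ᵥ θ)) := by nlinarith [mul_self_nonneg c]
    rw [mul_mul_mul_comm, ← mul_inv, ← mul_inv, Real.mul_self_sqrt h2,
      Real.mul_self_sqrt hpos.le]
    field_simp
  simp only [hθ, hmat, proj_smul hc, Matrix.smul_mulVec, Matrix.mulVec_smul, ← smul_add, costMat,
    ← Matrix.mulVec_mulVec, smul_smul, smul_dotProduct, dotProduct_smul, smul_eq_mul, ← hθdef,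
    ← Matrix.mulVec_add]
  linear_combination ((proj θ *ᵥ (actionMat (z i) (rcoef i) *ᵥ Sum.elim d.1 d.2 + D i *ᵥ θ)) ⬝ᵥ
    (proj θ *ᵥ (actionMat (z i) (rcoef i) *ᵥ Sum.elim d.1 d.2 + D i *ᵥ θ))) * hsq

/-- A term of the homogeneous least-squares problem vanishes if the motion fixes the landmark. The
projection loses nothing: the motion of `(z, r)` has last coordinate `0`, so that it can be
parallel to `(z, r)` only for `r = 0`, and then it is orthogonal to `z`. -/
theorem costMat_mulVec_eq_zero_iff {z : R3} (hz : z ≠ 0) (r : ℝ) (d : Fin 3 ⊕ Fin 3 → ℝ) :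
    costMat z r *ᵥ d = 0 ↔
      crossProduct (fun a => d (Sum.inl a)) z + r • (fun a => d (Sum.inr a)) = 0 := by
  have hθ : hom z r ≠ 0 := hom_ne_zero_of_left hz r
  have hpos := dot_self_pos hθ
  set ω : R3 := fun a => d (Sum.inl a)
  set v : R3 := fun a => d (Sum.inr a)
  have hs : (Real.sqrt (hom z r ⬝ᵥ hom z r))⁻¹ ≠ 0 := inv_ne_zero (Real.sqrt_pos.2 hpos).ne'
  rw [costMat, Matrix.smul_mulVec, smul_eq_zero, or_iff_right hs, ← Matrix.mulVec_mulVec,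
    actionMat_mulVec, proj_mulVec]
  constructor
  · intro h0
    rw [sub_eq_zero, smul_hom] at h0
    set c := (hom z r ⬝ᵥ hom z r)⁻¹ * (hom z r ⬝ᵥ hom (crossProduct ω z + r • v) 0)
    obtain ⟨h1, h2⟩ := hom_inj h0
    have h3 : c * (z ⬝ᵥ z) = r * (z ⬝ᵥ v) := by
      have := congrArg (fun y => z ⬝ᵥ y) h1
      simp only [dotProduct_add, dotProduct_smul, dot_cross_self, smul_eq_mul, zero_add] at this
      exact this.symm
    have h4 : c * c * (z ⬝ᵥ z) = 0 := by
      rw [mul_assoc, h3, ← mul_assoc, ← h2, zero_mul]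
    have h5 : c = 0 := by
      rcases mul_eq_zero.1 h4 with h | h
      · exact mul_self_eq_zero.1 h
      · exact absurd h (dot_self_pos hz).ne'
    rw [h1, h5, zero_smul]
  · intro h0
    rw [h0, hom_zero, dotProduct_zero, mul_zero, zero_smul, sub_zero]

/-! ### Existence of observer runs -/

theorem exists_pose {R : Mat3} (hR : R ∈ Matrix.specialOrthogonalGroup (Fin 3) ℝ) (x : R3) :
    ∃ P : SE3, poseMat P = rigidMat R x := by
  have h1 := so3_mul_transpose hR
  have hv : R *ᵥ (-(Rᵀ *ᵥ x)) = -x := by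
    rw [Matrix.mulVec_neg, Matrix.mulVec_mulVec, h1, Matrix.one_mulVec]
  have hcol : R * Matrix.replicateCol Unit (-(Rᵀ *ᵥ x)) = -Matrix.replicateCol Unit x := by
    ext a b
    simpa [Matrix.mul_apply, Matrix.mulVec, dotProduct] using congrFun hv a
  have h2 : rigidMat R x * rigidMat Rᵀ (-(Rᵀ *ᵥ x)) = 1 := by
    rw [rigidMat, rigidMat, Matrix.fromBlocks_multiply, ← Matrix.fromBlocks_one]
    congr 1
    · simp [h1]
    · rw [hcol]
      simp
    · simp
    · simp
  exact ⟨⟨⟨rigidMat R x, rigidMat Rᵀ (-(Rᵀ *ᵥ x)), h2, mul_eq_one_comm.1 h2⟩, R, hR, x, rfl⟩, rfl⟩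

theorem exists_scaledRotation {R : Mat3} (hR : R ∈ Matrix.specialOrthogonalGroup (Fin 3) ℝ)
    {a : ℝ} (ha : a ≠ 0) : ∃ Q : SOT3, sotGroupMat Q = scaledMat R a := by
  have h2 : scaledMat R a * scaledMat Rᵀ a⁻¹ = 1 := by
    rw [scaledMat, scaledMat, Matrix.fromBlocks_multiply, ← Matrix.fromBlocks_one]
    congr 1 <;> simp [so3_mul_transpose hR, smul_smul, ha]
  exact ⟨⟨⟨scaledMat R a, scaledMat Rᵀ a⁻¹, h2, mul_eq_one_comm.1 h2⟩, R, hR, a, ha, rfl⟩, rfl⟩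

theorem continuous_crossProduct {f g : ℝ → R3} (hf : Continuous f) (hg : Continuous g) :
    Continuous fun t => crossProduct (f t) (g t) := by
  simp only [← skew_mulVec]
  exact (continuous_skew.comp hf).matrix_mulVec hg

theorem continuous_hom {f : ℝ → R3} (hf : Continuous f) {g : ℝ → ℝ} (hg : Continuous g) :
    Continuous fun t => hom (f t) (g t) := by
  refine continuous_pi fun a => ?_
  rcases a with a | a
  · exact (continuous_apply a).comp hf
  · exact hg

theorem continuous_proj {ι : Type} [Fintype ι] [DecidableEq ι] {f : ℝ → ι → ℝ}
    (hf : Continuous f) (h0 : ∀ t, f t ≠ 0) : Continuous fun t => proj (f t) :=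
  continuous_const.sub (((hf.dotProduct hf).inv₀ fun t => (dot_self_pos (h0 t)).ne').smul
    (hf.matrix_vecMulVec hf))

/-- Scaled rotations that transport `z t` to a fixed vector: if `z' = s z - ω × z`, then the
solution of `Q' = Q [ω^×, 0; 0, s]`, `Q 0 = 1` satisfies `Q⁻¹ [z 0; r] = [z; r]`. -/
theorem exists_scaledRotation_curve {z ω : ℝ → R3} {s : ℝ → ℝ} (hω : Continuous ω)
    (hs : Continuous s)
    (hzd : ∀ t ∈ Ici (0 : ℝ), HasDerivWithinAt z (s t • z t - skew (ω t) *ᵥ z t) (Ici 0) t) :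
    ∃ Q : ℝ → SOT3, Q 0 = 1 ∧
      (∀ t, HasMatDeriv (fun u => sotGroupMat (Q u)) (sotGroupMat (Q t) * sotMat (ω t) (s t))
        univ t) ∧
      ∀ y r, IsRep y (z 0) r → ∀ t ∈ Ici (0 : ℝ), IsRep ((Q t : GL HIdx ℝ)⁻¹ • y) (z t) r := by
  obtain ⟨R, hR0, hRd, hR⟩ := exists_rotation hω
  obtain ⟨F, hF0, hFd⟩ := exists_antideriv hs
  choose Q hQ using fun t => exists_scaledRotation (hR t) (Real.exp_pos (F t)).ne'
  refine ⟨Q, ?_, ?_, ?_⟩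
  · refine Subtype.ext (Units.ext ?_)
    change sotGroupMat (Q 0) = 1
    rw [hQ, hR0, hF0, Real.exp_zero, scaledMat, one_smul, Matrix.fromBlocks_one]
  · intro t
    have h1 : sotGroupMat (Q t) * sotMat (ω t) (s t) = Matrix.fromBlocks (R t * skew (ω t)) 0 0
        ((Real.exp (F t) * s t) • (1 : Matrix Unit Unit ℝ)) := by
      rw [hQ, scaledMat, sotMat, Matrix.fromBlocks_multiply]
      simp [smul_smul, mul_comm]
    rw [h1]
    simp only [hQ, scaledMat]
    rintro (a | a) (b | b)
    · exact hRd t a b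
    · simpa using hasDerivWithinAt_const t univ (0 : ℝ)
    · simpa using hasDerivWithinAt_const t univ (0 : ℝ)
    · simpa using (hFd t).exp
  · intro y r hy t ht
    have hconst := vec_eq_of_hasDerivWithinAt_zero (convex_Ici (0 : ℝ))
      (v := fun u => Real.exp (-F u) • (R u *ᵥ z u))
      (fun u hu => ((hFd u).neg.exp.hasDerivWithinAt (s := Ici 0)).smul
        (((hRd u).mono (subset_univ _)).mulVec (hzd u hu)))
      (fun u _ => by
        simp only [Matrix.mulVec_sub, Matrix.mulVec_smul, ← Matrix.mulVec_mulVec, smul_sub,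
          smul_add, smul_smul, mul_neg, neg_smul]
        abel) ht (mem_Ici.2 (le_refl (0 : ℝ)))
    simp only [hR0, hF0, neg_zero, Real.exp_zero, one_smul, Matrix.one_mulVec] at hconst
    have h1 := hy.sot_inv_smul (Q t) (hR t) (Real.exp_pos (F t)).ne' (hQ t)
    rwa [← hconst, Matrix.mulVec_smul, smul_smul, ← Real.exp_add, add_neg_cancel, Real.exp_zero,
      one_smul, Matrix.mulVec_mulVec, so3_transpose_mul (hR t), Matrix.one_mulVec] at h1

theorem exists_pose_curve {W : ℝ → Twist} (hW : Continuous W) :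
    ∃ A : ℝ → SE3, A 0 = 1 ∧
      ∀ t, HasMatDeriv (fun u => poseMat (A u)) (poseMat (A t) * twistMat (W t)) univ t := by
  obtain ⟨R, hR0, hRd, hR⟩ := exists_rotation (continuous_fst.comp hW)
  have hRc : Continuous R := continuousOn_univ.1 (continuousOn_of_hasMatDeriv fun t _ => hRd t)
  obtain ⟨x, hx0, hxd⟩ := exists_antideriv (hRc.matrix_mulVec (continuous_snd.comp hW))
  choose A hA using fun t => exists_pose (hR t) (x t)
  refine ⟨A, ?_, fun t => ?_⟩
  · refine Subtype.ext (Units.ext ?_)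
    change poseMat (A 0) = 1
    rw [hA, hR0, hx0, rigidMat, ← Matrix.fromBlocks_one]
    congr 1
  · have h1 : poseMat (A t) * twistMat (W t) = Matrix.fromBlocks (R t * skew (W t).1)
        (R t * Matrix.replicateCol Unit (W t).2) 0 0 := by
      rw [hA, rigidMat, twistMat, Matrix.fromBlocks_multiply]
      congr 1 <;> simp
    rw [h1]
    simp only [hA, rigidMat]
    rintro (a | a) (b | b)
    · exact hRd t a b
    · exact (hasDerivAt_pi.1 (hxd t) a).hasDerivWithinAt
    · simpa using hasDerivWithinAt_const t univ (0 : ℝ)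
    · simpa using hasDerivWithinAt_const t univ ((1 : Matrix Unit Unit ℝ) a b)

theorem twistMat_add (W W' : Twist) : twistMat W + twistMat W' = twistMat (W + W') := by
  rw [twistMat, twistMat, twistMat, Matrix.fromBlocks_add]
  congr 1
  · ext a b
    fin_cases a <;> fin_cases b <;> simp [skew] <;> ring
  · simp
  · simp

section Existence

variable {np nb : ℕ} {k kG kH σ : ℝ} {U : ℝ → Twist} {ξ : ℝ → TotalSpace np nb}
  {S : Fin np → ℝ → Mat3} {x : Idx np nb → ℝ → R3} {h : Idx np nb → R3}

theorem continuousOn_corrMat (hx : TrueBody U ξ x h) (hS : RiccatiData kG kH σ U x S)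
    (i : Idx np nb) : ContinuousOn (fun t => corrMat k kG S t i (x i t)) (Ici 0) := by
  have hp := hx.continuousOn_proj i
  have hs : ContinuousOn (fun t => sigma (nb := nb) S t i) (Ici 0) := by
    rcases i with i | j
    · exact (hS.along i).continuousOn
    · exact continuousOn_const
  exact (((hs.mul hp).mul continuousOn_const).const_smul k).mul hp

/-- The linear flow of the estimate of the landmark `i`: the solution that starts at `c` is
`Φ i t (c + F i t)`, and `Ψ i t` is the inverse of `Φ i t`. -/
structure LandmarkFlow (k kG : ℝ) (U : ℝ → Twist) (S : Fin np → ℝ → Mat3)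
    (x : Idx np nb → ℝ → R3) (Φ Ψ : Idx np nb → ℝ → Mat3) (F : Idx np nb → ℝ → R3) : Prop where
  left_inv : ∀ i t, Ψ i t * Φ i t = 1
  start : ∀ i, Φ i 0 = 1
  start' : ∀ i, F i 0 = 0
  diff : ∀ i t, ∃ M, HasMatDeriv (Φ i) M univ t
  diff' : ∀ i t, ∃ M, HasMatDeriv (Ψ i) M univ t
  diffF : ∀ i, Differentiable ℝ (F i)
  deriv : ∀ i c, ∀ t ∈ Ici (0 : ℝ), HasDerivWithinAt (fun u => Φ i u *ᵥ (c + F i u))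
    (-(skew (U t).1 *ᵥ (Φ i t *ᵥ (c + F i t))) - rcoef i • (U t).2
      - corrMat k kG S t i (x i t) *ᵥ (Φ i t *ᵥ (c + F i t))) (Ici 0) t

theorem exists_landmarkFlow (k : ℝ) (hU : ContinuousOn U (Ici 0)) (hx : TrueBody U ξ x h)
    (hS : RiccatiData kG kH σ U x S) : ∃ Φ Ψ F, LandmarkFlow k kG U S x Φ Ψ F := by
  have hone : ∀ i : Idx np nb, ∃ (Φ Ψ : ℝ → Mat3) (F : ℝ → R3), (∀ t, Ψ t * Φ t = 1) ∧ Φ 0 = 1 ∧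
      F 0 = 0 ∧ (∀ t, ∃ M, HasMatDeriv Φ M univ t) ∧ (∀ t, ∃ M, HasMatDeriv Ψ M univ t) ∧
      Differentiable ℝ F ∧
      ∀ c, ∀ t ∈ Ici (0 : ℝ), HasDerivWithinAt (fun u => Φ u *ᵥ (c + F u))
        (-(skew (U t).1 *ᵥ (Φ t *ᵥ (c + F t))) - rcoef i • (U t).2
          - corrMat k kG S t i (x i t) *ᵥ (Φ t *ᵥ (c + F t))) (Ici 0) t := by
    intro i
    have hMc : ContinuousOn (fun t => skew (U t).1 + corrMat k kG S t i (x i t)) (Ici 0) :=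
      (continuous_skew.comp_continuousOn (continuous_fst.comp_continuousOn hU)).add
        (continuousOn_corrMat hx hS i)
    obtain ⟨Ψ, Φ, hΨ0, hΦ0, hΨ, hΦ, hΨΦ, hΦΨ⟩ := exists_fundamental (continuous_comp_max hMc)
    have hΨc : Continuous Ψ :=
      continuousOn_univ.1 (continuousOn_of_hasMatDeriv fun t _ => hΨ t)
    have hVc : Continuous fun t => (U (max t 0)).2 :=
      continuous_comp_max (continuous_snd.comp_continuousOn hU)
    obtain ⟨F, hF0, hF⟩ := exists_antideriv
      (f := fun t => (-(rcoef i : ℝ)) • (Ψ t *ᵥ (U (max t 0)).2))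
      ((hΨc.matrix_mulVec hVc).fun_const_smul _)
    refine ⟨Φ, Ψ, F, hΨΦ, hΦ0, hF0, fun t => ⟨_, hΦ t⟩, fun t => ⟨_, hΨ t⟩,
      fun t => (hF t).differentiableAt, fun c t ht => ?_⟩
    have h1 := (((hΦ t).mono (subset_univ (Ici 0))).mulVec
      ((hasDerivWithinAt_const t (Ici 0) c).fun_add (hF t).hasDerivWithinAt))
    refine h1.congr_deriv ?_
    rw [max_eq_left (mem_Ici.1 ht), zero_add, Matrix.mulVec_smul, Matrix.mulVec_mulVec, hΦΨ,
      Matrix.one_mulVec, Matrix.neg_mulVec, ← Matrix.mulVec_mulVec, Matrix.add_mulVec, neg_smul]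
    abel
  choose Φ Ψ F h1 h2 h3 h4 h5 h6 h7 using hone
  exact ⟨Φ, Ψ, F, h1, h2, h3, h4, h5, h6, h7⟩

/-- A run exists as soon as the estimated landmarks, which solve linear equations, never meet the
robot, and the directions `u i = z i - rᵢ p` that the rotations of the robot about `p` have to fix
are generic. Here `p` is the estimate of a chosen point landmark `i₀`, or `0` if there is none. -/
theorem exists_observerRun (hU : ContinuousOn U (Ici 0)) (hx : TrueBody U ξ x h)
    (hS : RiccatiData kG kH σ U x S) {Φ Ψ : Idx np nb → ℝ → Mat3} {F : Idx np nb → ℝ → R3}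
    (hflow : LandmarkFlow k kG U S x Φ Ψ F) {ξ₀ : TotalSpace np nb} {c : Idx np nb → R3}
    (hrep : ∀ i, IsRep (body ξ₀ i) (c i) (rcoef i))
    (hne : ∀ i, ∀ t ∈ Ici (0 : ℝ), Φ i t *ᵥ (c i + F i t) ≠ 0)
    (p : ℝ → R3) (T : Set (Idx np nb))
    (hp : (∃ i₀, rcoef i₀ = 1 ∧ T = {i₀}ᶜ ∧ ∀ t, p t = Φ i₀ t *ᵥ (c i₀ + F i₀ t)) ∨
      ((∀ i : Idx np nb, rcoef i = 0) ∧ T = univ ∧ ∀ t, p t = 0))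
    (hTne : ∀ i ∈ T, ∀ t ∈ Ici (0 : ℝ), Φ i t *ᵥ (c i + F i t) - rcoef i • p t ≠ 0)
    (hTind : ∀ i ∈ T, ∀ j ∈ T, i ≠ j → ∀ t ∈ Ici (0 : ℝ),
      crossProduct (Φ i t *ᵥ (c i + F i t) - rcoef i • p t)
        (Φ j t *ᵥ (c j + F j t) - rcoef j • p t) ≠ 0) :
    ∃ X Δ, IsObserverRun k kG U ξ S ξ₀ (Ici 0) X Δ := by
  have hmax : ∀ t, max t 0 ∈ Ici (0 : ℝ) := fun t => mem_Ici.2 (le_max_right _ _)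
  have hmaxeq : ∀ {t : ℝ}, t ∈ Ici (0 : ℝ) → max t 0 = t := fun {t} ht => max_eq_left ht
  -- all signals are extended to the real line by their value at `0`
  set z : Idx np nb → ℝ → R3 := fun i t => Φ i (max t 0) *ᵥ (c i + F i (max t 0)) with hz
  set C : Idx np nb → ℝ → Mat3 := fun i t => corrMat k kG S (max t 0) i (x i (max t 0)) with hC
  set Ω : ℝ → R3 := fun t => (U (max t 0)).1 with hΩ
  set V : ℝ → R3 := fun t => (U (max t 0)).2 with hV
  have hzc : ∀ i, Continuous (z i) := fun i => by
    have h1 : ContinuousOn (fun t => Φ i t *ᵥ (c i + F i t)) (Ici 0) :=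
      fun t ht => (hflow.deriv i (c i) t ht).continuousWithinAt
    exact continuous_comp_max h1
  have hCc : ∀ i, Continuous (C i) := fun i => continuous_comp_max (continuousOn_corrMat hx hS i)
  have hΩc : Continuous Ω := continuous_comp_max (continuous_fst.comp_continuousOn hU)
  have hVc : Continuous V := continuous_comp_max (continuous_snd.comp_continuousOn hU)
  have hz0 : ∀ i t, z i t ≠ 0 := fun i t => hne i _ (hmax t)
  have hzz : ∀ i, Continuous fun t => (z i t ⬝ᵥ z i t)⁻¹ := fun i =>
    ((hzc i).dotProduct (hzc i)).inv₀ fun t => (dot_self_pos (hz0 i t)).ne'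
  set w : Idx np nb → ℝ → R3 := fun i t => C i t *ᵥ z i t with hw
  have hwc : ∀ i, Continuous (w i) := fun i => (hCc i).matrix_mulVec (hzc i)
  set ω : Idx np nb → ℝ → R3 := fun i t => Ω t -
    (rcoef i / (z i t ⬝ᵥ z i t)) • crossProduct (V t) (z i t)
      + (z i t ⬝ᵥ z i t)⁻¹ • crossProduct (z i t) (w i t) with hω
  set s : Idx np nb → ℝ → ℝ := fun i t => -(rcoef i * (V t ⬝ᵥ z i t) / (z i t ⬝ᵥ z i t)) +
    -((z i t ⬝ᵥ z i t)⁻¹ * (z i t ⬝ᵥ w i t)) with hs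
  have hωc : ∀ i, Continuous (ω i) := fun i => by
    simp only [hω, div_eq_mul_inv]
    exact (hΩc.sub ((continuous_const.mul (hzz i)).smul
      (continuous_crossProduct hVc (hzc i)))).add
      ((hzz i).smul (continuous_crossProduct (hzc i) (hwc i)))
  have hsc : ∀ i, Continuous (s i) := fun i => by
    simp only [hs, div_eq_mul_inv]
    exact (((continuous_const.mul (hVc.dotProduct (hzc i))).mul (hzz i)).neg).add
      ((hzz i).mul ((hzc i).dotProduct (hwc i))).neg
  have hzd : ∀ i, ∀ t ∈ Ici (0 : ℝ),
      HasDerivWithinAt (z i) (s i t • z i t - skew (ω i t) *ᵥ z i t) (Ici 0) t := by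
    intro i t ht
    have h1 := hflow.deriv i (c i) t ht
    have h2 : HasDerivWithinAt (z i) _ (Ici 0) t := h1.congr
      (fun u hu => by simp only [hz, hmaxeq hu]) (by simp only [hz, hmaxeq ht])
    refine h2.congr_deriv ?_
    rw [lift_add_innovation_apply (hz0 i t)]
    simp only [hΩ, hV, hw, hC, hz, hmaxeq ht]
  have hzi : ∀ i, z i 0 = c i := fun i => by
    simp [hz, hflow.start, hflow.start']
  choose Q hQ0 hQd hQrep using fun i => exists_scaledRotation_curve (hωc i) (hsc i) (hzd i)
  have hbody : ∀ (A : SE3) i, ∀ t ∈ Ici (0 : ℝ),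
      IsRep (body (upsilon (A, fun i => Q i t) ξ₀) i) (z i t) (rcoef i) := fun A i t ht => by
    rw [body_upsilon]
    exact hQrep i _ _ (by rw [hzi]; exact hrep i) t ht
  have hinn : ∀ (A : SE3) i, ∀ t ∈ Ici (0 : ℝ),
      innovation k kG S t (ξ t) (upsilon (A, fun i => Q i t) ξ₀) i =
        sotMat ((z i t ⬝ᵥ z i t)⁻¹ • crossProduct (z i t) (w i t))
          (-((z i t ⬝ᵥ z i t)⁻¹ * (z i t ⬝ᵥ w i t))) := fun A i t ht => by
    rw [innovation_eq (hx.ne_zero i t ht) (hz0 i t) (hx.rep i t ht) (hbody A i t ht)]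
    simp only [hw, hC, hmaxeq ht]
  -- the least-squares problem
  set u : Idx np nb → ℝ → R3 := fun i t => z i t - rcoef i • p (max t 0) with hu
  have hpc : Continuous fun t => p (max t 0) := by
    rcases hp with ⟨i₀, -, -, h3⟩ | ⟨-, -, h3⟩
    · simp only [h3]
      exact hzc i₀
    · simp only [h3]
      exact continuous_const
  obtain ⟨B, hBc, hB⟩ := exists_continuous_stabilizer
    (u := u) (fun i => (hzc i).sub (hpc.fun_const_smul _)) T
    (fun i hi t => by
      rcases hp with ⟨i₀, h1, h2, h3⟩ | ⟨h1, h2, h3⟩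
      · rw [h2, notMem_compl_iff, mem_singleton_iff] at hi
        simp only [hu, hz, hi, h1, h3, one_smul, sub_self]
      · rw [h2] at hi
        exact absurd (mem_univ i) hi)
    (fun i hi t => hTne i hi _ (hmax t))
    (fun i hi j hj hij t => hTind i hi j hj hij _ (hmax t))
  obtain ⟨τ, hτ⟩ : ∃ τ : ℝ, (∀ i : Idx np nb, rcoef i * τ = 0) ∧
      ∀ (t : ℝ) (d v : R3), (∀ i, crossProduct d (z i t) + rcoef i • v = 0) →
        ∃ v', v = crossProduct (p (max t 0)) d + τ • v' := by
    rcases hp with ⟨i₀, h1, h2, h3⟩ | ⟨h1, h2, h3⟩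
    · refine ⟨0, fun i => mul_zero _, fun t d v hd => ⟨0, ?_⟩⟩
      have h4 := hd i₀
      rw [h1, one_smul, show z i₀ t = p (max t 0) by rw [h3]] at h4
      rw [smul_zero, add_zero, ← cross_anticomm]
      exact eq_neg_of_add_eq_zero_right h4
    · refine ⟨1, fun i => by rw [h1, zero_mul], fun t d v _ => ⟨v, ?_⟩⟩
      simp [h3]
  set L : ℝ → Matrix (Fin 3 ⊕ Fin 3) (Fin 3 ⊕ Fin 3) ℝ := fun t =>
    Matrix.fromBlocks (B t) 0 (skew (p (max t 0)) * B t) (τ • (1 : Mat3)) with hL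
  have hLc : Continuous L :=
    hBc.matrix_fromBlocks continuous_const ((continuous_skew.comp hpc).matrix_mul hBc)
      continuous_const
  have hLw : ∀ t (w' : Fin 3 ⊕ Fin 3 → ℝ), L t *ᵥ w' =
      Sum.elim (B t *ᵥ fun a => w' (Sum.inl a)) (crossProduct (p (max t 0))
        (B t *ᵥ fun a => w' (Sum.inl a)) + τ • fun a => w' (Sum.inr a)) := by
    intro t w'
    rw [hL, Matrix.fromBlocks_mulVec, ← skew_mulVec, Matrix.mulVec_mulVec, Matrix.zero_mulVec,
      add_zero, Matrix.smul_mulVec, Matrix.one_mulVec]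
    rfl
  have hθc : ∀ i, Continuous fun t => hom (z i t) (rcoef i) := fun i =>
    continuous_hom (hzc i) continuous_const
  have hθ0 : ∀ i t, hom (z i t) (rcoef i) ≠ 0 := fun i t => hom_ne_zero_of_left (hz0 i t) _
  have hsqrt : ∀ i, Continuous fun t =>
      (Real.sqrt (hom (z i t) (rcoef i) ⬝ᵥ hom (z i t) (rcoef i)))⁻¹ := fun i =>
    (Real.continuous_sqrt.comp ((hθc i).dotProduct (hθc i))).inv₀
      fun t => (Real.sqrt_pos.2 (dot_self_pos (hθ0 i t))).ne'
  have hprojc : ∀ i, Continuous fun t => proj (hom (z i t) (rcoef i)) := fun i =>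
    continuous_proj (hθc i) (hθ0 i)
  have hskz : ∀ {f : ℝ → R3}, Continuous f → Continuous fun t => skew (f t) :=
    fun hf => continuous_skew.comp hf
  obtain ⟨d, hdc, hd⟩ := exists_continuous_leastSquares
    (C := fun i t => costMat (z i t) (rcoef i))
    (g := fun i t => (Real.sqrt (hom (z i t) (rcoef i) ⬝ᵥ hom (z i t) (rcoef i)))⁻¹ •
      (proj (hom (z i t) (rcoef i)) *ᵥ
        (sotMat ((z i t ⬝ᵥ z i t)⁻¹ • crossProduct (z i t) (w i t))
          (-((z i t ⬝ᵥ z i t)⁻¹ * (z i t ⬝ᵥ w i t))) *ᵥ hom (z i t) (rcoef i))))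
    (L := L)
    (fun i => (hsqrt i).smul ((hprojc i).matrix_mul
      ((hskz (hzc i)).neg.matrix_fromBlocks continuous_const continuous_const continuous_const)))
    (fun i => by
      simp only [sotMat_mulVec]
      exact (hsqrt i).smul ((hprojc i).matrix_mulVec (continuous_hom
        (continuous_crossProduct ((hzz i).smul (continuous_crossProduct (hzc i) (hwc i))) (hzc i))
        ((((hzz i).mul ((hzc i).dotProduct (hwc i))).neg).mul continuous_const))))
    hLc
    (fun t d => by
      simp only [costMat_mulVec_eq_zero_iff (hz0 _ t), hLw]
      constructor
      · intro h0
        obtain ⟨v', hv'⟩ := hτ.2 t _ _ h0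
        obtain ⟨w', hw'⟩ := (hB t (fun a => d (Sum.inl a))).1 (fun i => by
          have h1 := h0 i
          rw [hv', smul_add, smul_smul, hτ.1 i, zero_smul, add_zero,
            ← cross_anticomm _ (p (max t 0)), smul_neg, ← sub_eq_add_neg] at h1
          rw [hu, map_sub, map_smul]
          exact h1)
        refine ⟨Sum.elim w' v', ?_⟩
        funext a
        rcases a with a | a
        · exact congrFun hw' a
        · have h2 := congrFun hv' a
          rw [hw'] at h2
          exact h2
      · rintro ⟨w', hw'⟩ i
        set e := B t *ᵥ fun a => w' (Sum.inl a) with he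
        have h1 := (hB t e).2 ⟨_, he⟩ i
        rw [hu, map_sub, map_smul] at h1
        have h2 : (fun a => d (Sum.inl a)) = e := by rw [hw']; rfl
        have h3 : (fun a => d (Sum.inr a)) =
            crossProduct (p (max t 0)) e + τ • fun a => w' (Sum.inr a) := by rw [hw']; rfl
        rw [h2, h3, smul_add, smul_smul, hτ.1 i, zero_smul, add_zero,
          ← cross_anticomm _ (p (max t 0)), smul_neg, ← sub_eq_add_neg]
        exact h1)
  -- the pose
  set Δ : ℝ → Twist := fun t => (fun a => d t (Sum.inl a), fun a => d t (Sum.inr a)) with hΔ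
  have hΔc : Continuous Δ :=
    (continuous_pi fun a => (continuous_apply (Sum.inl a)).comp hdc).prodMk
      (continuous_pi fun a => (continuous_apply (Sum.inr a)).comp hdc)
  obtain ⟨A, hA0, hAd⟩ := exists_pose_curve
    (W := fun t => U (max t 0) + Δ t) ((continuous_comp_max hU).add hΔc)
  refine ⟨fun t => (A t, fun i => Q i t), Δ, ?_, ?_, ?_, ?_⟩
  · exact Prod.ext hA0 (funext fun i => hQ0 i)
  · intro t ht d'
    rw [robotCost_eq (fun i => hbody (A t) i t ht), robotCost_eq (fun i => hbody (A t) i t ht)]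
    simp only [fun i => hinn (A t) i t ht]
    have h1 : Sum.elim (Δ t).1 (Δ t).2 = d t := by
      funext a
      rcases a with a | a <;> rfl
    rw [h1]
    exact hd t (Sum.elim d'.1 d'.2)
  · intro t ht
    have h1 := (hAd t).mono (subset_univ (Ici (0 : ℝ)))
    rw [hmaxeq ht, ← twistMat_add] at h1
    exact h1
  · intro i t ht
    rw [(hbody (A t) i t ht).lift_eq, hinn (A t) i t ht, sotMat_add]
    have h1 := (hQd i t).mono (subset_univ (Ici (0 : ℝ)))
    simp only [hω, hs, hΩ, hV, hmaxeq ht] at h1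
    exact h1

end Existence

/-! ### Almost every reference configuration is generic -/

/-- A differentiable self-map that is constant along a fixed direction has a null range: its
derivative is everywhere singular (Sard). -/
theorem measure_range_eq_zero_of_add_smul_eq {E : Type*} [NormedAddCommGroup E] [NormedSpace ℝ E]
    [FiniteDimensional ℝ E] [MeasurableSpace E] [BorelSpace E] (μ : Measure E)
    [μ.IsAddHaarMeasure] {f : E → E} (hf : Differentiable ℝ f) {v : E} (hv : v ≠ 0)
    (h : ∀ x, ∀ τ : ℝ, f (x + τ • v) = f x) : μ (range f) = 0 := by
  rw [← image_univ]
  refine addHaar_image_eq_zero_of_det_fderivWithin_eq_zero μ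
    (fun x _ => (hf x).hasFDerivAt.hasFDerivWithinAt) fun x _ => ?_
  have h0 : fderiv ℝ f x v = 0 := by
    have h1 : HasDerivAt (fun τ : ℝ => x + τ • v) v 0 := by
      simpa using ((hasDerivAt_id (0 : ℝ)).smul_const v).const_add x
    have h2 : HasFDerivAt f (fderiv ℝ f x) (x + (0 : ℝ) • v) := by
      rw [zero_smul, add_zero]
      exact (hf x).hasFDerivAt
    have h3 := h2.comp_hasDerivAt 0 h1
    have h4 : f ∘ (fun τ : ℝ => x + τ • v) = fun _ => f x := funext fun τ => h x τ
    rw [h4] at h3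
    exact h3.unique (hasDerivAt_const 0 (f x))
  by_contra hdet
  have h1 : LinearMap.ker (fderiv ℝ f x : E →ₗ[ℝ] E) = ⊥ :=
    LinearMap.ker_eq_bot'.2 fun w hw => by
      have h2 := (LinearEquiv.ofIsUnitDet (f := (fderiv ℝ f x : E →ₗ[ℝ] E))
        (v := Module.finBasis ℝ E) (v' := Module.finBasis ℝ E) (by
          rw [LinearMap.det_toMatrix]
          exact isUnit_iff_ne_zero.2 hdet)).injective
      exact h2 (by simpa using hw)
  exact hv (LinearMap.ker_eq_bot'.1 h1 v h0)

theorem differentiable_mulVec {E : Type*} [NormedAddCommGroup E] [NormedSpace ℝ E] {M : E → Mat3}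
    {v : E → R3} (hM : ∀ a b, Differentiable ℝ fun x => M x a b) (hv : Differentiable ℝ v) :
    Differentiable ℝ fun x => M x *ᵥ v x := by
  refine differentiable_pi.2 fun a => ?_
  simp only [Matrix.mulVec, dotProduct]
  exact Differentiable.fun_sum fun b _ => (hM a b).mul (differentiable_pi.1 hv b)

theorem differentiable_update {ι : Type} [Fintype ι] [DecidableEq ι] (l : ι)
    {g : (ι → R3) → R3} (hg : Differentiable ℝ g) :
    Differentiable ℝ fun q : ι → R3 => Function.update q l (g q) := by
  refine differentiable_pi.2 fun i => ?_
  rcases eq_or_ne i l with rfl | hi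
  · simpa using hg
  · simpa [hi] using differentiable_apply (𝕜 := ℝ) i

/-- The vectors `q` with `q l` orthogonal to `n ≠ 0` form a null set. -/
theorem volume_setOf_dotProduct_eq_zero {ι : Type} [Fintype ι] [DecidableEq ι] (l : ι) {n : R3}
    (hn : n ≠ 0) : volume {q : ι → R3 | n ⬝ᵥ q l = 0} = 0 := by
  refine measure_mono_null ?_ (measure_range_eq_zero_of_add_smul_eq volume
    (differentiable_update l (g := fun q => proj n *ᵥ q l)
      (differentiable_mulVec (fun a b => differentiable_const _) (differentiable_apply l)))
    (v := Pi.single l n) (by simpa using hn) fun q τ => ?_)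
  · intro q hq
    refine ⟨q, ?_⟩
    change Function.update q l (proj n *ᵥ q l) = q
    rw [proj_mulVec, show n ⬝ᵥ q l = 0 from hq]
    simp
  · funext i
    rcases eq_or_ne i l with rfl | hi
    · simp [Matrix.mulVec_add, Matrix.mulVec_smul, proj_mulVec_self hn]
    · simp [hi]

section Generic

variable {np nb : ℕ} {k kG : ℝ} {U : ℝ → Twist} {S : Fin np → ℝ → Mat3}
  {x : Idx np nb → ℝ → R3} {Φ Ψ : Idx np nb → ℝ → Mat3} {F : Idx np nb → ℝ → R3}

/-- The landmark `i` at time `t` in the coordinates of the linear flow, if it starts at `q` in the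
inertial frame of the pose `P`. -/
def flowPosition (P : SE3) (Φ : Idx np nb → ℝ → Mat3) (F : Idx np nb → ℝ → R3)
    (i : Idx np nb) (t : ℝ) (q : Idx np nb → R3) : R3 :=
  Φ i t *ᵥ ((rot P)ᵀ *ᵥ (q i - rcoef i • trans P) + F i t)

theorem LandmarkFlow.differentiable_entry (hflow : LandmarkFlow k kG U S x Φ Ψ F) (i a b) :
    (Differentiable ℝ fun t => Φ i t a b) ∧ Differentiable ℝ fun t => Ψ i t a b := by
  refine ⟨fun t => ?_, fun t => ?_⟩
  · obtain ⟨M, hM⟩ := hflow.diff i t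
    exact (hasDerivWithinAt_univ.1 (hM a b)).differentiableAt
  · obtain ⟨M, hM⟩ := hflow.diff' i t
    exact (hasDerivWithinAt_univ.1 (hM a b)).differentiableAt

theorem LandmarkFlow.differentiable_flowPosition (hflow : LandmarkFlow k kG U S x Φ Ψ F) (P : SE3)
    (i : Idx np nb) :
    Differentiable ℝ fun w : ℝ × (Idx np nb → R3) => flowPosition P Φ F i w.1 w.2 :=
  differentiable_mulVec
    (fun a b => (hflow.differentiable_entry i a b).1.fun_comp differentiable_fst)
    ((differentiable_mulVec (fun a b => differentiable_const ((rot P)ᵀ a b))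
      ((differentiable_pi.1 differentiable_snd i).fun_sub (differentiable_const _))).fun_add
      ((hflow.diffF i).fun_comp differentiable_fst))

theorem flowPosition_update_of_ne (P : SE3) {i l : Idx np nb} (h : i ≠ l) (t : ℝ)
    (q : Idx np nb → R3) (y : R3) :
    flowPosition P Φ F i t (Function.update q l y) = flowPosition P Φ F i t q := by
  rw [flowPosition, flowPosition, Function.update_of_ne h]

/-- The curves of the landmark `l` meet a moving line, which depends on the other landmarks only,
just for a null set of initial configurations: such configurations have a parametrization by the
other landmarks, a time and a parameter on the line, and so one parameter is missing. -/
theorem LandmarkFlow.volume_meets_line (hflow : LandmarkFlow k kG U S x Φ Ψ F) (P : SE3)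
    (l : Idx np nb) {a u : ℝ → (Idx np nb → R3) → R3}
    (ha : Differentiable ℝ fun w : ℝ × (Idx np nb → R3) => a w.1 w.2)
    (hu : Differentiable ℝ fun w : ℝ × (Idx np nb → R3) => u w.1 w.2)
    (ha' : ∀ t q y, a t (Function.update q l y) = a t q)
    (hu' : ∀ t q y, u t (Function.update q l y) = u t q) :
    volume {q | ∃ t s : ℝ, flowPosition P Φ F l t q = a t q + s • u t q} = 0 := by
  set g : (Idx np nb → R3) → R3 := fun q =>
    rot P *ᵥ (Ψ l (q l 0) *ᵥ (a (q l 0) q + q l 1 • u (q l 0) q) - F l (q l 0))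
      + rcoef l • trans P with hg
  have hco : ∀ b, Differentiable ℝ fun q : Idx np nb → R3 => q l b := fun b =>
    differentiable_pi.1 (differentiable_apply (𝕜 := ℝ) l) b
  have hpair : Differentiable ℝ fun q : Idx np nb → R3 => (q l 0, q) :=
    (hco 0).prodMk differentiable_id
  have hgd : Differentiable ℝ g :=
    (differentiable_mulVec (fun a b => differentiable_const (rot P a b))
      ((differentiable_mulVec (fun a b => (hflow.differentiable_entry l a b).2.fun_comp (hco 0))
        ((ha.fun_comp hpair).fun_add ((hco 1).fun_smul (hu.fun_comp hpair)))).fun_sub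
        ((hflow.diffF l).fun_comp (hco 0)))).fun_add (differentiable_const _)
  have hg' : ∀ q y, g (Function.update q l y) =
      rot P *ᵥ (Ψ l (y 0) *ᵥ (a (y 0) q + y 1 • u (y 0) q) - F l (y 0)) + rcoef l • trans P :=
    fun q y => by simp only [hg, Function.update_self, ha', hu']
  refine measure_mono_null ?_ (measure_range_eq_zero_of_add_smul_eq volume
    (differentiable_update l hgd) (v := Pi.single l (Pi.single 2 1 : R3)) (by simp) fun q τ => ?_)
  · rintro q ⟨t, s, h⟩
    refine ⟨Function.update q l ![t, s, 0], ?_⟩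
    simp only [hg', Function.update_idem]
    have h1 : (rot P)ᵀ *ᵥ (q l - rcoef l • trans P) =
        Ψ l t *ᵥ (a t q + s • u t q) - F l t := by
      rw [← h, flowPosition, Matrix.mulVec_mulVec, hflow.left_inv, Matrix.one_mulVec,
        add_sub_cancel_right]
    refine Function.update_eq_self_iff.2 ?_
    change rot P *ᵥ (Ψ l t *ᵥ (a t q + s • u t q) - F l t) + rcoef l • trans P = q l
    rw [← h1, rot_mulVec_transpose, sub_add_cancel]
  · have h1 : q + τ • (Pi.single l (Pi.single 2 1) : Idx np nb → R3) =
        Function.update q l (q l + τ • (Pi.single 2 1 : R3)) := by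
      funext i
      rcases eq_or_ne i l with rfl | hi
      · simp
      · simp [hi]
    simp only [h1, hg', Function.update_idem]
    simp [hg]

end Generic

section Basin

variable {np nb : ℕ} {k kG kH σ : ℝ} {U : ℝ → Twist} {ξ : ℝ → TotalSpace np nb}
  {S : Fin np → ℝ → Mat3} {x : Idx np nb → ℝ → R3} {h : Idx np nb → R3}

/-- For almost every configuration no estimated landmark meets the robot, the directions seen from
the centre of the admissible rotations of the robot are never parallel, and no bearing starts
orthogonal to the true one. -/
theorem ae_config_mem_basin (hU : ContinuousOn U (Ici 0)) (hx : TrueBody U ξ x h)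
    (hS : RiccatiData kG kH σ U x S) (hred : ∀ t ∈ Ici (0 : ℝ), ξ t ∈ reducedTotalSpace np nb)
    (hk : 1 / 2 < k) (hkG : 0 < kG) (hkH : 0 < kH) (hσ : 0 < σ) (P₀ : SE3) :
    ∀ᵐ pb : (Fin np → R3) × (Fin nb → R3), ∀ hb : ∀ j, pb.2 j ≠ 0,
      config P₀ pb.1 pb.2 hb ∈ basin k kG U ξ S := by
  obtain ⟨Φ, Ψ, F, hflow⟩ := exists_landmarkFlow k hU hx hS
  set Z := flowPosition P₀ Φ F with hZ
  have hZd := hflow.differentiable_flowPosition P₀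
  -- the point about which the robot may rotate, and the landmarks that it sees from there
  obtain ⟨p, T, hpd, hp', hp⟩ : ∃ (p : ℝ → (Idx np nb → R3) → R3) (T : Set (Idx np nb)),
      (Differentiable ℝ fun w : ℝ × (Idx np nb → R3) => p w.1 w.2) ∧
      (∀ l ∈ T, ∀ t q y, p t (Function.update q l y) = p t q) ∧
      ((∃ i₀, rcoef i₀ = 1 ∧ T = {i₀}ᶜ ∧ p = Z i₀) ∨
        ((∀ i : Idx np nb, rcoef i = 0) ∧ T = univ ∧ p = 0)) := by
    rcases isEmpty_or_nonempty (Fin np) with he | ⟨⟨i₀⟩⟩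
    · refine ⟨0, univ, differentiable_const 0, fun _ _ _ _ _ => rfl, Or.inr ⟨?_, rfl, rfl⟩⟩
      rintro (i | j)
      · exact he.elim i
      · rfl
    · exact ⟨Z (Sum.inl i₀), {Sum.inl i₀}ᶜ, hZd _,
        fun l hl t q y => flowPosition_update_of_ne P₀ (Ne.symm hl) t q y,
        Or.inl ⟨_, rfl, rfl, rfl⟩⟩
  have h1 : ∀ᵐ q : Idx np nb → R3, ∀ i, ∀ t, Z i t q ≠ 0 := by
    refine ae_all_iff.2 fun i => ?_
    have h0 := hflow.volume_meets_line P₀ i (a := 0) (u := 0) (differentiable_const 0)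
      (differentiable_const 0) (fun _ _ _ => rfl) (fun _ _ _ => rfl)
    filter_upwards [measure_eq_zero_iff_ae_notMem.1 h0] with q hq t h2
    exact hq ⟨t, 0, by simpa using h2⟩
  have h2 : ∀ᵐ q : Idx np nb → R3, ∀ i, i ∈ T → ∀ t, Z i t q - rcoef i • p t q ≠ 0 := by
    refine ae_all_iff.2 fun i => ?_
    by_cases hi : i ∈ T
    · have h0 := hflow.volume_meets_line P₀ i (a := fun t q => rcoef i • p t q) (u := 0)
        (hpd.fun_const_smul _) (differentiable_const 0) (fun t q y => by rw [hp' i hi])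
        (fun _ _ _ => rfl)
      filter_upwards [measure_eq_zero_iff_ae_notMem.1 h0] with q hq _ t h2
      exact hq ⟨t, 0, by simpa using sub_eq_zero.1 h2⟩
    · exact Eventually.of_forall fun q hi' => absurd hi' hi
  have h3 : ∀ᵐ q : Idx np nb → R3, ∀ i j, i ∈ T → j ∈ T → i ≠ j → ∀ t s : ℝ,
      Z i t q ≠ rcoef i • p t q + s • (Z j t q - rcoef j • p t q) := by
    refine ae_all_iff.2 fun i => ae_all_iff.2 fun j => ?_
    by_cases hij : i ∈ T ∧ j ∈ T ∧ i ≠ j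
    · obtain ⟨hi, hj, hne⟩ := hij
      have h0 := hflow.volume_meets_line P₀ i (a := fun t q => rcoef i • p t q)
        (u := fun t q => Z j t q - rcoef j • p t q)
        (hpd.fun_const_smul _) ((hZd j).fun_sub (hpd.fun_const_smul _))
        (fun t q y => by rw [hp' i hi])
        (fun t q y => by rw [hp' i hi, hZ, flowPosition_update_of_ne P₀ hne.symm])
      filter_upwards [measure_eq_zero_iff_ae_notMem.1 h0] with q hq _ _ _ t s h2
      exact hq ⟨t, s, h2⟩
    · exact Eventually.of_forall fun q hi hj hne => absurd ⟨hi, hj, hne⟩ hij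
  have h4 : ∀ᵐ q : Idx np nb → R3, ∀ j, (rot P₀ *ᵥ x (Sum.inr j) 0) ⬝ᵥ q (Sum.inr j) ≠ 0 := by
    refine ae_all_iff.2 fun j => ?_
    have hn : rot P₀ *ᵥ x (Sum.inr j) 0 ≠ 0 := fun h0 =>
      hx.ne_zero (Sum.inr j) 0 (mem_Ici.2 le_rfl) (by
        have h5 := congrArg (fun v => (rot P₀)ᵀ *ᵥ v) h0
        simpa only [Matrix.mulVec_mulVec, so3_transpose_mul (rot_mem_and_poseMat P₀).1,
          Matrix.one_mulVec, Matrix.mulVec_zero] using h5)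
    exact measure_eq_zero_iff_ae_notMem.1 (volume_setOf_dotProduct_eq_zero (Sum.inr j) hn)
  have hmp := volume_measurePreserving_sumPiEquivProdPi_symm fun _ : Idx np nb => R3
  filter_upwards [hmp.quasiMeasurePreserving.ae h1, hmp.quasiMeasurePreserving.ae h2,
    hmp.quasiMeasurePreserving.ae h3, hmp.quasiMeasurePreserving.ae h4] with pb g1 g2 g3 g4 hb
  set q : Idx np nb → R3 := (MeasurableEquiv.sumPiEquivProdPi fun _ : Idx np nb => R3).symm pb
    with hq
  have hql : ∀ i, q (Sum.inl i) = pb.1 i := fun i => rfl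
  have hqr : ∀ j, q (Sum.inr j) = pb.2 j := fun j => rfl
  set c : Idx np nb → R3 := fun i => (rot P₀)ᵀ *ᵥ (q i - rcoef i • trans P₀) with hc
  have hrep : ∀ i, IsRep (body (config P₀ pb.1 pb.2 hb) i) (c i) (rcoef i) := by
    intro i
    refine IsRep.pose_inv_smul ?_ P₀
    rcases i with i | j
    · exact ⟨_, rfl⟩
    · exact ⟨_, rfl⟩
  have hne : ∀ i, ∀ t ∈ Ici (0 : ℝ), Φ i t *ᵥ (c i + F i t) ≠ 0 := fun i t _ => g1 i t
  have hmem : config P₀ pb.1 pb.2 hb ∈ reducedTotalSpace np nb := by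
    refine mem_reducedTotalSpace (z := c) (fun i h0 => ?_) hrep
    have h5 := hne i 0 (mem_Ici.2 le_rfl)
    rw [hflow.start, hflow.start', h0] at h5
    simp at h5
  refine ⟨hmem, ?_, fun X Δ hrun => hrun.convergesUpToEquiv hx hS hred hk hkG hkH hσ hmem ?_⟩
  · refine exists_observerRun hU hx hS hflow hrep hne (fun t => p t q) T ?_
      (fun i hi t _ => g2 i hi t) fun i hi j hj hij t _ h0 => ?_
    · rcases hp with ⟨i₀, e1, e2, e3⟩ | ⟨e1, e2, e3⟩
      · exact Or.inl ⟨i₀, e1, e2, fun t => by rw [e3]; rfl⟩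
      · exact Or.inr ⟨e1, e2, fun t => by rw [e3]; rfl⟩
    · have h5 := eq_smul_of_cross_eq_zero (g2 j hj t) h0
      exact g3 i j hi hj hij t _ (eq_add_of_sub_eq' h5)
  · intro j
    have hx0 := hx.ne_zero (Sum.inr j) 0 (mem_Ici.2 le_rfl)
    have hc0 : c (Sum.inr j) ≠ 0 := fun h0 => g1 (Sum.inr j) 0 (by
      change Φ _ 0 *ᵥ (c (Sum.inr j) + F _ 0) = 0
      rw [hflow.start', h0, add_zero, Matrix.mulVec_zero])
    have h5 : x (Sum.inr j) 0 ⬝ᵥ c (Sum.inr j) ≠ 0 := by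
      have h6 := g4 j
      rw [← Matrix.vecMul_transpose, ← Matrix.dotProduct_mulVec] at h6
      have h7 : c (Sum.inr j) = (rot P₀)ᵀ *ᵥ q (Sum.inr j) := by
        simp [hc, rcoef]
      rw [h7]
      exact h6
    rw [bearingError_eq hx0 hc0 (hx.rep (Sum.inr j) 0 (mem_Ici.2 le_rfl)) (hrep (Sum.inr j))]
    have h8 := dot_self_pos hx0
    have h9 := dot_self_pos hc0
    have : 0 < (x (Sum.inr j) 0 ⬝ᵥ c (Sum.inr j)) ^ 2 := by positivity
    have : 0 < (x (Sum.inr j) 0 ⬝ᵥ c (Sum.inr j)) ^ 2 /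
      (x (Sum.inr j) 0 ⬝ᵥ x (Sum.inr j) 0 * c (Sum.inr j) ⬝ᵥ c (Sum.inr j)) := by positivity
    linarith

end Basin

end VisualSlam

theorem theorem1 (np nb : ℕ)
    -- the velocity input and the true state
    (U : ℝ → Twist) (hU : ContinuousOn U (Ici 0))
    (ξ : ℝ → TotalSpace np nb) (hξ : IsTrajectory U ξ)
    (hred : ∀ t ∈ Ici (0 : ℝ), ξ t ∈ reducedTotalSpace np nb)
    -- the gains and the Riccati solutions
    (k kG kH : ℝ) (hk : 1 / 2 < k) (hkG : 0 < kG) (hkH : 0 < kH)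
    (S : Fin np → ℝ → Matrix (Fin 3) (Fin 3) ℝ)
    (hS₀ : ∀ i, (S i 0).PosDef) (hS : SolvesRiccati kG kH U ξ S)
    -- persistence of excitation
    (hPE : ∃ δ > 0, ∃ μ > 0, PersistentlyExciting ξ δ μ) :
    -- almost every initial estimate lies in the basin of attraction
    (∀ P₀ : SE3, ∀ᵐ pb : (Fin np → R3) × (Fin nb → R3), ∀ hb : ∀ j, pb.2 j ≠ 0,
      config P₀ pb.1 pb.2 hb ∈ basin k kG U ξ S) ∧
    -- the true state is stable
    (∀ ε > 0, ∃ δ > 0, ∀ ξ₀ ∈ reducedTotalSpace np nb, errorSq ξ₀ (ξ 0) < δ →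
      ∀ T ≥ 0, ∀ X Δ, IsObserverRun k kG U ξ S ξ₀ (Icc 0 T) X Δ →
        ∀ t ∈ Icc 0 T, errorSq (upsilon (X t) ξ₀) (ξ t) < ε) ∧
    -- convergence is exponential on every compact subset of the basin of attraction
    (∀ 𝒦 ⊆ basin k kG U ξ S, IsCompact 𝒦 → ∃ lam > 0, ∃ M > 0,
      ∀ ξ₀ ∈ 𝒦, ∀ X Δ, IsObserverRun k kG U ξ S ξ₀ (Ici 0) X Δ → ∀ t ∈ Ici (0 : ℝ),
        lyapunov S t (upsilon (X t) ξ₀) (ξ t) ≤ Real.exp (-lam * t) * lyapunov S 0 ξ₀ (ξ 0) ∧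
        errorSq (upsilon (X t) ξ₀) (ξ t) ≤ M * Real.exp (-lam * t) * errorSq ξ₀ (ξ 0)) := by
  obtain ⟨x, h, hx⟩ := exists_trueBody hξ hred
  obtain ⟨σ, hσ, hR⟩ := exists_riccatiData hU hξ hx hkG hkH hS₀ hS hPE
  refine ⟨ae_config_mem_basin hU hx hR hred hk hkG hkH hσ,
    stability hx hR hred hk hkG hkH hσ, fun K hK hKc => ?_⟩
  obtain ⟨c, hc, hgap⟩ := exists_bearing_gap hx hred hK hKc
  exact exponential_bounds hx hR hred hk hkG hkH hσ (fun _ hm => (hK hm).1) hc hgap
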